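/- Let $R$ be an excellent normal local domain with maximal ideal $m_R$ and quotient field $K$, let $K'$ be a finite field extension of $K$, and let $R'$ be a normal local ring with quotient field $K'$ and maximal ideal $m_{R'}$ which lies over $R$, that is, $R'$ is the localization of the integral closure of $R$ in $K'$ at a maximal ideal. Then the completions $\hat R$ and $\hat R'$ of $R$ and $R'$ at their maximal ideals are domains, the induced map $\hat R\to\hat R'$ is injective, and, writing $E$ and $E'$ for the quotient fields of $\hat R$ and $\hat R'$, the extensions $E'/E$ and $(R'/m_{R'})/(R/m_R)$ are finite. Put $$d(R':R)=[E':E],\qquad g(R':R)=[R'/m_{R'}:R/m_R]_s,\qquad r(R':R)=\frac{d(R':R)}{g(R':R)},$$ where $[\,\cdot:\cdot\,]_s$ is the separable degree. Then $R\to R'$ is unramified (that is, $m_RR'=m_{R'}$ and $R'/m_{R'}$ is a finite separable extension of $R/m_R$) if and only if $r(R':R)=1$. -/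

import Mathlib

open IsLocalRing

universe u v w

/-! ### Excellent rings -/

/-- A Noetherian algebra `A` over a field `k` is geometrically regular if `L ⊗[k] A` is a regular
ring for every finite field extension `L` of `k`. -/
def IsGeometricallyRegular (k : Type u) (A : Type v) [Field k] [CommRing A] [Algebra k A] : Prop :=
  ∀ (L : Type u) [Field L] [Algebra k L] [FiniteDimensional k L],
    IsRegularRing (TensorProduct k L A)

/-- A ring is catenary if for all primes `p ≤ q` the chains of primes from `p` to `q` have bounded
length and all the saturated chains have the same length `n` (which is then the bound). -/
def IsCatenaryRing (R : Type u) [CommRing R] : Prop :=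
  ∀ p q : PrimeSpectrum R, p ≤ q → ∃ n : ℕ, ∀ s : LTSeries (PrimeSpectrum R),
    s.head = p → s.last = q →
      s.length ≤ n ∧ ((∀ i : Fin s.length, s i.castSucc ⋖ s i.succ) → s.length = n)

/-- The completion of a local ring at its maximal ideal. -/
abbrev LocalCompletion (R : Type u) [CommRing R] [IsLocalRing R] : Type u :=
  AdicCompletion (maximalIdeal R) R

/-- The formal fibres of a local ring `A` (the fibres of `A → Â` over the primes of `A`) are
geometrically regular. -/
def HasGeometricallyRegularFormalFibers (A : Type u) [CommRing A] [IsLocalRing A] : Prop :=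
  ∀ (p : Ideal A) [p.IsPrime],
    IsGeometricallyRegular p.ResidueField (p.Fiber (LocalCompletion A))

/-- An excellent ring: a Noetherian ring that is universally catenary, a G-ring and J-2. -/
class IsExcellentRing (R : Type u) [CommRing R] : Prop extends IsNoetherianRing R where
  /-- Every finite type algebra is catenary. -/
  universallyCatenary : ∀ (B : Type u) [CommRing B] [Algebra R B] [Algebra.FiniteType R B],
    IsCatenaryRing B
  /-- The formal fibres of every localization at a prime are geometrically regular
  (here `A` is any model of the localization of `R` at `p`). -/
  formalFibers : ∀ (p : Ideal R) [p.IsPrime] (A : Type u) [CommRing A] [Algebra R A]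
    [IsLocalization.AtPrime A p] [IsLocalRing A], HasGeometricallyRegularFormalFibers A
  /-- The regular locus of every finite type algebra is open. -/
  isOpen_regularLocus : ∀ (B : Type u) [CommRing B] [Algebra R B] [Algebra.FiniteType R B],
    IsOpen {p : PrimeSpectrum B | IsRegularLocalRing (Localization.AtPrime p.asIdeal)}

/-! ### Local rings of a finite field extension -/

/-- Let `R` be a ring contained in a field `K'` and `R'` a local ring with quotient field `K'`.
Then `R'` lies over `R` if, as a subring of `K'`, it is the localization at some maximal ideal
of the integral closure of `R` in `K'`. -/
def LiesOver (R : Type u) (K' : Type v) (R' : Type w) [CommRing R] [Field K'] [CommRing R']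
    [Algebra R K'] [Algebra R' K'] : Prop :=
  ∃ n : Ideal (integralClosure R K'), n.IsMaximal ∧
    ∀ x : K', x ∈ (algebraMap R' K').range ↔
      ∃ a b : integralClosure R K', b ∉ n ∧ x = (a : K') / (b : K')

/-- If `R'` lies over the local ring `R`, then `R'` dominates `R`. -/
theorem LiesOver.isLocalHom {R : Type u} {K' : Type v} {R' : Type w} [CommRing R] [IsLocalRing R]
    [Field K'] [CommRing R'] [Algebra R K'] [Algebra R' K'] [Algebra R R'] [IsScalarTower R R' K']
    (h : LiesOver R K' R') : IsLocalHom (algebraMap R R') := by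
  obtain ⟨n, hn, H⟩ := h
  refine ⟨fun x hx => ?_⟩
  by_contra hxu
  have hmax : (n.comap (algebraMap R (integralClosure R K'))).IsMaximal :=
    Ideal.isMaximal_comap_of_isIntegral_of_isMaximal n
  have hxn : algebraMap R (integralClosure R K') x ∈ n := by
    have h1 : x ∈ n.comap (algebraMap R (integralClosure R K')) := by
      rw [eq_maximalIdeal hmax]
      exact (mem_maximalIdeal x).2 hxu
    exact h1
  obtain ⟨y, hy⟩ := hx.exists_right_inv
  have hxy : algebraMap R K' x * algebraMap R' K' y = 1 := by
    rw [IsScalarTower.algebraMap_apply R R' K', ← map_mul, hy, map_one]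
  obtain ⟨a, b, hb, hab⟩ := (H (algebraMap R' K' y)).1 ⟨y, rfl⟩
  have hb0 : (b : K') ≠ 0 := by
    intro h0
    apply hb
    have h2 : b = 0 := Subtype.ext h0
    rw [h2]
    exact n.zero_mem
  apply hb
  have h3 : b = algebraMap R (integralClosure R K') x * a := by
    apply Subtype.ext
    change (b : K') = algebraMap R K' x * (a : K')
    rw [hab] at hxy
    field_simp at hxy
    exact hxy.symm
  rw [h3]
  exact n.mul_mem_right _ hxn

section Dominating

variable (R : Type u) (R' : Type v) [CommRing R] [CommRing R'] [IsLocalRing R] [IsLocalRing R']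
  [Algebra R R'] [IsLocalHom (algebraMap R R')]

/-- A local homomorphism `R → R'` is unramified: the maximal ideal of `R` generates the
maximal ideal of `R'` and the residue field extension is finite separable. -/
def IsUnramifiedLocalExtension : Prop :=
  (maximalIdeal R).map (algebraMap R R') = maximalIdeal R' ∧
    Module.Finite (ResidueField R) (ResidueField R') ∧
    Algebra.IsSeparable (ResidueField R) (ResidueField R')

theorem maximalIdeal_pow_le_comap (n : ℕ) :
    maximalIdeal R ^ n ≤ (maximalIdeal R' ^ n).comap (algebraMap R R') := by
  rw [← Ideal.map_le_iff_le_comap, Ideal.map_pow]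
  exact Ideal.pow_right_mono
    (((local_hom_TFAE (algebraMap R R')).out 0 2 rfl rfl).mp inferInstance) n

/-- The map `R̂ → R / m ^ n → R' / m' ^ n`. -/
noncomputable def completionMapAux (n : ℕ) : LocalCompletion R →+* R' ⧸ maximalIdeal R' ^ n :=
  (Ideal.quotientMap (maximalIdeal R' ^ n) (algebraMap R R')
    (maximalIdeal_pow_le_comap R R' n)).comp (AdicCompletion.evalₐ (maximalIdeal R) n).toRingHom

theorem factorPow_comp_completionMapAux {m n : ℕ} (hle : m ≤ n) :
    (Ideal.Quotient.factorPow (maximalIdeal R') hle).comp (completionMapAux R R' n) =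
      completionMapAux R R' m := by
  ext x
  obtain ⟨x, rfl⟩ := AdicCompletion.mk_surjective (maximalIdeal R) R x
  simp only [completionMapAux, RingHom.comp_apply, AlgHom.toRingHom_eq_coe, RingHom.coe_coe,
    AdicCompletion.evalₐ_mk, Ideal.quotientMap_mk]
  have h := congrArg (Ideal.quotientMap (maximalIdeal R' ^ m) (algebraMap R R')
    (maximalIdeal_pow_le_comap R R' m)) (AdicCompletion.Ideal.mk_eq_mk (maximalIdeal R) hle x)
  rw [Ideal.quotientMap_mk, Ideal.quotientMap_mk] at h
  exact h

/-- The map `R̂ → R̂'` induced by a local homomorphism `R → R'`: the inverse limit of the maps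
`R / m ^ n → R' / m' ^ n`. -/
noncomputable def completionMap : LocalCompletion R →+* LocalCompletion R' :=
  AdicCompletion.liftRingHom (maximalIdeal R') (completionMapAux R R')
    (factorPow_comp_completionMapAux R R')

theorem evalₐ_completionMap (n : ℕ) (x : LocalCompletion R) :
    AdicCompletion.evalₐ (maximalIdeal R') n (completionMap R R' x) =
      Ideal.quotientMap (maximalIdeal R' ^ n) (algebraMap R R') (maximalIdeal_pow_le_comap R R' n)
        (AdicCompletion.evalₐ (maximalIdeal R) n x) :=
  AdicCompletion.evalₐ_liftRingHom (maximalIdeal R') (completionMapAux R R')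
    (factorPow_comp_completionMapAux R R') n x

theorem completionMap_algebraMap (x : R) :
    completionMap R R' (algebraMap R (LocalCompletion R) x) =
      algebraMap R' (LocalCompletion R') (algebraMap R R' x) := by
  refine AdicCompletion.ext_evalₐ fun n => ?_
  rw [evalₐ_completionMap, AlgHom.commutes, AlgHom.commutes]
  exact Ideal.quotientMap_mk

variable {R R'}

/-- The map `E → E'` between the quotient fields of `R̂` and `R̂'`. -/
noncomputable def completionFractionMap [IsDomain (LocalCompletion R)]
    [IsDomain (LocalCompletion R')] (h : Function.Injective (completionMap R R')) :
    FractionRing (LocalCompletion R) →+* FractionRing (LocalCompletion R') :=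
  IsFractionRing.map h

/-- `d(R':R) = [E':E]`, where `E` and `E'` are the quotient fields of `R̂` and `R̂'`. -/
noncomputable def completionDegree [IsDomain (LocalCompletion R)] [IsDomain (LocalCompletion R')]
    (h : Function.Injective (completionMap R R')) : ℕ :=
  letI := (completionFractionMap h).toAlgebra
  Module.finrank (FractionRing (LocalCompletion R)) (FractionRing (LocalCompletion R'))

variable (R R') in
/-- `g(R':R)`, the separable degree of the residue field extension. -/
noncomputable def residueSeparableDegree : ℕ :=
  Field.finSepDegree (ResidueField R) (ResidueField R')

/-- `r(R':R) = d(R':R) / g(R':R)`. -/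
noncomputable def ramificationRatio [IsDomain (LocalCompletion R)] [IsDomain (LocalCompletion R')]
    (h : Function.Injective (completionMap R R')) : ℚ :=
  (completionDegree h : ℚ) / (residueSeparableDegree R R' : ℚ)

end Dominating

/-! Write $A=\hat R$ and $C=\hat R'$. Once $A$ is known to be a normal domain and $C$ a domain that
is finite over $A$ and contains it, the equivalence is a statement about a finite local extension
$A\subset C$ whose residue fields $k\subset k'$ are those of $R$ and $R'$. Let $x\in k'$ generate
the separable closure of $k$ in $k'$, lift it to $\theta\in C$, and let $f$ be the minimal
polynomial of $\theta$ over $A$. By normality $f$ is also minimal over $E$, so $\deg f\le d$. Its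
reduction is divisible by the minimal polynomial of $x$, so $g\le\deg f$. In the unramified case
Nakayama lifts a basis of $k'/k$ to generators of $C$, whence $d\le g$. Conversely, if $d=g$ then
$\bar f$ is the separable minimal polynomial of $x$, so $f'(\theta)$ is a unit. Trace duality gives
$f'(\theta)C\subset A[\theta]$, so $C=A[\theta]$. Then $m_AC=m_C$ and $k'=k(x)$ can be read off
(`map_maximalIdeal_eq_of_finrank_eq_finSepDegree`).

Most of the work goes into $A$ and $C$, and excellence enters through the geometrically regular
formal fibres of $R$. Let $S$ be the integral closure of $R$ in $K'$. If $S$ is finite over $R$,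
then $S\otimes_R\hat R$ is flat over the normal ring $S$ with reduced fibres and regular generic
fibre $K'\otimes_R\hat R$. Serre's argument shows that it is integrally closed in this generic fibre
(`exists_eq_algebraMap_of_isIntegral`). Since regular local rings are domains, zero divisors in the
generic fibre are separated by idempotents, and these descend. With $S=R$ this makes $\hat R$ a
normal domain. In general $\hat R'$ is the quotient of $\hat R\otimes_R S$ by elements killed by
something invertible in $\hat R'$, and a local ring has only trivial idempotents, so $\hat R'$ is a
domain.

Finiteness of $S$ over $R$ is classical in characteristic zero. In characteristic $p$ it descends by
faithful flatness from $\hat R\otimes_R S$, which embeds into the reduced finite $E$-algebra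
$E\otimes_R K'$. This reduces it to the finiteness of integral closures over complete local domains,
proved through coefficient fields, power series normalization and functionals on $p^e$-th roots. -/

open TensorProduct

/-! ### Regular local rings are domains. -/

section RegularLocal

variable {A : Type u} [CommRing A]

/-- Since $x\notin m^2$, one coefficient in an expression of $x$ by the generators is a unit, so
that generator becomes redundant modulo $x$. The dimension drops by at most one, so the quotient
satisfies the same inequality and induction can proceed. -/
theorem exists_parameter_of_card_le_ringKrullDim [IsLocalRing A] [IsNoetherianRing A]
    (s : Finset A) (hs : Ideal.span (s : Set A) = maximalIdeal A)
    (hd : (s.card : WithBot ℕ∞) ≤ ringKrullDim A) (hne : s.Nonempty) :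
    ∃ x ∈ maximalIdeal A, (∀ q ∈ minimalPrimes A, x ∉ q) ∧
      ∃ t : Finset (A ⧸ Ideal.span {x}), t.card < s.card ∧
        Ideal.span (t : Set (A ⧸ Ideal.span {x})) =
          (maximalIdeal A).map (Ideal.Quotient.mk (Ideal.span {x})) ∧
        (t.card : WithBot ℕ∞) ≤ ringKrullDim (A ⧸ Ideal.span {x}) := by
  classical
  have hpos : 0 < s.card := hne.card_pos
  rw [← IsLocalRing.maximalIdeal_height_eq_ringKrullDim] at hd
  have hd' : (s.card : ℕ∞) ≤ (maximalIdeal A).height := by exact_mod_cast hd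
  have hht : (maximalIdeal A).height ≠ 0 := by
    intro h0
    rw [h0] at hd'
    have : s.card ≤ 0 := by exact_mod_cast hd'
    omega
  have hmin : ∀ q ∈ minimalPrimes A, ¬ maximalIdeal A ≤ q := by
    intro q hq hle
    have hqp : q.IsPrime := hq.1.1
    have : q = maximalIdeal A := le_antisymm (le_maximalIdeal hqp.ne_top) hle
    rw [← this] at hht
    exact hht (Ideal.height_eq_zero_iff.2 hq)
  have hsq : ¬ maximalIdeal A ≤ maximalIdeal A ^ 2 := by
    intro hle
    have h0 : maximalIdeal A = ⊥ :=
      Submodule.eq_bot_of_le_smul_of_le_jacobson_bot (maximalIdeal A) (maximalIdeal A)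
        (IsNoetherian.noetherian _) (by rw [smul_eq_mul, ← pow_two]; exact hle)
        (maximalIdeal_le_jacobson _)
    apply hht
    rw [Ideal.height_eq_zero_iff, h0]
    have : (⊥ : Ideal A).IsPrime := h0 ▸ inferInstance
    exact ⟨⟨this, le_refl _⟩, fun q hq _ => bot_le⟩
  obtain ⟨x, hx, hx2, hxq⟩ : ∃ x ∈ maximalIdeal A, x ∉ maximalIdeal A ^ 2 ∧
      ∀ q ∈ minimalPrimes A, x ∉ q := by
    have hfin : (minimalPrimes A).Finite := minimalPrimes.finite_of_isNoetherianRing A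
    by_contra! hcon
    -- Prime avoidance allows two ideals that need not be prime. Both slots are filled with $m^2$.
    have hsub := (Ideal.subset_union_prime' (s := hfin.toFinset) (f := fun i => i)
      (a := maximalIdeal A ^ 2) (b := maximalIdeal A ^ 2)
      (fun i hi => (hfin.mem_toFinset.1 hi).1.1) (I := maximalIdeal A)).1 (by
        intro y hy
        by_cases hy2 : y ∈ maximalIdeal A ^ 2
        · exact Or.inl (Or.inl hy2)
        · obtain ⟨q, hq, hyq⟩ := hcon y hy hy2
          exact Or.inr (by simpa using ⟨q, hq, hyq⟩))
    rcases hsub with h | h | ⟨q, hq, h⟩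
    · exact hsq h
    · exact hsq h
    · exact hmin q (hfin.mem_toFinset.1 hq) h
  have hxs : x ∈ Submodule.span A (s : Set A) := by
    change x ∈ Ideal.span (s : Set A)
    rw [hs]; exact hx
  obtain ⟨a, ha⟩ := Submodule.mem_span_finset'.1 hxs
  obtain ⟨i, hi⟩ : ∃ i : s, IsUnit (a i) := by
    by_contra! hcon
    apply hx2
    rw [← ha, pow_two]
    refine Ideal.sum_mem _ fun i _ => ?_
    refine Ideal.mul_mem_mul ((mem_maximalIdeal _).2 (hcon i)) ?_
    rw [← hs]
    exact Ideal.subset_span i.2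
  refine ⟨x, hx, hxq, (s.erase i).image (Ideal.Quotient.mk (Ideal.span {x})), ?_, ?_, ?_⟩
  · exact lt_of_le_of_lt Finset.card_image_le (Finset.card_erase_lt_of_mem i.2)
  · rw [Finset.coe_image, ← Ideal.map_span]
    apply le_antisymm
    · apply Ideal.map_mono
      rw [← hs]
      exact Ideal.span_mono (by simp)
    · rw [← hs, Ideal.map_span, Ideal.span_le]
      rintro _ ⟨y, hy, rfl⟩
      by_cases hyi : y = i
      · subst hyi
        obtain ⟨b, hb⟩ := hi.exists_left_inv
        have : Ideal.Quotient.mk (Ideal.span {x}) i =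
            -Ideal.Quotient.mk (Ideal.span {x}) (b * ∑ j ∈ Finset.univ.erase i, a j * j) := by
          rw [← map_neg, Ideal.Quotient.mk_eq_mk_iff_sub_mem, Ideal.mem_span_singleton]
          refine ⟨b, ?_⟩
          rw [← ha, ← Finset.add_sum_erase _ _ (Finset.mem_univ i)]
          simp only [smul_eq_mul]
          linear_combination (-(i : A)) * hb
        change Ideal.Quotient.mk (Ideal.span {x}) i ∈ _
        rw [this]
        apply neg_mem
        apply Ideal.mem_map_of_mem
        refine Ideal.mul_mem_left _ _ (Ideal.sum_mem _ fun j hj => Ideal.mul_mem_left _ _ ?_)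
        refine Ideal.subset_span ?_
        have hji : j ≠ i := (Finset.mem_erase.1 hj).1
        simpa using fun h => hji (Subtype.ext h)
      · exact Ideal.mem_map_of_mem _ (Ideal.subset_span (by simpa using ⟨hy, hyi⟩))
  · have h1 := Ideal.height_le_ringKrullDim_quotient_add_one hx
    have h2 : (((s.erase i).image (Ideal.Quotient.mk (Ideal.span {x}))).card : WithBot ℕ∞) + 1 ≤
        ringKrullDim (A ⧸ Ideal.span {x}) + 1 := by
      refine le_trans ?_ (hd.trans h1)
      have : ((s.erase i).image (Ideal.Quotient.mk (Ideal.span {x}))).card + 1 ≤ s.card := by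
        have := Finset.card_erase_lt_of_mem i.2
        have := Finset.card_image_le (s := s.erase i) (f := Ideal.Quotient.mk (Ideal.span {x}))
        omega
      exact_mod_cast this
    exact ENat.WithBot.add_le_add_natCast_right_iff.mp (by exact_mod_cast h2)

/-- By induction $A/x$ is a domain, so $(x)$ is prime and contains a minimal prime $q$. Since
$x\notin q$, every element $xa\in q$ has $a\in q$. Thus $q\subset mq$, and $q=0$ by Nakayama. -/
theorem isDomain_of_card_le_ringKrullDim (n : ℕ) : ∀ (A : Type u) [CommRing A] [IsLocalRing A]
    [IsNoetherianRing A] (s : Finset A), s.card ≤ n →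
    Ideal.span (s : Set A) = maximalIdeal A → (s.card : WithBot ℕ∞) ≤ ringKrullDim A →
    IsDomain A := by
  induction n with
  | zero =>
    intro A _ _ _ s hn hs _
    have : s = ∅ := by simpa using hn
    subst this
    have h0 : maximalIdeal A = ⊥ := by rw [← hs]; simp
    exact (IsLocalRing.isField_iff_maximalIdeal_eq.2 h0).isDomain
  | succ n ih =>
    intro A _ _ _ s hn hs hd
    by_cases hne : s.Nonempty
    · obtain ⟨x, hx, hxq, t, htc, hts, htd⟩ := exists_parameter_of_card_le_ringKrullDim s hs hd hne
      have hnt : Nontrivial (A ⧸ Ideal.span {x}) := by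
        apply Ideal.Quotient.nontrivial_iff.2
        intro h
        rw [Ideal.span_singleton_eq_top] at h
        exact (mem_maximalIdeal x).1 hx h
      have hloc : IsLocalRing (A ⧸ Ideal.span {x}) :=
        IsLocalRing.of_surjective' (Ideal.Quotient.mk _) Ideal.Quotient.mk_surjective
      have hdom : IsDomain (A ⧸ Ideal.span {x}) := by
        refine ih _ t (by omega) ?_ htd
        rw [hts]
        exact map_maximalIdeal_of_surjective _ Ideal.Quotient.mk_surjective
      have hprime : (Ideal.span {x}).IsPrime := (Ideal.Quotient.isDomain_iff_prime _).1 hdom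
      obtain ⟨q, hq, hqle⟩ := Ideal.exists_minimalPrimes_le (I := (⊥ : Ideal A)) (J := Ideal.span {x})
        bot_le
      have hqp : q.IsPrime := hq.1.1
      have hq0 : q = ⊥ := by
        refine Submodule.eq_bot_of_le_smul_of_le_jacobson_bot (maximalIdeal A) q
          (IsNoetherian.noetherian _) ?_ (maximalIdeal_le_jacobson _)
        intro y hy
        obtain ⟨a, rfl⟩ := Ideal.mem_span_singleton.1 (hqle hy)
        rw [smul_eq_mul]
        exact Ideal.mul_mem_mul hx ((hqp.mem_or_mem hy).resolve_left (hxq q hq))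
      rw [hq0] at hqp
      exact IsDomain.of_bot_isPrime A
    · have : s = ∅ := Finset.not_nonempty_iff_eq_empty.1 hne
      exact ih A s (by simp [this]) hs hd

theorem IsRegularLocalRing.exists_finset_span_eq [IsRegularLocalRing A] :
    ∃ s : Finset A, Ideal.span (s : Set A) = maximalIdeal A ∧
      (s.card : WithBot ℕ∞) = ringKrullDim A := by
  obtain ⟨s, hs, hs'⟩ := Submodule.FG.exists_span_finset_card_eq_spanFinrank
    (IsNoetherian.noetherian (maximalIdeal A))
  refine ⟨s, hs', ?_⟩
  rw [hs]
  exact IsRegularLocalRing.spanFinrank_maximalIdeal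

theorem IsRegularLocalRing.isDomain [IsRegularLocalRing A] : IsDomain A := by
  obtain ⟨s, hs, hs'⟩ := IsRegularLocalRing.exists_finset_span_eq (A := A)
  exact isDomain_of_card_le_ringKrullDim _ A s le_rfl hs hs'.le

theorem IsRegularLocalRing.exists_prime_mem_maximalIdeal [IsRegularLocalRing A]
    (hA : maximalIdeal A ≠ ⊥) : ∃ x ∈ maximalIdeal A, Prime x := by
  obtain ⟨s, hs, hs'⟩ := IsRegularLocalRing.exists_finset_span_eq (A := A)
  have hdom := IsRegularLocalRing.isDomain (A := A)
  have hne : s.Nonempty := by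
    rw [Finset.nonempty_iff_ne_empty]
    rintro rfl
    apply hA
    rw [← hs]
    simp
  obtain ⟨x, hx, hxq, t, htc, hts, htd⟩ := exists_parameter_of_card_le_ringKrullDim s hs hs'.le hne
  have hnt : Nontrivial (A ⧸ Ideal.span {x}) := by
    apply Ideal.Quotient.nontrivial_iff.2
    intro h
    rw [Ideal.span_singleton_eq_top] at h
    exact (mem_maximalIdeal x).1 hx h
  have hloc : IsLocalRing (A ⧸ Ideal.span {x}) :=
    IsLocalRing.of_surjective' (Ideal.Quotient.mk _) Ideal.Quotient.mk_surjective
  have hdom : IsDomain (A ⧸ Ideal.span {x}) :=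
    isDomain_of_card_le_ringKrullDim _ _ t le_rfl
      (hts.trans (map_maximalIdeal_of_surjective _ Ideal.Quotient.mk_surjective)) htd
  refine ⟨x, hx, (Ideal.span_singleton_prime ?_).1 ((Ideal.Quotient.isDomain_iff_prime _).1 hdom)⟩
  rintro rfl
  exact hxq ⊥ (by simp [IsDomain.minimalPrimes_eq_singleton_bot]) (by simp)

end RegularLocal

/-! ### Regular rings are reduced and locally normal. -/

section RegularRing

variable {A : Type u} [CommRing A]

theorem IsRegularRing.of_isLocalization [IsRegularRing A] (M : Submonoid A) (B : Type v)
    [CommRing B] [Algebra A B] [IsLocalization M B] : IsRegularRing B := by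
  have : IsNoetherianRing B := IsLocalization.isNoetherianRing M B inferInstance
  rw [isRegularRing_iff]
  intro p hp
  have h1 : (p.comap (algebraMap A B)).IsPrime := inferInstance
  have h2 := IsLocalization.isLocalization_isLocalization_atPrime_isLocalization M
    (Localization.AtPrime p) p
  exact IsRegularLocalRing.of_ringEquiv (IsLocalization.algEquiv
    (p.comap (algebraMap A B)).primeCompl (Localization.AtPrime (p.comap (algebraMap A B)))
    (Localization.AtPrime p)).toRingEquiv

theorem IsRegularRing.isReduced [IsRegularRing A] : IsReduced A :=
  isReduced_ofLocalizationMaximal A fun P _ => by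
    have := IsRegularLocalRing.isDomain (A := Localization.AtPrime P)
    infer_instance

/-- For $z$ integral, the denominator ideal of $z$ lies in no prime other than $m$, so it contains a
power of $x$. Normality at the prime $(x)$ shows that $x$ divides the numerator of a nontrivial
least such power, against minimality. If $(x)=m$, the ring is a principal ideal domain. -/
theorem IsIntegrallyClosed.of_prime_mem_of_localization [IsDomain A] [IsLocalRing A]
    [IsNoetherianRing A] {x : A} (hx : Prime x) (hxm : x ∈ maximalIdeal A)
    (h : ∀ (Q : Ideal A) [Q.IsPrime], Q ≠ maximalIdeal A →
      IsIntegrallyClosed (Localization.AtPrime Q)) : IsIntegrallyClosed A := by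
  by_cases hxm' : Ideal.span {x} = maximalIdeal A
  · have hpr : (maximalIdeal A).IsPrincipal := ⟨⟨x, hxm'.symm⟩⟩
    have : IsPrincipalIdealRing A :=
      ((tfae_of_isNoetherianRing_of_isLocalRing_of_isDomain A).out 4 0).1 hpr
    infer_instance
  let K := FractionRing A
  have key : ∀ (z : K), IsIntegral A z → ∀ (Q : Ideal A) [Q.IsPrime], Q ≠ maximalIdeal A →
      ∃ s a : A, s ∉ Q ∧ algebraMap A K s * z = algebraMap A K a := by
    intro z hz Q hQ hQm
    have := h Q hQm
    let : Algebra (Localization.AtPrime Q) K :=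
      (IsLocalization.lift (M := Q.primeCompl) (S := Localization.AtPrime Q)
        (g := algebraMap A K) (fun y => IsUnit.mk0 _ (by
          have : (y : A) ≠ 0 := fun h0 => y.2 (h0 ▸ Q.zero_mem)
          simpa using this))).toAlgebra
    have : IsScalarTower A (Localization.AtPrime Q) K :=
      IsScalarTower.of_algebraMap_eq fun y => by
        rw [RingHom.algebraMap_toAlgebra, IsLocalization.lift_eq]
    have : IsFractionRing (Localization.AtPrime Q) K :=
      IsFractionRing.isFractionRing_of_isDomain_of_isLocalization Q.primeCompl _ _
    obtain ⟨y, hy⟩ := IsIntegrallyClosed.algebraMap_eq_of_integral (K := K)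
      (hz.tower_top (A := Localization.AtPrime Q))
    obtain ⟨⟨a, s⟩, has⟩ := IsLocalization.surj Q.primeCompl y
    refine ⟨s, a, s.2, ?_⟩
    rw [← hy, IsScalarTower.algebraMap_apply A (Localization.AtPrime Q) K,
      IsScalarTower.algebraMap_apply A (Localization.AtPrime Q) K, ← map_mul, ← has, mul_comm]
  rw [isIntegrallyClosed_iff K]
  intro z hz
  let D : Ideal A :=
    { carrier := {s | ∃ a, algebraMap A K s * z = algebraMap A K a}
      add_mem' := by
        rintro s t ⟨a, ha⟩ ⟨b, hb⟩
        exact ⟨a + b, by rw [map_add, map_add, add_mul, ha, hb]⟩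
      zero_mem' := ⟨0, by simp⟩
      smul_mem' := by
        rintro c s ⟨a, ha⟩
        exact ⟨c * a, by rw [smul_eq_mul, map_mul, map_mul, mul_assoc, ha]⟩ }
  have hrad : x ∈ D.radical := by
    rw [Ideal.radical_eq_sInf, Ideal.mem_sInf]
    rintro Q ⟨hDQ, hQ⟩
    by_contra hxQ
    obtain ⟨s, a, hs, ha⟩ := key z hz Q (fun h => hxQ (h ▸ hxm))
    exact hs (hDQ ⟨a, ha⟩)
  classical
  have hex : ∃ n, x ^ n ∈ D := hrad
  have hmin := Nat.find_spec hex
  obtain ⟨a, ha⟩ := hmin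
  rcases Nat.eq_zero_or_pos (Nat.find hex) with h0 | hpos
  · rw [h0] at ha
    exact ⟨a, by rw [← ha]; simp⟩
  exfalso
  have hxp : (Ideal.span {x}).IsPrime := (Ideal.span_singleton_prime hx.ne_zero).2 hx
  obtain ⟨s, b, hs, hb⟩ := key z hz (Ideal.span {x}) hxm'
  have hab : s * a = x ^ Nat.find hex * b := by
    apply IsFractionRing.injective A K
    rw [map_mul, map_mul, ← ha, ← hb]
    ring
  have hxa : x ∣ s * a := by
    rw [hab]
    exact Dvd.dvd.mul_right (dvd_pow_self x (by omega)) b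
  rcases hx.dvd_or_dvd hxa with hd | ⟨c, rfl⟩
  · exact hs (Ideal.mem_span_singleton.2 hd)
  · apply Nat.find_min hex (Nat.sub_lt hpos one_pos)
    refine ⟨c, ?_⟩
    have hx0 : algebraMap A K x ≠ 0 := by simpa using hx.ne_zero
    apply mul_left_cancel₀ hx0
    rw [← map_mul, ← ha, ← mul_assoc, ← map_mul, ← pow_succ',
      Nat.sub_add_cancel (show 1 ≤ Nat.find hex from hpos)]

/-- A parameter $x$ with $A/x$ a domain supplies the prime element. The localizations at non-maximal
primes have smaller height. -/
theorem isIntegrallyClosed_of_isRegularRing_of_height_le (n : ℕ) : ∀ (A : Type u) [CommRing A]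
    [IsLocalRing A] [IsRegularRing A] [IsDomain A], (maximalIdeal A).height ≤ n →
    IsIntegrallyClosed A := by
  induction n with
  | zero =>
    intro A _ _ _ _ hA
    have h0 : (maximalIdeal A).height = 0 := by simpa using hA
    rw [Ideal.height_eq_zero_iff] at h0
    rw [IsDomain.minimalPrimes_eq_singleton_bot] at h0
    exact (IsLocalRing.isField_iff_maximalIdeal_eq.2 h0).toField.instIsIntegrallyClosed
  | succ n ih =>
    intro A _ _ _ _ hA
    by_cases h0 : maximalIdeal A = ⊥
    · exact (IsLocalRing.isField_iff_maximalIdeal_eq.2 h0).toField.instIsIntegrallyClosed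
    have hreg : IsRegularLocalRing A := IsRegularLocalRing.of_isRegularRing_of_isLocalRing A
    obtain ⟨x, hxm, hx⟩ := IsRegularLocalRing.exists_prime_mem_maximalIdeal h0
    refine IsIntegrallyClosed.of_prime_mem_of_localization hx hxm fun Q hQ hQm => ?_
    have hr : IsRegularRing (Localization.AtPrime Q) :=
      IsRegularRing.of_isLocalization Q.primeCompl _
    have hdom : IsDomain (Localization.AtPrime Q) := IsRegularLocalRing.isDomain
    apply ih
    have hlt : Q < maximalIdeal A := lt_of_le_of_ne (le_maximalIdeal hQ.ne_top) hQm
    have h1 := Ideal.height_add_one_le_of_lt_of_isPrime hlt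
    have h2 : (maximalIdeal (Localization.AtPrime Q)).height = Q.height := by
      have := IsLocalization.height_under Q.primeCompl (maximalIdeal (Localization.AtPrime Q))
      rw [IsLocalization.AtPrime.under_maximalIdeal _ Q] at this
      exact this.symm
    rw [h2]
    have h3 := h1.trans hA
    push_cast at h3
    exact (ENat.add_le_add_iff_right (by simp)).1 h3

theorem IsRegularRing.isIntegrallyClosed_localization [IsRegularRing A] (P : Ideal A) [P.IsPrime] :
    IsIntegrallyClosed (Localization.AtPrime P) := by
  have hr : IsRegularRing (Localization.AtPrime P) :=
    IsRegularRing.of_isLocalization P.primeCompl _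
  have hdom : IsDomain (Localization.AtPrime P) := IsRegularLocalRing.isDomain
  have hfin : (maximalIdeal (Localization.AtPrime P)).height ≠ ⊤ := Ideal.height_ne_top
    (Ideal.IsPrime.ne_top inferInstance)
  obtain ⟨n, hn⟩ := ENat.ne_top_iff_exists.1 hfin
  exact isIntegrallyClosed_of_isRegularRing_of_height_le n _ hn.ge

theorem IsRegularRing.isIntegrallyClosed [IsRegularRing A] [IsDomain A] : IsIntegrallyClosed A :=
  IsIntegrallyClosed.of_localization_maximal fun p _ _ =>
    IsRegularRing.isIntegrallyClosed_localization p

end RegularRing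

/-! ### Integral closedness along flat maps with reduced fibres. -/

section NormalDescent

variable {S : Type u} {T : Type v} {W : Type w} [CommRing S] [CommRing T] [CommRing W]
  [Algebra S T] [Algebra T W]

/-- Multiply the equation of integral dependence of degree $n$ by $a^n$ and substitute $ay=t$. -/
theorem exists_pow_eq_mul_of_isIntegral {y : W} (hy : IsIntegral T y)
    (hinj : Function.Injective (algebraMap T W)) {a t : T}
    (h : algebraMap T W a * y = algebraMap T W t) : ∃ (n : ℕ) (b : T), t ^ n = a * b := by
  obtain ⟨p, hp, hpy⟩ := hy
  refine ⟨p.natDegree, -∑ i ∈ Finset.range p.natDegree,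
    p.coeff i * (a ^ (p.natDegree - 1 - i) * t ^ i), hinj ?_⟩
  have h1 : y ^ p.natDegree = -∑ i ∈ Finset.range p.natDegree,
      algebraMap T W (p.coeff i) * y ^ i := by
    rw [Polynomial.eval₂_eq_sum_range, Finset.sum_range_succ, hp.coeff_natDegree, map_one,
      one_mul] at hpy
    linear_combination hpy
  rw [map_pow, ← h, mul_pow, h1, map_mul, map_neg, map_sum, mul_neg, mul_neg, Finset.mul_sum,
    Finset.mul_sum]
  congr 1
  refine Finset.sum_congr rfl fun i hi => ?_
  have hi' : p.natDegree = (p.natDegree - 1 - i) + i + 1 := by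
    have := Finset.mem_range.1 hi
    omega
  simp only [map_mul, map_pow]
  rw [← h]
  conv_lhs => rw [hi']
  ring

/-- This is the discrete valuation ring $S_q$ with its denominators cleared. For $q=(f:a)$ the
fraction $a/f$ multiplies $q$ into $S$. If it multiplied $q$ into $q$, it would be integral by the
determinant trick, hence in $S$, a contradiction. So some $p\in q$ has $p\,a/f\notin q$, and $p$
generates $q$ locally. -/
theorem exists_uniformizer_of_mem_associatedPrimes [IsNoetherianRing S] [IsDomain S]
    [IsIntegrallyClosed S] {f : S} (hf : f ≠ 0) {q : Ideal S}
    (hq : q ∈ associatedPrimes S (S ⧸ Ideal.span {f})) :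
    ∃ p ∈ q, p ≠ 0 ∧ (∃ v ∉ q, ∀ b ∈ q, ∃ c, v * b = p * c) ∧
      ∃ k, ∃ u ∉ q, ∃ v ∉ q, u * f = v * p ^ k := by
  obtain ⟨hqp, x, hx⟩ := isAssociatedPrime_iff.1 hq
  obtain ⟨a, rfl⟩ := Ideal.Quotient.mk_surjective x
  have hmem : ∀ s, s ∈ q ↔ f ∣ s * a := by
    intro s
    rw [hx, Submodule.mem_colon_singleton, Submodule.mem_bot, ← Ideal.mem_span_singleton,
      ← Ideal.Quotient.eq_zero_iff_mem, map_mul]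
    rfl
  have ha : ¬ f ∣ a := fun h => hqp.ne_top ((Ideal.eq_top_iff_one _).2 ((hmem 1).2 (by simpa)))
  have hfq : f ∈ q := (hmem f).2 (Dvd.intro _ rfl)
  obtain ⟨p, hpq, v, hpv, hv⟩ : ∃ p ∈ q, ∃ v, p * a = f * v ∧ v ∉ q := by
    by_contra! hcon
    have hfK : algebraMap S (FractionRing S) f ≠ 0 := by simpa using hf
    have hint : IsIntegral S (algebraMap S (FractionRing S) a / algebraMap S (FractionRing S) f) := by
      refine isIntegral_of_smul_mem_submodule (M := FractionRing S)
        (Submodule.map (Algebra.linearMap S (FractionRing S)) q) ?_ ((IsNoetherian.noetherian q).map _) _ ?_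
      · rw [Submodule.ne_bot_iff]
        exact ⟨algebraMap S (FractionRing S) f, ⟨f, hfq, rfl⟩, hfK⟩
      · rintro _ ⟨p, hp, rfl⟩
        obtain ⟨v, hv⟩ := (hmem p).1 hp
        refine ⟨v, hcon p hp v hv, ?_⟩
        have h1 := congrArg (algebraMap S (FractionRing S)) hv
        simp only [map_mul] at h1
        simp only [Algebra.linearMap_apply, smul_eq_mul]
        rw [div_mul_eq_mul_div, eq_div_iff hfK]
        linear_combination -h1
    obtain ⟨c, hc⟩ := IsIntegrallyClosed.algebraMap_eq_of_integral hint
    apply ha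
    refine ⟨c, IsFractionRing.injective S (FractionRing S) ?_⟩
    rw [map_mul, hc, mul_div_cancel₀ _ hfK]
  have hloc : ∀ b ∈ q, ∃ c, v * b = p * c := by
    intro b hb
    obtain ⟨c, hc⟩ := (hmem b).1 hb
    refine ⟨c, mul_left_cancel₀ hf ?_⟩
    linear_combination p * hc - b * hpv
  have hp0 : p ≠ 0 := by
    rintro rfl
    apply hv
    have : f * v = 0 := by rw [← hpv, zero_mul]
    rw [(mul_eq_zero.1 this).resolve_left hf]
    exact q.zero_mem
  refine ⟨p, hpq, hp0, ⟨v, hv, hloc⟩, ?_⟩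
  classical
  -- By Krull's intersection theorem in $S_q$, the nonzero $f$ is not divisible by every power of
  -- $p$. The first power that fails gives the valuation of $f$ plus one.
  have hex : ∃ k, ¬ ∃ u ∉ q, ∃ c, u * f = c * p ^ k := by
    by_contra! hcon
    let Sq := Localization.AtPrime q
    have hbot : algebraMap S Sq f ∈ ⨅ k, (Ideal.span {algebraMap S Sq p}) ^ k := by
      rw [Ideal.mem_iInf]
      intro k
      obtain ⟨u, hu, c, hc⟩ := hcon k
      rw [Ideal.span_singleton_pow, Ideal.mem_span_singleton,
        ← (IsLocalization.map_units Sq (⟨u, hu⟩ : q.primeCompl)).dvd_mul_left, ← map_mul, hc,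
        map_mul, map_pow]
      exact Dvd.intro_left _ rfl
    rw [Ideal.iInf_pow_eq_bot_of_isLocalRing] at hbot
    · apply hf
      exact IsLocalization.injective Sq q.primeCompl_le_nonZeroDivisors (by simpa using hbot)
    · rw [Ne, Ideal.span_singleton_eq_top]
      intro hu
      have := (IsLocalization.AtPrime.isUnit_to_map_iff Sq q p).1 hu
      exact this hpq
  have hk := Nat.find_spec hex
  have hk0 : Nat.find hex ≠ 0 := by
    intro h0
    apply hk
    rw [h0]
    exact ⟨1, fun h => hqp.ne_top ((Ideal.eq_top_iff_one _).2 h), f, by simp⟩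
  obtain ⟨k, hk'⟩ := Nat.exists_eq_succ_of_ne_zero hk0
  obtain ⟨u, hu, c, hc⟩ := not_not.1 (Nat.find_min hex (m := k) (by omega))
  refine ⟨k, u, hu, c, ?_, hc⟩
  intro hcq
  obtain ⟨d, hd⟩ := hloc c hcq
  apply hk
  rw [hk', Nat.succ_eq_add_one]
  refine ⟨v * u, fun h => (hqp.mem_or_mem h).elim hv hu, d, ?_⟩
  linear_combination v * hc + p ^ k * hd

variable [Algebra S W] [IsScalarTower S T W]

/-- One factor $p$ is removed at a time. If $p^{k+1}y=t$, then $p^ky$ is integral, so $p$ divides a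
power of $t$. Reducedness of the fibre puts $t$ into $qT$ locally at $q$, where $q$ is generated by
$p$, and $p$ cancels. -/
theorem exists_mul_mem_range_of_pow_mul_eq (hinj : Function.Injective (algebraMap T W))
    {q : Ideal S} [q.IsPrime]
    (hred : ∀ (t : T) (n : ℕ), t ^ n ∈ q.map (algebraMap S T) →
      ∃ s ∉ q, algebraMap S T s * t ∈ q.map (algebraMap S T))
    {p : S} (hpq : p ∈ q) (hp : ∀ w : W, algebraMap S W p * w = 0 → w = 0)
    {v : S} (hv : v ∉ q) (hpv : ∀ b ∈ q, ∃ c, v * b = p * c) (k : ℕ) :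
    ∀ (y : W) (t : T), IsIntegral T y → algebraMap S W p ^ k * y = algebraMap T W t →
      ∃ s ∉ q, ∃ t' : T, algebraMap S W s * y = algebraMap T W t' := by
  have hq : q.IsPrime := inferInstance
  have hmap : ∀ t ∈ q.map (algebraMap S T), ∃ t', algebraMap S T v * t = algebraMap S T p * t' := by
    intro t ht
    refine Submodule.span_induction (p := fun t _ => ∃ t', algebraMap S T v * t =
      algebraMap S T p * t') ?_ ⟨0, by simp⟩ ?_ ?_ ht
    · rintro _ ⟨b, hb, rfl⟩
      obtain ⟨c, hc⟩ := hpv b hb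
      exact ⟨algebraMap S T c, by rw [← map_mul, hc, map_mul]⟩
    · rintro x y _ _ ⟨a, ha⟩ ⟨b, hb⟩
      exact ⟨a + b, by rw [mul_add, mul_add, ha, hb]⟩
    · rintro r x _ ⟨a, ha⟩
      exact ⟨r * a, by rw [smul_eq_mul]; linear_combination r * ha⟩
  induction k with
  | zero =>
    intro y t _ h
    exact ⟨1, fun h => hq.ne_top ((Ideal.eq_top_iff_one _).2 h), t, by simpa using h⟩
  | succ k ih =>
    intro y t hy h
    obtain ⟨n, b, hn⟩ := exists_pow_eq_mul_of_isIntegral (a := algebraMap S T p)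
      (y := algebraMap S W p ^ k * y) (t := t)
      ((((isIntegral_algebraMap (R := T) (A := W) (x := algebraMap S T p)).pow k).mul hy :
        IsIntegral T (algebraMap T W (algebraMap S T p) ^ k * y)) |> fun h => by
          rwa [← IsScalarTower.algebraMap_apply] at h) hinj (by
        rw [← h, ← IsScalarTower.algebraMap_apply, pow_succ']; ring)
    obtain ⟨s, hs, hst⟩ := hred t n (by
      rw [hn]; exact Ideal.mul_mem_right _ _ (Ideal.mem_map_of_mem _ hpq))
    obtain ⟨t', ht'⟩ := hmap _ hst
    obtain ⟨s', hs', t'', ht''⟩ := ih (algebraMap S W (v * s) * y) t' (by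
      rw [IsScalarTower.algebraMap_apply S T W]
      exact isIntegral_algebraMap.mul hy) (by
      have h1 := congrArg (algebraMap T W) ht'
      simp only [map_mul, ← h, ← IsScalarTower.algebraMap_apply S T W] at h1
      rw [← sub_eq_zero]
      apply hp
      rw [map_mul]
      linear_combination h1)
    refine ⟨s' * (v * s), fun h => ?_, t'', ?_⟩
    · rcases hq.mem_or_mem h with h | h
      · exact hs' h
      · exact (hq.mem_or_mem h).elim hv hs
    · rw [← ht'', map_mul, mul_assoc]

/-- The denominators in $S$ of $y$ form an ideal contained in no associated prime of $S/f$, since at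
these primes $f$ is a unit times a power of a uniformizer. Hence some denominator $s$ is regular
modulo $f$. Then $st\in fT$, and flatness gives $t\in fT$. -/
theorem exists_eq_algebraMap_of_isIntegral [IsNoetherianRing S] [IsDomain S]
    [IsIntegrallyClosed S] [Module.Flat S T] (hinj : Function.Injective (algebraMap T W))
    (hred : ∀ (q : Ideal S) [q.IsPrime] (t : T) (n : ℕ), t ^ n ∈ q.map (algebraMap S T) →
      ∃ s ∉ q, algebraMap S T s * t ∈ q.map (algebraMap S T))
    (htf : ∀ p : S, p ≠ 0 → ∀ w : W, algebraMap S W p * w = 0 → w = 0)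
    (hW : ∀ w : W, ∃ f : S, f ≠ 0 ∧ ∃ t : T, algebraMap S W f * w = algebraMap T W t)
    {y : W} (hy : IsIntegral T y) : ∃ t : T, algebraMap T W t = y := by
  obtain ⟨f, hf, t, ht⟩ := hW y
  let J : Ideal S :=
    { carrier := {s | ∃ t : T, algebraMap S W s * y = algebraMap T W t}
      add_mem' := by
        rintro s t ⟨a, ha⟩ ⟨b, hb⟩
        exact ⟨a + b, by rw [map_add, map_add, add_mul, ha, hb]⟩
      zero_mem' := ⟨0, by simp⟩
      smul_mem' := by
        rintro c s ⟨a, ha⟩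
        refine ⟨algebraMap S T c * a, ?_⟩
        rw [smul_eq_mul, map_mul, map_mul, ← ha, ← IsScalarTower.algebraMap_apply, mul_assoc] }
  have hfin := associatedPrimes.finite S (S ⧸ Ideal.span {f})
  obtain ⟨s, hsJ, hs⟩ : ∃ s ∈ J, ∀ q ∈ associatedPrimes S (S ⧸ Ideal.span {f}), s ∉ q := by
    by_contra! hcon
    obtain ⟨q, hq, hJq⟩ := (Ideal.subset_union_prime (s := hfin.toFinset) (f := fun i => i)
      (⊥ : Ideal S) ⊥ (fun i hi _ _ => (hfin.mem_toFinset.1 hi).1) (I := J)).1 (by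
        intro s hs
        obtain ⟨q, hq, hsq⟩ := hcon s hs
        simpa using ⟨q, hq, hsq⟩)
    have hqa := hfin.mem_toFinset.1 hq
    have hqp : q.IsPrime := hqa.1
    obtain ⟨p, hpq, hp0, ⟨v, hv, hpv⟩, k, u, hu, v', hv', huv⟩ :=
      exists_uniformizer_of_mem_associatedPrimes hf hqa
    obtain ⟨s, hs, t', ht'⟩ := exists_mul_mem_range_of_pow_mul_eq hinj
      (hred q) hpq (htf p hp0) hv hpv k (algebraMap S W v' * y)
      (algebraMap S T u * t) (by
        rw [IsScalarTower.algebraMap_apply S T W]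
        exact isIntegral_algebraMap.mul hy) (by
        rw [map_mul, ← ht, ← IsScalarTower.algebraMap_apply S T W, ← mul_assoc, ← mul_assoc,
          ← map_mul, huv, map_mul, map_pow]
        ring)
    have : s * v' ∈ J := ⟨t', by rw [← ht', map_mul, mul_assoc]⟩
    exact (hqp.mem_or_mem (hJq this)).elim hs hv'
  have hreg : ∀ a : S, f ∣ s * a → f ∣ a := by
    have h1 : s ∈ {r : S | IsSMulRegular (S ⧸ Ideal.span {f}) r} := by
      by_contra h
      have h2 : s ∈ {r : S | IsSMulRegular (S ⧸ Ideal.span {f}) r}ᶜ := h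
      rw [← biUnion_associatedPrimes_eq_compl_regular] at h2
      simp only [Set.mem_iUnion] at h2
      obtain ⟨q, hq, hsq⟩ := h2
      exact hs q hq hsq
    intro a ha
    rw [← Ideal.mem_span_singleton, ← Ideal.Quotient.eq_zero_iff_mem] at ha ⊢
    apply h1
    change s • Ideal.Quotient.mk (Ideal.span {f}) a = s • 0
    rw [smul_zero, ← ha]
    rfl
  obtain ⟨t1, ht1⟩ := hsJ
  have hrel : algebraMap S T s * t = algebraMap S T f * t1 := by
    apply hinj
    rw [map_mul, map_mul, ← ht, ← ht1, ← IsScalarTower.algebraMap_apply,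
      ← IsScalarTower.algebraMap_apply]
    ring
  -- The equational criterion for flatness, applied to $st-ft_1=0$, writes $t$ through relations
  -- over $S$. In those, $f\mid s\,a_{0j}$ forces $f\mid a_{0j}$.
  obtain ⟨k, a, z, hz, ha⟩ := Module.Flat.isTrivialRelation_of_sum_smul_eq_zero (R := S) (M := T)
    (f := ![s, -f]) (x := ![t, t1]) (by
      simp [Fin.sum_univ_two, Algebra.smul_def, hrel])
  have hdvd : ∀ j, f ∣ a 0 j := fun j => hreg _ ⟨a 1 j, by
    have := ha j
    simp only [Fin.sum_univ_two, Matrix.cons_val_zero, Matrix.cons_val_one] at this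
    linear_combination this⟩
  choose c hc using hdvd
  refine ⟨∑ j, c j • z j, ?_⟩
  have h0 := hz 0
  simp only [Matrix.cons_val_zero] at h0
  rw [← sub_eq_zero]
  apply htf f hf
  rw [mul_sub, ht, h0, IsScalarTower.algebraMap_apply S T W, ← map_mul, ← map_sub, Finset.mul_sum,
    ← Finset.sum_sub_distrib]
  rw [Finset.sum_eq_zero, map_zero]
  intro j _
  rw [hc j, Algebra.smul_def, Algebra.smul_def, map_mul]
  ring

end NormalDescent

/-- The annihilator of $x$ is locally zero or the whole ring, because the localizations are domains.
So it is an idempotent finitely generated ideal, and these are generated by idempotents. -/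
theorem exists_idempotent_of_mul_eq_zero {W : Type w} [CommRing W] [IsNoetherianRing W]
    (hW : ∀ (P : Ideal W) [P.IsMaximal], IsDomain (Localization.AtPrime P)) {x y : W}
    (hxy : x * y = 0) : ∃ i : W, IsIdempotentElem i ∧ i * x = 0 ∧ i * y = y := by
  let I : Ideal W := Ideal.span {x} |>.annihilator
  have hI : ∀ a, a ∈ I ↔ a * x = 0 := fun a => by
    simp only [I, Ideal.span, Submodule.mem_annihilator_span_singleton, smul_eq_mul]
  have hidem : IsIdempotentElem I := by
    refine Ideal.eq_of_localization_maximal fun P hP => ?_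
    have := hW P
    by_cases h0 : algebraMap W (Localization.AtPrime P) x = 0
    · obtain ⟨s, hs⟩ := (IsLocalization.map_eq_zero_iff P.primeCompl _ _).1 h0
      have h1 : I.map (algebraMap W (Localization.AtPrime P)) = ⊤ :=
        Ideal.eq_top_of_isUnit_mem _ (Ideal.mem_map_of_mem _ ((hI s).2 hs))
          (IsLocalization.map_units _ s)
      rw [Ideal.map_mul, h1, Ideal.top_mul]
    · have h1 : I.map (algebraMap W (Localization.AtPrime P)) = ⊥ := by
        rw [Ideal.map_eq_bot_iff_le_ker]
        intro a ha
        have h2 : algebraMap W (Localization.AtPrime P) a *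
            algebraMap W (Localization.AtPrime P) x = 0 := by
          rw [← map_mul, (hI a).1 ha, map_zero]
        exact (mul_eq_zero.1 h2).resolve_right h0
      rw [Ideal.map_mul, h1, Ideal.bot_mul]
  obtain ⟨i, hi, hIi⟩ := (Ideal.isIdempotentElem_iff_of_fg I (IsNoetherian.noetherian I)).1 hidem
  refine ⟨i, hi, (hI i).1 (by rw [hIi]; exact Ideal.mem_span_singleton_self i), ?_⟩
  have hy : y ∈ I := (hI y).2 (by rw [mul_comm]; exact hxy)
  rw [hIi] at hy
  obtain ⟨c, rfl⟩ := Ideal.mem_span_singleton.1 hy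
  rw [← mul_assoc, hi]

/-! ### Finite field extensions of formal fibres. -/

section Fibers

variable {R : Type u} [CommRing R] [IsLocalRing R]

/-- Geometric regularity quantifies over extensions in the universe of the base field. A finite
extension is small, so a copy in that universe can be used. -/
theorem HasGeometricallyRegularFormalFibers.isRegularRing_tensorProduct
    (h : HasGeometricallyRegularFormalFibers R) (p : Ideal R) [p.IsPrime] (L : Type v) [Field L]
    [Algebra p.ResidueField L] [Module.Finite p.ResidueField L] [Algebra R L]
    [IsScalarTower R p.ResidueField L] : IsRegularRing (L ⊗[R] LocalCompletion R) := by
  have : Small.{u} L := Module.Finite.small p.ResidueField L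
  let e : Shrink.{u} L ≃ₐ[p.ResidueField] L := Shrink.algEquiv p.ResidueField L
  have : Module.Finite p.ResidueField (Shrink.{u} L) := Module.Finite.equiv e.symm.toLinearEquiv
  have hreg := h p (Shrink.{u} L)
  let e1 : Shrink.{u} L ⊗[p.ResidueField] (p.Fiber (LocalCompletion R)) ≃+*
      L ⊗[p.ResidueField] (p.Fiber (LocalCompletion R)) :=
    (Algebra.TensorProduct.congr e AlgEquiv.refl).toRingEquiv
  let e2 : L ⊗[p.ResidueField] (p.Fiber (LocalCompletion R)) ≃+* L ⊗[R] LocalCompletion R :=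
    (Algebra.TensorProduct.cancelBaseChange R p.ResidueField p.ResidueField L
      (LocalCompletion R)).toRingEquiv
  have := IsRegularRing.of_ringEquiv (R := Shrink.{u} L ⊗[p.ResidueField]
    (p.Fiber (LocalCompletion R))) (R' := L ⊗[p.ResidueField] (p.Fiber (LocalCompletion R))) e1
  exact IsRegularRing.of_ringEquiv (R := L ⊗[p.ResidueField] (p.Fiber (LocalCompletion R))) e2

end Fibers

/-- The fibre maps to the localization of $T/qT$ at the image of $S\setminus q$. The class of $t$ is
nilpotent, hence zero, in the fibre. It therefore vanishes in that localization, which gives the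
multiplier $s$. -/
theorem exists_mul_mem_map_of_isReduced_fiber {S : Type u} {T : Type v} [CommRing S] [CommRing T]
    [Algebra S T] (q : Ideal S) [q.IsPrime] (hred : IsReduced (q.Fiber T)) {t : T} {n : ℕ}
    (ht : t ^ n ∈ q.map (algebraMap S T)) :
    ∃ s ∉ q, algebraMap S T s * t ∈ q.map (algebraMap S T) := by
  let B := T ⧸ q.map (algebraMap S T)
  let M := Algebra.algebraMapSubmonoid B q.primeCompl
  let f : q.ResidueField →ₐ[S] Localization M := Ideal.ResidueField.liftₐ (R := S) q
    (Algebra.ofId S (Localization M)) (by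
      intro s hs
      rw [RingHom.mem_ker]
      change algebraMap S (Localization M) s = 0
      rw [IsScalarTower.algebraMap_apply S B (Localization M),
        IsScalarTower.algebraMap_apply S T B]
      have : algebraMap T B (algebraMap S T s) = 0 :=
        Ideal.Quotient.eq_zero_iff_mem.2 (Ideal.mem_map_of_mem _ hs)
      rw [this, map_zero]) (by
      intro s hs
      change IsUnit (algebraMap S (Localization M) s)
      rw [IsScalarTower.algebraMap_apply S B (Localization M)]
      exact IsLocalization.map_units (M := M) _ ⟨algebraMap S B s, ⟨s, hs, rfl⟩⟩)
  let g : q.Fiber T →ₐ[S] Localization M :=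
    Algebra.TensorProduct.lift f (IsScalarTower.toAlgHom S T (Localization M))
      (fun _ _ => Commute.all _ _)
  have h0 : (1 : q.ResidueField) ⊗ₜ[S] (t ^ n) = 0 := by
    refine Submodule.span_induction (p := fun t _ => (1 : q.ResidueField) ⊗ₜ[S] t = 0) ?_ ?_ ?_ ?_ ht
    · rintro _ ⟨b, hb, rfl⟩
      rw [← Algebra.TensorProduct.tmul_one_eq_one_tmul, Ideal.algebraMap_residueField_eq_zero.2 hb,
        TensorProduct.zero_tmul]
    · simp
    · rintro x y _ _ hx hy
      rw [TensorProduct.tmul_add, hx, hy, add_zero]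
    · rintro r x _ hx
      have : (1 : q.ResidueField) ⊗ₜ[S] (r • x) = (1 ⊗ₜ r) * (1 ⊗ₜ x) := by
        rw [Algebra.TensorProduct.tmul_mul_tmul, one_mul, smul_eq_mul]
      rw [this, hx, mul_zero]
  have h1 : (1 : q.ResidueField) ⊗ₜ[S] t = (0 : q.Fiber T) := by
    have : IsNilpotent ((1 : q.ResidueField) ⊗ₜ[S] t : q.Fiber T) :=
      ⟨n, by rw [Algebra.TensorProduct.tmul_pow, one_pow, h0]⟩
    exact this.eq_zero
  have h2 : algebraMap B (Localization M) (Ideal.Quotient.mk _ t) = 0 := by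
    have := congrArg g h1
    rw [map_zero] at this
    simpa [g, B, IsScalarTower.algebraMap_apply T B (Localization M)] using this
  obtain ⟨⟨_, s, hs, rfl⟩, hst⟩ := (IsLocalization.map_eq_zero_iff M _ _).1 h2
  refine ⟨s, hs, Ideal.Quotient.eq_zero_iff_mem.1 ?_⟩
  rw [map_mul]
  exact hst

/-! ### Domains and normality from a regular generic fibre. -/

section NormalFibers

variable {S : Type u} {T : Type v} [CommRing S] [CommRing T] [Algebra S T]
  [Module.Flat S T]

variable (S T) in
theorem algebraMapSubmonoid_nonZeroDivisors_le_of_flat :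
    Algebra.algebraMapSubmonoid T (nonZeroDivisors S) ≤ nonZeroDivisors T := by
  rintro _ ⟨s, hs, rfl⟩
  have h1 : IsSMulRegular T s := Module.Flat.isSMulRegular_of_nonZeroDivisors hs
  refine mem_nonZeroDivisors_iff_right.2 fun t ht => h1 ?_
  simp only [smul_zero]
  rw [Algebra.smul_def, mul_comm]
  exact ht

variable [IsDomain S] (W : Type w) [CommRing W] [Algebra T W]
  [IsLocalization (Algebra.algebraMapSubmonoid T (nonZeroDivisors S)) W]

theorem exists_eq_algebraMap_of_isIntegral_of_isReduced_fiber [IsNoetherianRing S]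
    [IsIntegrallyClosed S] (hred : ∀ (q : Ideal S) [q.IsPrime], IsReduced (q.Fiber T))
    {y : W} (hy : IsIntegral T y) : ∃ t : T, algebraMap T W t = y := by
  let _ : Algebra S W := ((algebraMap T W).comp (algebraMap S T)).toAlgebra
  have : IsScalarTower S T W := IsScalarTower.of_algebraMap_eq fun _ => rfl
  refine exists_eq_algebraMap_of_isIntegral (S := S)
    (IsLocalization.injective W (algebraMapSubmonoid_nonZeroDivisors_le_of_flat S T))
    (fun q _ t n ht => exists_mul_mem_map_of_isReduced_fiber q (hred q) ht) ?_ ?_ hy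
  · intro p hp w hw
    have hu : IsUnit (algebraMap S W p) := by
      rw [IsScalarTower.algebraMap_apply S T W]
      exact IsLocalization.map_units (M := Algebra.algebraMapSubmonoid T (nonZeroDivisors S)) W
        ⟨algebraMap S T p, p, mem_nonZeroDivisors_of_ne_zero hp, rfl⟩
    exact (hu.mul_right_eq_zero).1 hw
  · intro w
    obtain ⟨⟨t, _, s, hs, rfl⟩, hw⟩ :=
      IsLocalization.surj (Algebra.algebraMapSubmonoid T (nonZeroDivisors S)) w
    exact ⟨s, nonZeroDivisors.ne_zero hs, t, by
      rw [IsScalarTower.algebraMap_apply S T W, mul_comm]; exact hw⟩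

/-- Idempotents of $W$ are roots of $X^2-X$, hence integral over $T$, hence in $T$. -/
theorem exists_idempotent_of_mul_eq_zero_of_isRegularRing [IsNoetherianRing S]
    [IsIntegrallyClosed S] (hred : ∀ (q : Ideal S) [q.IsPrime], IsReduced (q.Fiber T))
    [IsRegularRing W] {x y : T} (hxy : x * y = 0) :
    ∃ i : T, IsIdempotentElem i ∧ i * x = 0 ∧ i * y = y := by
  have hinj : Function.Injective (algebraMap T W) :=
    IsLocalization.injective W (algebraMapSubmonoid_nonZeroDivisors_le_of_flat S T)
  obtain ⟨i, hi, hix, hiy⟩ := exists_idempotent_of_mul_eq_zero (W := W)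
    (fun P _ => IsRegularLocalRing.isDomain) (x := algebraMap T W x) (y := algebraMap T W y)
    (by rw [← map_mul, hxy, map_zero])
  obtain ⟨j, rfl⟩ := exists_eq_algebraMap_of_isIntegral_of_isReduced_fiber W hred (y := i)
    ⟨Polynomial.X ^ 2 - Polynomial.X, by monicity!, by
      simp [pow_two, hi.eq]⟩
  refine ⟨j, hinj (by rw [map_mul]; exact hi), hinj ?_, hinj ?_⟩
  · rw [map_mul, hix, map_zero]
  · rw [map_mul, hiy]

theorem isDomain_of_isRegularRing_localization [IsNoetherianRing S]
    [IsIntegrallyClosed S] (hred : ∀ (q : Ideal S) [q.IsPrime], IsReduced (q.Fiber T))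
    [IsRegularRing W] [IsLocalRing T] : IsDomain T := by
  have : NoZeroDivisors T := ⟨by
    intro x y hxy
    obtain ⟨i, hi, hix, hiy⟩ := exists_idempotent_of_mul_eq_zero_of_isRegularRing W hred hxy
    rcases IsLocalRing.isUnit_or_isUnit_one_sub_self i with hu | hu
    · exact Or.inl (hu.mul_right_eq_zero.1 hix)
    · refine Or.inr (hu.mul_right_eq_zero.1 ?_)
      rw [sub_mul, one_mul, hiy, sub_self]⟩
  exact NoZeroDivisors.to_isDomain T

/-- An integral fraction lies in $W$, because regular domains are normal, and then in $T$, which is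
integrally closed in $W$. -/
theorem isIntegrallyClosed_of_isRegularRing_localization [IsNoetherianRing S]
    [IsIntegrallyClosed S] (hred : ∀ (q : Ideal S) [q.IsPrime], IsReduced (q.Fiber T))
    [IsRegularRing W] [IsDomain T] : IsIntegrallyClosed T := by
  have hle := algebraMapSubmonoid_nonZeroDivisors_le_of_flat S T
  have hdom : IsDomain W := IsLocalization.isDomain_of_le_nonZeroDivisors W hle
  have hic : IsIntegrallyClosed W := IsRegularRing.isIntegrallyClosed
  let L := FractionRing T
  let : Algebra W L := (IsLocalization.lift
    (M := Algebra.algebraMapSubmonoid T (nonZeroDivisors S)) (S := W)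
    (g := algebraMap T L) (fun y => IsLocalization.map_units L (⟨y, hle y.2⟩ :
      nonZeroDivisors T))).toAlgebra
  have : IsScalarTower T W L := IsScalarTower.of_algebraMap_eq fun y => by
    rw [RingHom.algebraMap_toAlgebra, IsLocalization.lift_eq]
  have : IsFractionRing W L := IsFractionRing.isFractionRing_of_isDomain_of_isLocalization
    (Algebra.algebraMapSubmonoid T (nonZeroDivisors S)) _ _
  rw [isIntegrallyClosed_iff L]
  intro z hz
  obtain ⟨w, rfl⟩ := IsIntegrallyClosed.algebraMap_eq_of_integral (R := W) (hz.tower_top (A := W))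
  have hw : IsIntegral T w :=
    (isIntegral_algHom_iff (IsScalarTower.toAlgHom T W L) (IsFractionRing.injective W L)).1 hz
  obtain ⟨t, rfl⟩ := exists_eq_algebraMap_of_isIntegral_of_isReduced_fiber W hred hw
  exact ⟨t, IsScalarTower.algebraMap_apply T W L t⟩

end NormalFibers

/-! ### Completion of a normal ring with geometrically regular formal fibres. -/

section FormalFibers

variable {R : Type u} [CommRing R] [IsLocalRing R]

theorem HasGeometricallyRegularFormalFibers.isRegularRing_fractionField_tensorProduct
    [IsDomain R] (h : HasGeometricallyRegularFormalFibers R)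
    (K : Type v) [Field K] [Algebra R K] [IsFractionRing R K]
    (K' : Type w) [Field K'] [Algebra K K'] [FiniteDimensional K K']
    [Algebra R K'] [IsScalarTower R K K'] : IsRegularRing (K' ⊗[R] LocalCompletion R) := by
  let e : (⊥ : Ideal R).ResidueField ≃ₐ[R] K :=
    IsLocalization.algEquiv (nonZeroDivisors R) (⊥ : Ideal R).ResidueField K
  let _ : Algebra (⊥ : Ideal R).ResidueField K := e.toRingHom.toAlgebra
  let _ : Algebra (⊥ : Ideal R).ResidueField K' :=
    ((algebraMap K K').comp e.toRingHom).toAlgebra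
  have : IsScalarTower (⊥ : Ideal R).ResidueField K K' := IsScalarTower.of_algebraMap_eq fun _ => rfl
  have : IsScalarTower R (⊥ : Ideal R).ResidueField K' := IsScalarTower.of_algebraMap_eq fun x => by
    change _ = algebraMap K K' (e (algebraMap R _ x))
    rw [AlgEquiv.commutes, ← IsScalarTower.algebraMap_apply]
  have : Module.Finite (⊥ : Ideal R).ResidueField K :=
    Module.Finite.of_surjective (Algebra.linearMap _ K) e.surjective
  have : Module.Finite (⊥ : Ideal R).ResidueField K' := Module.Finite.trans K K'
  exact h.isRegularRing_tensorProduct ⊥ K'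

theorem HasGeometricallyRegularFormalFibers.isReduced_fiber
    (h : HasGeometricallyRegularFormalFibers R) (q : Ideal R) [q.IsPrime] :
    IsReduced (q.Fiber (LocalCompletion R)) := by
  have := h.isRegularRing_tensorProduct q q.ResidueField
  exact IsRegularRing.isReduced (A := q.Fiber (LocalCompletion R))

/-- The fibre over $q$ is $\kappa(q)\otimes_R\hat R$, and $\kappa(q)$ is finite over the residue
field of the prime below $q$. -/
theorem HasGeometricallyRegularFormalFibers.isReduced_fiber_tensorProduct
    (h : HasGeometricallyRegularFormalFibers R) (S : Type v) [CommRing S] [Algebra R S]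
    [Module.Finite R S] (q : Ideal S) [q.IsPrime] :
    IsReduced (q.Fiber (S ⊗[R] LocalCompletion R)) := by
  let p : Ideal R := q.under R
  let := Localization.AtPrime.algebraOfLiesOver p q
  have : IsScalarTower R p.ResidueField q.ResidueField := inferInstance
  have : Module.Finite p.ResidueField q.ResidueField := inferInstance
  have := h.isRegularRing_tensorProduct p q.ResidueField
  let e : q.Fiber (S ⊗[R] LocalCompletion R) ≃+* q.ResidueField ⊗[R] LocalCompletion R :=
    (Algebra.TensorProduct.cancelBaseChange R S S q.ResidueField
      (LocalCompletion R)).toRingEquiv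
  have hr : IsReduced (q.ResidueField ⊗[R] LocalCompletion R) := IsRegularRing.isReduced
  exact isReduced_of_injective e e.injective

variable [IsNoetherianRing R] [IsDomain R]

theorem HasGeometricallyRegularFormalFibers.isDomain_localCompletion [IsIntegrallyClosed R]
    (h : HasGeometricallyRegularFormalFibers R) : IsDomain (LocalCompletion R) := by
  have := h.isRegularRing_fractionField_tensorProduct (FractionRing R) (FractionRing R)
  have : IsRegularRing (LocalCompletion R ⊗[R] FractionRing R) :=
    IsRegularRing.of_ringEquiv (R := FractionRing R ⊗[R] LocalCompletion R)
      (Algebra.TensorProduct.comm R _ _).toRingEquiv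
  exact isDomain_of_isRegularRing_localization (S := R) (T := LocalCompletion R)
    (LocalCompletion R ⊗[R] FractionRing R) fun q _ => h.isReduced_fiber q

theorem HasGeometricallyRegularFormalFibers.isIntegrallyClosed_localCompletion
    [IsIntegrallyClosed R]
    (h : HasGeometricallyRegularFormalFibers R) : IsIntegrallyClosed (LocalCompletion R) := by
  have := h.isDomain_localCompletion
  have := h.isRegularRing_fractionField_tensorProduct (FractionRing R) (FractionRing R)
  have : IsRegularRing (LocalCompletion R ⊗[R] FractionRing R) :=
    IsRegularRing.of_ringEquiv (R := FractionRing R ⊗[R] LocalCompletion R)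
      (Algebra.TensorProduct.comm R _ _).toRingEquiv
  exact isIntegrallyClosed_of_isRegularRing_localization (S := R) (T := LocalCompletion R)
    (LocalCompletion R ⊗[R] FractionRing R) fun q _ => h.isReduced_fiber q

/-- The generic fibre of $S\otimes_R\hat R$ over $S$ is $K'\otimes_R\hat R$, which is regular. As
$S\otimes_R\hat R$ need not be local, the idempotent is kept until the passage to $\hat R'$. -/
theorem HasGeometricallyRegularFormalFibers.exists_idempotent_of_mul_eq_zero_tensorProduct
    (h : HasGeometricallyRegularFormalFibers R)
    (K : Type v) [Field K] [Algebra R K] [IsFractionRing R K]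
    (K' : Type w) [Field K'] [Algebra K K'] [FiniteDimensional K K']
    [Algebra R K'] [IsScalarTower R K K'] (S : Type*) [CommRing S] [IsDomain S]
    [IsIntegrallyClosed S] [Algebra R S] [Module.Finite R S] [Algebra S K'] [IsFractionRing S K']
    [IsScalarTower R S K'] {x y : S ⊗[R] LocalCompletion R} (hxy : x * y = 0) :
    ∃ i, IsIdempotentElem i ∧ i * x = 0 ∧ i * y = y := by
  have hS : IsNoetherianRing S := IsNoetherianRing.of_finite R S
  have hreg := h.isRegularRing_fractionField_tensorProduct K K'
  let : Algebra (S ⊗[R] LocalCompletion R) (K' ⊗[R] LocalCompletion R) :=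
    (Algebra.TensorProduct.map (IsScalarTower.toAlgHom R S K')
      (AlgHom.id R (LocalCompletion R))).toRingHom.toAlgebra
  have : IsScalarTower S (S ⊗[R] LocalCompletion R) (K' ⊗[R] LocalCompletion R) :=
    IsScalarTower.of_algebraMap_eq (R := S) (S := S ⊗[R] LocalCompletion R)
      (A := K' ⊗[R] LocalCompletion R) fun s => by
      rw [RingHom.algebraMap_toAlgebra]
      simp [Algebra.TensorProduct.algebraMap_apply]
  have : IsLocalization (Algebra.algebraMapSubmonoid (S ⊗[R] LocalCompletion R)
      (nonZeroDivisors S)) (K' ⊗[R] LocalCompletion R) :=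
    IsLocalization.tensorProduct_tensorProduct R (LocalCompletion R) (nonZeroDivisors S) K' (by
      ext x
      rw [RingHom.algebraMap_toAlgebra]
      simp)
  exact exists_idempotent_of_mul_eq_zero_of_isRegularRing (S := S) (K' ⊗[R] LocalCompletion R)
    (fun q _ => h.isReduced_fiber_tensorProduct S q) hxy

end FormalFibers

/-! ### Evaluation of power series; completions are Noetherian. -/

section PowerSeriesEvaluation

variable {B : Type u} {A : Type v} [CommRing B] [CommRing A] (I : Ideal A) [IsAdicComplete I A]
  {n : ℕ} (φ : B →+* A) (a : Fin n → A)

/-- Power series can be evaluated at elements of an ideal with respect to which the target is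
complete. -/
theorem exists_ringHom_mvPowerSeries (ha : ∀ i, a i ∈ I) :
    ∃ F : MvPowerSeries (Fin n) B →+* A,
      (∀ p : MvPolynomial (Fin n) B, F p = MvPolynomial.eval₂Hom φ a p) := by
  let J := MvPolynomial.idealOfVars (Fin n) B
  have hJ (m : ℕ) : J ^ m ≤ (I ^ m).comap (MvPolynomial.eval₂Hom φ a) := by
    rw [← Ideal.map_le_iff_le_comap, Ideal.map_pow]
    refine Ideal.pow_right_mono ?_ m
    rw [Ideal.map_le_iff_le_comap]
    refine Ideal.span_le.2 ?_
    rintro _ ⟨i, rfl⟩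
    simpa using ha i
  let f (m : ℕ) : MvPowerSeries (Fin n) B →+* A ⧸ I ^ m :=
    (Ideal.quotientMap (I ^ m) (MvPolynomial.eval₂Hom φ a) (hJ m)).comp
      (MvPowerSeries.truncTotalAlgHom (Fin n) B m).toRingHom
  have hf {l m : ℕ} (hle : l ≤ m) : (Ideal.Quotient.factorPow I hle).comp (f m) = f l := by
    ext p
    have h1 : p.truncTotal m - p.truncTotal l ∈ J ^ l :=
      MvPowerSeries.truncTotal_sub_truncTotal_mem_pow_idealOfVars hle le_rfl p
    have h2 := hJ l h1
    rw [Ideal.mem_comap, map_sub, ← Ideal.Quotient.eq] at h2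
    exact h2
  refine ⟨IsAdicComplete.liftRingHom I f hf, fun p => ?_⟩
  rw [← sub_eq_zero]
  refine IsHausdorff.haus (inferInstance : IsHausdorff I A) _ fun m => ?_
  rw [SModEq.zero, smul_eq_mul, Ideal.mul_top, ← Ideal.Quotient.eq_zero_iff_mem, map_sub,
    IsAdicComplete.mk_liftRingHom, sub_eq_zero]
  have h3 : (MvPowerSeries.truncTotalAlgHom (Fin n) B m) (p : MvPowerSeries (Fin n) B) =
      Ideal.Quotient.mk _ p :=
    (MvPowerSeries.truncTotalAlgHom (Fin n) B m).commutes p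
  change Ideal.quotientMap _ _ (hJ m) (MvPowerSeries.truncTotalAlgHom (Fin n) B m _) = _
  rw [h3, Ideal.quotientMap_mk]

/-- The variables map to generators of $I$ and the constants cover $A/I$. Surjectivity modulo the
ideal lifts because the power series ring is complete and $A$ is separated. -/
theorem exists_surjective_ringHom_mvPowerSeries
    (hI : Ideal.span (Set.range a) = I)
    (hφ : Function.Surjective ((Ideal.Quotient.mk I).comp φ)) :
    ∃ F : MvPowerSeries (Fin n) B →+* A, Function.Surjective F := by
  obtain ⟨F, hF⟩ := exists_ringHom_mvPowerSeries I φ a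
    fun i => hI ▸ Ideal.subset_span (Set.mem_range_self i)
  have hmap : (Ideal.span (Set.range (MvPowerSeries.X (R := B)))).map F = I := by
    rw [Ideal.map_span, ← Set.range_comp, ← hI]
    congr 2
    ext i
    have := hF (MvPolynomial.X i)
    simpa using this
  refine ⟨F, ?_⟩
  have : IsHausdorff ((Ideal.span (Set.range (MvPowerSeries.X (R := B)))).map F) A := by
    rw [hmap]; infer_instance
  refine surjective_of_mk_map_comp_surjective
    (I := Ideal.span (Set.range (MvPowerSeries.X (R := B)))) F ?_
  rw [hmap]
  intro y
  obtain ⟨b, hb⟩ := hφ y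
  refine ⟨MvPowerSeries.C b, ?_⟩
  have := hF (MvPolynomial.C b)
  simp only [MvPolynomial.coe_C, MvPolynomial.coe_eval₂Hom, MvPolynomial.eval₂_C] at this
  simpa [this] using hb

end PowerSeriesEvaluation

/-- A ring which is complete with respect to a finitely generated ideal, with Noetherian residue
ring (presented as a quotient of a Noetherian ring), is Noetherian. -/
theorem IsNoetherianRing.of_isAdicComplete {B : Type u} {A : Type v} [CommRing B] [CommRing A]
    [IsNoetherianRing B] (I : Ideal A) [IsAdicComplete I A] (hI : I.FG) (φ : B →+* A)
    (hφ : Function.Surjective ((Ideal.Quotient.mk I).comp φ)) : IsNoetherianRing A := by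
  obtain ⟨n, a, ha⟩ := Submodule.fg_iff_exists_fin_generating_family.1 hI
  obtain ⟨F, hF⟩ := exists_surjective_ringHom_mvPowerSeries I φ a ha hφ
  exact isNoetherianRing_of_surjective _ _ F hF

instance LocalCompletion.isNoetherianRing (R : Type u) [CommRing R] [IsLocalRing R]
    [IsNoetherianRing R] : IsNoetherianRing (LocalCompletion R) := by
  have h1 := AdicCompletion.maximalIdeal_eq_map (R := R)
  refine IsNoetherianRing.of_isAdicComplete (maximalIdeal (LocalCompletion R))
    (h1 ▸ Ideal.FG.map (maximalIdeal R).fg_of_isNoetherianRing _)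
    (algebraMap R (LocalCompletion R)) ?_
  intro y
  obtain ⟨z, hz⟩ := (AdicCompletion.residueField_map_bijective (R := R)).2 y
  obtain ⟨r, rfl⟩ := IsLocalRing.residue_surjective z
  exact ⟨r, hz⟩

/-! ### Coefficient fields in characteristic $p$. -/

section CoefficientField

/-- A field of characteristic `p` lifts along square-zero extensions of rings of
characteristic `p`: the lift is prescribed on `p`-th powers and is extended by Zorn's lemma. -/
theorem exists_ringHom_lift_of_sq_eq_bot {k : Type u} {B : Type v} [Field k] [CommRing B] (p : ℕ)
    [Fact p.Prime] [CharP k p] [CharP B p] (I : Ideal B) (hI : I ^ 2 = ⊥) (f : k →+* B ⧸ I) :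
    ∃ g : k →+* B, (Ideal.Quotient.mk I).comp g = f := by
  classical
  have hp : p.Prime := Fact.out
  have hpow {b b' : B} (h : Ideal.Quotient.mk I b = Ideal.Quotient.mk I b') : b ^ p = b' ^ p := by
    rw [Ideal.Quotient.eq] at h
    rw [← sub_eq_zero, ← sub_pow_char]
    have h2 : (b - b') ^ 2 ∈ I ^ 2 := Ideal.pow_mem_pow h 2
    rw [hI, Ideal.mem_bot] at h2
    exact pow_eq_zero_of_le hp.two_le h2
  -- the prescribed values on `p`-th powers
  choose s hs using fun x : k => Ideal.Quotient.mk_surjective (f x)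
  let σ : k →+* B :=
    { toFun x := s x ^ p
      map_one' := by
        rw [hpow (b := s 1) (b' := 1) (by rw [hs, map_one, map_one]), one_pow]
      map_zero' := by
        rw [hpow (b := s 0) (b' := 0) (by rw [hs, map_zero, map_zero]), zero_pow hp.ne_zero]
      map_mul' x y := by
        rw [hpow (b := s (x * y)) (b' := s x * s y) (by rw [map_mul, hs, hs, hs, map_mul]), mul_pow]
      map_add' x y := by
        rw [hpow (b := s (x + y)) (b' := s x + s y) (by rw [map_add, hs, hs, hs, map_add]),
          add_pow_char] }
  have hσ {x : k} {b : B} (hb : Ideal.Quotient.mk I b = f x) : b ^ p = σ x :=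
    hpow (hb.trans (hs x).symm)
  -- graphs of partial lifts
  let P : Set (Subring (k × B)) := {G | (∀ z ∈ G, Ideal.Quotient.mk I z.2 = f z.1) ∧
    (∀ z ∈ G, z.1 = 0 → z.2 = 0) ∧ ∀ x, (x ^ p, σ x) ∈ G}
  have h0 : ((frobenius k p).prod σ).range ∈ P := by
    refine ⟨?_, ?_, fun x => ⟨x, rfl⟩⟩
    · rintro _ ⟨x, rfl⟩
      change Ideal.Quotient.mk I (s x ^ p) = f (x ^ p)
      rw [map_pow, map_pow, hs]
    · rintro _ ⟨x, rfl⟩ hx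
      have hx0 : x = 0 := eq_zero_of_pow_eq_zero (n := p) hx
      change σ x = 0
      rw [hx0, map_zero]
  obtain ⟨G, -, hG⟩ := zorn_le_nonempty₀ P (by
    intro c hc hchain y hy
    have hmem {z : k × B} : z ∈ sSup c ↔ ∃ G ∈ c, z ∈ G :=
      Subring.mem_sSup_of_directedOn ⟨y, hy⟩ hchain.directedOn
    refine ⟨sSup c, ⟨fun z hz => ?_, fun z hz => ?_, fun x => ?_⟩, fun z hz => le_sSup hz⟩
    · obtain ⟨G, hG, hzG⟩ := hmem.1 hz
      exact (hc hG).1 z hzG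
    · obtain ⟨G, hG, hzG⟩ := hmem.1 hz
      exact (hc hG).2.1 z hzG
    · exact hmem.2 ⟨y, hy, (hc hy).2.2 x⟩) _ h0
  obtain ⟨⟨hG1, hG2, hG3⟩, hmax⟩ := hG
  let π : G →+* k := (RingHom.fst k B).comp G.subtype
  have hπ : Function.Injective π := by
    rw [injective_iff_map_eq_zero]
    rintro ⟨z, hz⟩ h
    exact Subtype.ext (Prod.ext h (hG2 z hz h))
  let L : Subfield k :=
    { π.range with
      inv_mem' := by
        rintro _ ⟨z, rfl⟩
        by_cases h : π z = 0
        · rw [h, inv_zero]; exact π.range.zero_mem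
        -- The inverse is a power of $z$ times a $p$-th power, and every $p$-th power belongs to the
        -- domain of the partial lift.
        · have h1 : (π z)⁻¹ = π z ^ (p - 1) * ((π z)⁻¹) ^ p := by
            obtain ⟨m, hm⟩ : ∃ m, p = m + 1 := ⟨p - 1, (Nat.succ_pred_prime hp).symm⟩
            rw [hm, Nat.add_sub_cancel, pow_succ, ← mul_assoc, ← mul_pow, mul_inv_cancel₀ h,
              one_pow, one_mul]
          rw [h1]
          exact π.range.mul_mem (π.range.pow_mem ⟨z, rfl⟩ _) ⟨⟨_, hG3 _⟩, rfl⟩ }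
  have hL (x : k) : x ∈ L ↔ ∃ z : G, π z = x := Iff.rfl
  let e : G ≃+* L := RingEquiv.ofBijective (π.codRestrict L fun z => ⟨z, rfl⟩)
    ⟨fun a b h => hπ (congrArg Subtype.val h), fun x => by
      obtain ⟨z, hz⟩ := (hL _).1 x.2
      exact ⟨z, Subtype.ext hz⟩⟩
  let g : L →+* B := ((RingHom.snd k B).comp G.subtype).comp e.symm.toRingHom
  have he (z : G) : ((e z : L) : k) = z.1.1 := rfl
  have hg (z : G) : g (e z) = z.1.2 := by simp [g]
  have hgmem (x : L) : ((x : k), g x) ∈ G := by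
    obtain ⟨z, rfl⟩ := e.surjective x
    rw [he, hg]; exact z.2
  have htop (t : k) : t ∈ L := by
    by_contra ht
    let b := s t
    let Φ : Polynomial L →+* k × B :=
      (Polynomial.eval₂RingHom L.subtype t).prod (Polynomial.eval₂RingHom g b)
    have htp : t ^ p ∈ L := ⟨⟨_, hG3 t⟩, rfl⟩
    -- If $t$ is missing, $X^p-t^p$ is its minimal polynomial over $L$. Any lift $b$ of $f(t)$
    -- satisfies $b^p=\sigma(t)$, so $t\mapsto b$ extends the partial lift.
    have hirr : Irreducible (Polynomial.X ^ p - Polynomial.C (⟨t ^ p, htp⟩ : L)) := by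
      refine X_pow_sub_C_irreducible_of_prime hp fun x hx => ht ?_
      have : (x : k) ^ p = t ^ p := congrArg Subtype.val hx
      have h2 : (x : k) = t := frobenius_inj k p this
      rw [← h2]; exact x.2
    have hgt : g ⟨t ^ p, htp⟩ = σ t := by
      have h1 : (⟨t ^ p, htp⟩ : L) = e ⟨_, hG3 t⟩ := Subtype.ext rfl
      rw [h1, hg]
    have hΦ : Φ.range ∈ P := by
      refine ⟨?_, ?_, ?_⟩
      · rintro _ ⟨q, rfl⟩
        have : (Ideal.Quotient.mk I).comp (Polynomial.eval₂RingHom g b) =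
            f.comp (Polynomial.eval₂RingHom L.subtype t) := by
          refine Polynomial.ringHom_ext (fun x => ?_) ?_
          · simpa using hG1 _ (hgmem x)
          · simpa [b] using hs t
        exact RingHom.congr_fun this q
      · rintro _ ⟨q, rfl⟩ hq
        have hdvd : (Polynomial.X ^ p - Polynomial.C (⟨t ^ p, htp⟩ : L)) ∣ q := by
          by_contra hnd
          obtain ⟨a, c, hac⟩ := (hirr.coprime_iff_not_dvd).2 hnd
          have h3 := congrArg (Polynomial.eval₂RingHom L.subtype t) hac
          have hq' : Polynomial.eval₂ L.subtype t q = 0 := hq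
          simp [hq', Polynomial.eval₂_mul] at h3
        obtain ⟨r, rfl⟩ := hdvd
        change Polynomial.eval₂RingHom g b _ = 0
        rw [map_mul]
        have : Polynomial.eval₂RingHom g b
            (Polynomial.X ^ p - Polynomial.C (⟨t ^ p, htp⟩ : L)) = 0 := by
          simp only [map_sub, map_pow, Polynomial.coe_eval₂RingHom, Polynomial.eval₂_X,
            Polynomial.eval₂_C, hgt]
          rw [hσ (hs t), sub_self]
        rw [this, zero_mul]
      · intro x
        refine ⟨Polynomial.C (e ⟨_, hG3 x⟩), ?_⟩
        refine Prod.ext ?_ ?_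
        · change Polynomial.eval₂RingHom L.subtype t _ = _
          simp [he]
        · change Polynomial.eval₂RingHom g b _ = _
          simp [hg]
    have hle : G ≤ Φ.range := by
      intro z hz
      refine ⟨Polynomial.C (e ⟨z, hz⟩), ?_⟩
      refine Prod.ext ?_ ?_
      · change Polynomial.eval₂RingHom L.subtype t _ = _
        simp [he]
      · change Polynomial.eval₂RingHom g b _ = _
        simp [hg]
    have hmem : (t, b) ∈ G := hmax hΦ hle ⟨Polynomial.X, by
      refine Prod.ext ?_ ?_
      · change Polynomial.eval₂RingHom L.subtype t _ = _
        simp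
      · change Polynomial.eval₂RingHom g b _ = _
        simp⟩
    exact ht ⟨⟨_, hmem⟩, rfl⟩
  refine ⟨g.comp ((RingHom.id k).codRestrict L htop), RingHom.ext fun x => ?_⟩
  exact hG1 _ (hgmem ⟨x, htop x⟩)

/-- Every field of characteristic `p` is formally smooth over its prime field. -/
theorem Algebra.FormallySmooth.of_zmod (k : Type u) [Field k] (p : ℕ) [Fact p.Prime]
    [Algebra (ZMod p) k] : Algebra.FormallySmooth (ZMod p) k := by
  refine .of_comp_surjective fun B _ _ I hI f => ?_
  rcases subsingleton_or_nontrivial B with hB | hB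
  · have : Subsingleton (B ⧸ I) := Ideal.Quotient.mk_surjective.subsingleton
    exact ⟨{ toFun _ := 0
             map_one' := Subsingleton.elim _ _
             map_zero' := rfl
             map_mul' _ _ := Subsingleton.elim _ _
             map_add' _ _ := Subsingleton.elim _ _
             commutes' _ := Subsingleton.elim _ _ }, AlgHom.ext fun _ => Subsingleton.elim _ _⟩
  · have : CharP k p := charP_of_injective_algebraMap (algebraMap (ZMod p) k).injective p
    have : CharP B p := charP_of_injective_algebraMap (algebraMap (ZMod p) B).injective p
    obtain ⟨g, hg⟩ := exists_ringHom_lift_of_sq_eq_bot p I hI f.toRingHom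
    refine ⟨{ g with commutes' := fun x => ?_ }, AlgHom.ext fun x => RingHom.congr_fun hg x⟩
    exact RingHom.congr_fun (RingHom.ext_zmod (g.comp (algebraMap (ZMod p) k))
      (algebraMap (ZMod p) B)) x

/-- A complete local ring of characteristic `p` contains a coefficient field. -/
theorem exists_coefficientField (A : Type u) [CommRing A] [IsLocalRing A]
    [IsAdicComplete (maximalIdeal A) A] (p : ℕ) [Fact p.Prime] [CharP A p] :
    ∃ g : ResidueField A →+* A, (residue A).comp g = RingHom.id _ := by
  let : Algebra (ZMod p) A := ZMod.algebra A p
  have := Algebra.FormallySmooth.of_zmod (ResidueField A) p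
  obtain ⟨g, hg⟩ := Algebra.FormallySmooth.exists_mkₐ_comp_eq_of_isAdicComplete
    (I := maximalIdeal A) (AlgHom.id (ZMod p) (ResidueField A))
  exact ⟨g.toRingHom, RingHom.ext fun x => AlgHom.congr_fun hg x⟩

end CoefficientField

/-! ### Power series over a normal Noetherian domain are normal. -/

section PowerSeriesNormal

open PowerSeries

variable {A : Type u} [CommRing A] [IsDomain A]

/-- Subtract the terms below degree $m$, already known to lie in $A$, and divide by $X^m$. The
lowest coefficient of $d$ is then a common denominator for all powers of the coefficient in
question. That coefficient is almost integral over $A$, hence in $A$. -/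
theorem PowerSeries.coeff_mem_range_of_forall_mul_pow [IsNoetherianRing A] [IsIntegrallyClosed A]
    {L : Type v} [Field L] [Algebra A L] [IsFractionRing A L] {d : A⟦X⟧} (hd : d ≠ 0) {x : L⟦X⟧}
    (hx : ∀ n, map (algebraMap A L) d * x ^ n ∈ (map (algebraMap A L)).range) (m : ℕ) :
    coeff m x ∈ (algebraMap A L).range := by
  induction m using Nat.strong_induction_on with
  | _ m ih =>
    have ht : ∃ t : A⟦X⟧, ∀ i < m, coeff i (x - map (algebraMap A L) t) = 0 := by
      choose! c hc using ih
      refine ⟨PowerSeries.mk c, fun i hi => ?_⟩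
      simp [hc i hi]
    obtain ⟨t, ht⟩ := ht
    obtain ⟨z, hz⟩ := X_pow_dvd_iff.2 ht
    obtain ⟨e, d', hd', hde⟩ : ∃ (e : ℕ) (d' : A⟦X⟧), coeff 0 d' ≠ 0 ∧ d = X ^ e * d' := by
      obtain ⟨d', h⟩ := X_pow_order_dvd (φ := d)
      refine ⟨_, d', fun h0 => ?_, h⟩
      have h1 := coeff_order hd
      have h2 := congrArg (coeff d.order.toNat) h
      rw [coeff_X_pow_mul', if_pos le_rfl, Nat.sub_self, h0] at h2
      exact h1 h2
    have hy (n : ℕ) : map (algebraMap A L) d * (x - map (algebraMap A L) t) ^ n ∈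
        (map (algebraMap A L)).range := by
      rw [sub_eq_add_neg, add_pow, Finset.mul_sum]
      refine Subring.sum_mem _ fun i _ => ?_
      have : map (algebraMap A L) d * (x ^ i * (-map (algebraMap A L) t) ^ (n - i) *
          (n.choose i : L⟦X⟧)) = (map (algebraMap A L) d * x ^ i) *
          map (algebraMap A L) ((-t) ^ (n - i) * (n.choose i : A⟦X⟧)) := by
        simp only [map_mul, map_pow, map_neg, map_natCast]
        ring
      rw [this]
      exact Subring.mul_mem _ (hx i) ⟨_, rfl⟩
    have hz0 : IsAlmostIntegral A (coeff 0 z) := by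
      refine ⟨coeff 0 d', mem_nonZeroDivisors_of_ne_zero hd', fun n => ?_⟩
      obtain ⟨a, ha⟩ := hy n
      refine ⟨coeff (e + m * n) a, ?_⟩
      have h6 : map (algebraMap A L) a =
          X ^ (e + m * n) * (map (algebraMap A L) d' * z ^ n) := by
        rw [ha, hz, hde, map_mul, map_pow, map_X]
        ring
      have h3 := congrArg (coeff (0 + (e + m * n))) h6
      rw [coeff_X_pow_mul, zero_add, coeff_map] at h3
      rw [h3, Algebra.smul_def]
      simp only [coeff_zero_eq_constantCoeff, map_mul, map_pow]
      congr 1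
    obtain ⟨b, hb⟩ := IsIntegrallyClosed.isIntegral_iff.1 hz0.isIntegral
    have h4 : coeff m x = coeff m (map (algebraMap A L) t) + coeff 0 z := by
      have h5 := congrArg (coeff (0 + m)) hz
      rw [coeff_X_pow_mul, zero_add, map_sub] at h5
      rw [← h5]; ring
    rw [h4, ← hb, coeff_map]
    exact ⟨_, map_add _ _ _⟩

/-- Normality of $L[[X]]$ places an integral fraction in $L[[X]]$. Almost integrality supplies one
denominator for all its powers, which controls the coefficients. -/
instance PowerSeries.isIntegrallyClosed [IsNoetherianRing A] [IsIntegrallyClosed A] :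
    IsIntegrallyClosed A⟦X⟧ := by
  let L := FractionRing A
  let ψ : A⟦X⟧ →+* L⟦X⟧ := map (algebraMap A L)
  have hψ : Function.Injective ψ := by
    intro a b h
    ext n
    have := congrArg (coeff n) h
    simp only [ψ, coeff_map] at this
    exact IsFractionRing.injective A L this
  let Φ : FractionRing A⟦X⟧ →+* FractionRing L⟦X⟧ := IsFractionRing.map hψ
  have hΦ (a : A⟦X⟧) : Φ (algebraMap _ _ a) = algebraMap _ _ (ψ a) := IsLocalization.map_eq _ a
  refine (isIntegrallyClosed_iff (FractionRing A⟦X⟧)).2 fun {x} hx => ?_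
  have h1 : IsIntegral L⟦X⟧ (Φ x) := by
    obtain ⟨P, hP, hPx⟩ := hx
    refine ⟨P.map ψ, hP.map ψ, ?_⟩
    have := congrArg Φ hPx
    rw [Polynomial.hom_eval₂, map_zero] at this
    rw [Polynomial.eval₂_map, ← this]
    congr 1
    ext a
    exact (hΦ a).symm
  obtain ⟨y, hy⟩ := IsIntegrallyClosed.isIntegral_iff.1 h1
  obtain ⟨d, hd, hdx⟩ := hx.isAlmostIntegral
  have h2 : ∀ n, ψ d * y ^ n ∈ ψ.range := by
    intro n
    obtain ⟨a, ha⟩ := hdx n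
    refine ⟨a, IsFractionRing.injective L⟦X⟧ (FractionRing L⟦X⟧) ?_⟩
    rw [← hΦ, ha, Algebra.smul_def, map_mul, map_pow, hΦ, map_mul, map_pow, hy]
  have h3 := coeff_mem_range_of_forall_mul_pow (nonZeroDivisors.ne_zero hd) h2
  choose c hc using h3
  refine ⟨PowerSeries.mk c, Φ.injective ?_⟩
  rw [hΦ, ← hy]
  congr 1
  ext n
  simp [ψ, hc]

end PowerSeriesNormal

/-! ### Functionals on $q$-th roots. -/

section FrobeniusFunctional

open PowerSeries

/-- The functionals `A^{1/q} → A` separate points; elements of `A^{1/q}` are represented by their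
`q`-th powers. -/
def HasSeparatingRootFunctionals (A : Type u) [CommRing A] (q : ℕ) : Prop :=
  ∀ c : A, c ≠ 0 → ∃ l : A →+ A, (∀ b x, l (b ^ q * x) = b * l x) ∧ l c ≠ 0

theorem HasSeparatingRootFunctionals.of_ringEquiv {A : Type u} {B : Type v} [CommRing A]
    [CommRing B] (e : A ≃+* B) {q : ℕ} (h : HasSeparatingRootFunctionals A q) :
    HasSeparatingRootFunctionals B q := by
  intro c hc
  obtain ⟨l, hl, hlc⟩ := h (e.symm c) (by simpa using hc)
  refine ⟨(e.toAddEquiv.toAddMonoidHom.comp l).comp e.symm.toAddEquiv.toAddMonoidHom, ?_, ?_⟩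
  · intro b x
    simp [hl]
  · simpa using hlc

theorem exists_addMonoidHom_semilinear {k : Type u} {K : Type v} [Field k] [Field K]
    (φ : k →+* K) {c : K} (hc : c ≠ 0) :
    ∃ l : K →+ k, (∀ b x, l (φ b * x) = b * l x) ∧ l c ≠ 0 := by
  let := φ.toAlgebra
  have h := mt (Module.forall_dual_apply_eq_zero_iff k c).1 hc
  push Not at h
  obtain ⟨l, hl⟩ := h
  exact ⟨l.toAddMonoidHom, fun b x => l.map_smul b x, hl⟩

theorem HasSeparatingRootFunctionals.field (k : Type u) [Field k] (p e : ℕ) [Fact p.Prime]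
    [CharP k p] : HasSeparatingRootFunctionals k (p ^ e) := by
  intro c hc
  obtain ⟨l, hl, hlc⟩ := exists_addMonoidHom_semilinear (iterateFrobenius k p e) hc
  exact ⟨l, fun b x => hl b x, hlc⟩

/-- Apply $l$ to the coefficients in degrees congruent to $j$ modulo $q=p^e$, where $j$ is the class
of a degree in which $c$ has a nonzero coefficient. Semilinearity holds because $b^q=\sum
b_i^qX^{qi}$ only involves degrees divisible by $q$. -/
theorem HasSeparatingRootFunctionals.powerSeries (A : Type u) [CommRing A] (p e : ℕ)
    [Fact p.Prime] [CharP A p] (h : HasSeparatingRootFunctionals A (p ^ e)) :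
    HasSeparatingRootFunctionals A⟦X⟧ (p ^ e) := by
  have hp : p.Prime := Fact.out
  have hq : p ^ e ≠ 0 := pow_ne_zero _ hp.ne_zero
  have hpow (b : A⟦X⟧) : b ^ p ^ e = map (iterateFrobenius A p e) (b.expand (p ^ e) hq) :=
    (MvPowerSeries.map_iterateFrobenius_expand p hp.ne_zero b e).symm
  intro c hc
  obtain ⟨m, hm⟩ := exists_coeff_ne_zero_iff_ne_zero.2 hc
  obtain ⟨l, hl, hlc⟩ := h _ hm
  let j := m % p ^ e
  refine ⟨{ toFun x := PowerSeries.mk fun n => l (coeff (p ^ e * n + j) x)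
            map_zero' := by ext; simp
            map_add' x y := by ext; simp }, fun b x => ?_, fun h0 => hlc ?_⟩
  · ext n
    simp only [AddMonoidHom.coe_mk, ZeroHom.coe_mk, coeff_mk, coeff_mul, map_sum, hpow]
    symm
    refine Finset.sum_of_injOn (fun i => (p ^ e * i.1, p ^ e * i.2 + j)) ?_ ?_ ?_ ?_
    · rintro ⟨a, b⟩ - ⟨a', b'⟩ - h
      simp only [Prod.mk.injEq, mul_eq_mul_left_iff, hq, or_false, add_left_inj] at h
      exact Prod.ext h.1 h.2
    · rintro ⟨a, b⟩ h
      simp only [Finset.mem_coe, Finset.HasAntidiagonal.mem_antidiagonal] at h ⊢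
      rw [← h, mul_add, add_assoc]
    · rintro ⟨u, v⟩ h hn
      rw [coeff_map, coeff_expand_of_not_dvd, map_zero, zero_mul, map_zero]
      rintro ⟨i, rfl⟩
      rw [Finset.HasAntidiagonal.mem_antidiagonal] at h
      have hj : j < p ^ e := Nat.mod_lt _ (Nat.pos_of_ne_zero hq)
      have hi : i ≤ n := by
        by_contra hlt
        have : p ^ e * (n + 1) ≤ p ^ e * i := Nat.mul_le_mul_left _ (by omega)
        rw [mul_add] at this
        simp only at h
        omega
      obtain ⟨i', rfl⟩ := Nat.exists_eq_add_of_le hi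
      refine hn ⟨(i, i'), by simp, ?_⟩
      simp only [mul_add] at h ⊢
      refine Prod.ext rfl ?_
      simp only
      omega
    · rintro ⟨a, b'⟩ -
      rw [coeff_map, coeff_expand_mul, iterateFrobenius_def, hl]
  · have := congrArg (coeff (m / p ^ e)) h0
    simpa [j, Nat.div_add_mod] using this

end FrobeniusFunctional

/-! ### Finiteness of integral closure in purely inseparable extensions. -/

section PurelyInseparable

/-- A torsionless module of finite rank over a Noetherian domain is finite. -/
theorem Module.Finite.of_forall_exists_functional {A : Type*} [CommRing A] [IsDomain A]
    [IsNoetherianRing A] (F : Type*) [Field F] [Algebra A F] [IsFractionRing A F]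
    {N M : Type*} [AddCommGroup N] [Module A N] [AddCommGroup M] [Module A M] [Module F M]
    [IsScalarTower A F M] [FiniteDimensional F M] (g : N →ₗ[A] M)
    [IsLocalizedModule (nonZeroDivisors A) g]
    (h : ∀ n : N, n ≠ 0 → ∃ l : N →ₗ[A] A, l n ≠ 0) : Module.Finite A N := by
  classical
  let ext (l : N →ₗ[A] A) : M →ₗ[F] F :=
    IsLocalizedModule.mapExtendScalars (nonZeroDivisors A) g (Algebra.linearMap A F) F l
  have hext (l : N →ₗ[A] A) (n : N) : ext l (g n) = algebraMap A F (l n) := by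
    simp [ext, IsLocalizedModule.map_apply]
  let K (s : Finset (N →ₗ[A] A)) : Submodule F M := ⨅ l ∈ s, LinearMap.ker (ext l)
  -- Among the common kernels of finitely many functionals, a minimal one exists by finite
  -- dimensionality. It meets the image of $N$ trivially, so these functionals embed $N$ into a
  -- finite free module.
  obtain ⟨_, ⟨s, rfl⟩, hs⟩ := WellFounded.has_min (r := ((· < ·) : Submodule F M → _ → Prop))
    wellFounded_lt (Set.range K) ⟨_, ⟨∅, rfl⟩⟩
  have hbot (n : N) (hn : ∀ l ∈ s, l n = 0) : n = 0 := by
    by_contra hn0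
    obtain ⟨l, hl⟩ := h n hn0
    refine hs (K (insert l s)) ⟨_, rfl⟩ (lt_of_le_of_ne ?_ fun heq => ?_)
    · exact le_iInf₂ fun l' hl' => iInf₂_le l' (Finset.mem_insert_of_mem hl')
    · have h1 : g n ∈ K s := by
        simp only [K, Submodule.mem_iInf, LinearMap.mem_ker]
        intro l' hl'
        rw [hext, hn l' hl', map_zero]
      rw [← heq] at h1
      simp only [K, Submodule.mem_iInf, LinearMap.mem_ker] at h1
      have h2 := h1 l (Finset.mem_insert_self l s)
      rw [hext] at h2
      exact hl (IsFractionRing.injective A F (by rw [h2, map_zero]))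
  refine Module.Finite.of_injective (LinearMap.pi fun l : s => (l : N →ₗ[A] A)) ?_
  rw [← LinearMap.ker_eq_bot, LinearMap.ker_eq_bot']
  intro n hn
  exact hbot n fun l hl => congrFun hn ⟨l, hl⟩

/-- For $s\in S$ the power $s^{p^e}$ lies in $A$ by normality. Composing a root functional with
$s\mapsto s^{p^e}$ is $A$-linear, so $S$ is torsionless. -/
theorem IsIntegralClosure.finite_of_pow_mem_range {A : Type*} [CommRing A] [IsDomain A]
    [IsNoetherianRing A] [IsIntegrallyClosed A] (F : Type*) [Field F] [Algebra A F]
    [IsFractionRing A F] (M : Type*) [Field M] [Algebra A M] [Algebra F M] [IsScalarTower A F M]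
    [FiniteDimensional F M] (S : Type*) [CommRing S] [Algebra A S] [Algebra S M]
    [IsScalarTower A S M] [IsIntegralClosure S A M] (p e : ℕ) [Fact p.Prime] [CharP A p]
    (hM : ∀ x : M, x ^ p ^ e ∈ (algebraMap F M).range)
    (hA : HasSeparatingRootFunctionals A (p ^ e)) : Module.Finite A S := by
  have hq : p ^ e ≠ 0 := pow_ne_zero _ (Fact.out : p.Prime).ne_zero
  have hSM : Function.Injective (algebraMap S M) := IsIntegralClosure.algebraMap_injective S A M
  have : IsDomain S := hSM.isDomain (algebraMap S M)
  have hAM : Function.Injective (algebraMap A M) := by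
    rw [IsScalarTower.algebraMap_eq A F M]
    exact (algebraMap F M).injective.comp (IsFractionRing.injective A F)
  have hAS : Function.Injective (algebraMap A S) := by
    rw [IsScalarTower.algebraMap_eq A S M] at hAM
    exact Function.Injective.of_comp hAM
  have : CharP S p := charP_of_injective_algebraMap hAS p
  have hroot (s : S) : ∃ a : A, algebraMap A S a = s ^ p ^ e := by
    obtain ⟨y, hy⟩ := hM (algebraMap S M s)
    have h1 : IsIntegral A y := by
      have h2 : IsIntegral A (algebraMap S M s) :=
        (IsIntegralClosure.isIntegral A M s).algebraMap
      have h3 := h2.pow (p ^ e)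
      rw [← hy] at h3
      exact (isIntegral_algebraMap_iff (algebraMap F M).injective).1 h3
    obtain ⟨a, rfl⟩ := IsIntegrallyClosed.isIntegral_iff.1 h1
    refine ⟨a, hSM ?_⟩
    rw [map_pow, ← hy, ← IsScalarTower.algebraMap_apply, ← IsScalarTower.algebraMap_apply]
  choose ρ hρ using hroot
  have := IsIntegralClosure.isLocalization A F M S
  refine Module.Finite.of_forall_exists_functional F (M := M)
    (IsScalarTower.toAlgHom A S M).toLinearMap fun s hs => ?_
  obtain ⟨l, hl, hls⟩ := hA (ρ s) fun h0 => hs (by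
    have := hρ s
    rw [h0, map_zero] at this
    exact eq_zero_of_pow_eq_zero this.symm)
  refine ⟨{ toFun x := l (ρ x), map_add' x y := ?_, map_smul' a x := ?_ }, hls⟩
  · rw [← map_add]
    congr 1
    apply hAS
    rw [map_add, hρ, hρ, hρ, add_pow_expChar_pow]
  · rw [RingHom.id_apply, smul_eq_mul, ← hl]
    congr 1
    apply hAS
    rw [map_mul, map_pow, hρ, hρ, Algebra.smul_def, mul_pow]

end PurelyInseparable

/-! ### Nakayama's lemma over complete rings. -/

section CompleteNakayama

variable {P : Type*} [CommRing P] (I : Ideal P)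

theorem IsPrecomplete.pi [IsPrecomplete I P] (r : ℕ) : IsPrecomplete I (Fin r → P) := by
  classical
  have hmem (n : ℕ) (x : Fin r → P) :
      x ∈ (I ^ n • ⊤ : Submodule P (Fin r → P)) ↔ ∀ i, x i ∈ (I ^ n • ⊤ : Submodule P P) := by
    constructor
    · intro hx i
      have h1 := Submodule.mem_map_of_mem (f := LinearMap.proj (R := P) (φ := fun _ => P) i) hx
      rw [Submodule.map_smul''] at h1
      exact Submodule.smul_mono le_rfl le_top h1
    · intro hx
      rw [pi_eq_sum_univ' x]
      refine Submodule.sum_mem _ fun i _ => Submodule.smul_mem_smul ?_ trivial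
      simpa using hx i
  refine ⟨fun f hf => ?_⟩
  have h1 (i : Fin r) : ∃ L : P, ∀ n, f n i ≡ L [SMOD (I ^ n • ⊤ : Submodule P P)] := by
    refine IsPrecomplete.prec (inferInstance : IsPrecomplete I P) fun {m n} hmn => ?_
    have := hf hmn
    rw [SModEq.sub_mem, hmem] at this
    exact SModEq.sub_mem.2 (this i)
  choose L hL using h1
  refine ⟨L, fun n => ?_⟩
  rw [SModEq.sub_mem, hmem]
  exact fun i => SModEq.sub_mem.1 (hL i n)

/-- Nakayama's lemma over a complete ring: a separated module is generated by lifts of generators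
modulo the ideal. -/
theorem Module.Finite.of_isPrecomplete [IsPrecomplete I P] {N : Type*} [AddCommGroup N]
    [Module P N] [IsHausdorff I N] (V : Submodule P N) (hV : V.FG) (h : V ⊔ I • ⊤ = ⊤) :
    Module.Finite P N := by
  obtain ⟨r, s, rfl⟩ := Submodule.fg_iff_exists_fin_generating_family.1 hV
  have := IsPrecomplete.pi I r
  let f : (Fin r → P) →ₗ[P] N := Fintype.linearCombination P s
  refine Module.Finite.of_surjective f (surjective_of_mkQ_comp_surjective (I := I) ?_)
  rw [← LinearMap.range_eq_top, LinearMap.range_comp, Fintype.range_linearCombination]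
  rw [eq_top_iff]
  rintro x -
  obtain ⟨x, rfl⟩ := Submodule.mkQ_surjective _ x
  obtain ⟨a, ha, b, hb, rfl⟩ := Submodule.mem_sup.1 (h ▸ Submodule.mem_top (x := x))
  refine ⟨a, ha, ?_⟩
  rw [map_add, left_eq_add]
  exact (Submodule.Quotient.mk_eq_zero _).2 hb

end CompleteNakayama

/-! ### Complete local domains are finite over power series rings. -/

section PowerSeriesNormalization

/-- If a ring `k` surjects onto the residue field, then a Noetherian local ring is finite over `k`
modulo every power of the maximal ideal. -/
theorem exists_fg_sup_maximalIdeal_pow {k A : Type*} [CommRing k] [CommRing A] [IsLocalRing A]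
    [IsNoetherianRing A] [Algebra k A]
    (hk : Function.Surjective ((residue A).comp (algebraMap k A))) (n : ℕ) :
    ∃ V : Submodule k A, V.FG ∧ ∀ a : A, ∃ v ∈ V, a - v ∈ maximalIdeal A ^ n := by
  induction n with
  | zero => exact ⟨⊥, Submodule.fg_bot, fun a => ⟨0, zero_mem _, by simp⟩⟩
  | succ n ih =>
    obtain ⟨V, hV, hVa⟩ := ih
    obtain ⟨r, t, ht⟩ := Submodule.fg_iff_exists_fin_generating_family.1
      (IsNoetherian.noetherian (maximalIdeal A ^ n))
    refine ⟨V ⊔ Submodule.span k (Set.range t),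
      hV.sup (Submodule.fg_span (Set.finite_range t)), fun a => ?_⟩
    obtain ⟨v, hv, hav⟩ := hVa a
    rw [← ht] at hav
    obtain ⟨c, hc⟩ := (Submodule.mem_span_range_iff_exists_fun A).1 hav
    choose b hb using fun i => hk (residue A (c i))
    refine ⟨v + ∑ i, b i • t i, Submodule.add_mem_sup hv (Submodule.sum_mem _ fun i _ =>
      Submodule.smul_mem _ _ (Submodule.subset_span ⟨i, rfl⟩)), ?_⟩
    rw [← sub_sub, ← hc, ← Finset.sum_sub_distrib]
    refine Ideal.sum_mem _ fun i _ => ?_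
    rw [smul_eq_mul, Algebra.smul_def, ← sub_mul, pow_succ']
    refine Ideal.mul_mem_mul ?_ (ht ▸ Submodule.subset_span ⟨i, rfl⟩)
    rw [← residue_eq_zero_iff, map_sub, sub_eq_zero]
    exact (hb i).symm

theorem MvPowerSeries.mem_span_range_X_of_constantCoeff_eq_zero {σ R : Type*} [Finite σ]
    [CommRing R] {f : MvPowerSeries σ R} (hf : MvPowerSeries.constantCoeff f = 0) :
    f ∈ Ideal.span (Set.range (MvPowerSeries.X (σ := σ) (R := R))) := by
  let e := (toAdicCompletionAlgEquiv σ R).toRingEquiv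
  have h1 : (Ideal.span (Set.range (MvPowerSeries.X (σ := σ) (R := R)))).map e =
      (MvPolynomial.idealOfVars σ R).map (algebraMap ..) := by
    simp_rw [Ideal.map_span, ← Set.range_comp]
    congr 2; ext1
    simp [e, AdicCompletion.algebraMap_apply, ← MvPolynomial.coe_X, toAdicCompletion_coe]
  have h3 := AdicCompletion.ker_evalOneₐ_eq_map _ (MvPolynomial.idealOfVars_fg σ R)
  have h2 : e f ∈ (Ideal.span (Set.range (MvPowerSeries.X (σ := σ) (R := R)))).map e := by
    rw [h1]
    refine h3.le ?_
    change AdicCompletion.evalOneₐ _ (toAdicCompletion σ R f) = 0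
    rw [toAdicCompletion, AdicCompletion.evalOneₐ_liftAlgHom, truncTotalAlgHom_apply]
    refine Ideal.Quotient.eq_zero_iff_mem.2 ?_
    rw [← pow_one (MvPolynomial.idealOfVars σ R), MvPolynomial.mem_pow_idealOfVars_iff']
    intro x hx
    rw [coeff_truncTotal _ hx]
    obtain rfl : x = 0 := (Finsupp.degree_eq_zero_iff x).1 (by omega)
    exact hf
    exact fun hle => AlgHom.ext fun _ => by
      simpa [Ideal.Quotient.mk_eq_mk_iff_sub_mem] using
        truncTotal_sub_truncTotal_mem_pow_idealOfVars hle le_rfl _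
  exact (Ideal.mem_map_of_equiv e _).1 h2 |> fun ⟨x, hx, hxf⟩ => e.injective hxf ▸ hx

theorem MvPowerSeries.ringKrullDim_le {k : Type*} [Field k] (d : ℕ) :
    ringKrullDim (MvPowerSeries (Fin d) k) ≤ d := by
  have h1 : maximalIdeal (MvPowerSeries (Fin d) k) = Ideal.span (Set.range MvPowerSeries.X) := by
    refine le_antisymm (fun f hf => ?_) ?_
    · refine mem_span_range_X_of_constantCoeff_eq_zero ?_
      by_contra h
      exact hf (MvPowerSeries.isUnit_iff_constantCoeff.2 (isUnit_iff_ne_zero.2 h))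
    · rw [Ideal.span_le]
      rintro _ ⟨i, rfl⟩
      intro h
      simpa using MvPowerSeries.isUnit_iff_constantCoeff.1 h
  refine (ringKrullDim_le_spanFinrank_maximalIdeal _).trans ?_
  rw [h1]
  have h2 := Submodule.spanFinrank_span_le_ncard_of_finite (R := MvPowerSeries (Fin d) k)
    (Set.finite_range (MvPowerSeries.X (σ := Fin d) (R := k)))
  have h3 : (Set.range (MvPowerSeries.X (σ := Fin d) (R := k))).ncard ≤ d := by
    rw [← Set.image_univ]
    refine (Set.ncard_image_le Set.finite_univ).trans ?_
    simp
  exact_mod_cast h2.trans h3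

/-- A complete Noetherian local domain of characteristic `p` is finite over a power series ring
over a field. -/
theorem exists_finite_injective_mvPowerSeries (A : Type u) [CommRing A] [IsDomain A]
    [IsLocalRing A] [IsNoetherianRing A] [IsAdicComplete (maximalIdeal A) A] (p : ℕ)
    [Fact p.Prime] [CharP A p] :
    ∃ (d : ℕ) (F : MvPowerSeries (Fin d) (ResidueField A) →+* A),
      Function.Injective F ∧ F.Finite := by
  obtain ⟨g, hg⟩ := exists_coefficientField A p
  -- The set $s$ is a system of parameters: as many elements as the dimension, with $m$ minimal over
  -- their span. Its span therefore contains a power of $m$.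
  obtain ⟨s, hs, hcard⟩ := Ideal.exists_finset_card_eq_height_of_isNoetherianRing (maximalIdeal A)
  let d := s.card
  let a : Fin d → A := fun i => (s.equivFin.symm i : A)
  have ha : Set.range a = s := by
    ext x
    constructor
    · rintro ⟨i, rfl⟩; exact (s.equivFin.symm i).2
    · intro hx; exact ⟨s.equivFin ⟨x, hx⟩, by simp [a]⟩
  have hle : Ideal.span (s : Set A) ≤ maximalIdeal A := hs.1.2
  have ham (i) : a i ∈ maximalIdeal A := hle (Ideal.subset_span (ha ▸ Set.mem_range_self i))
  obtain ⟨F, hF⟩ := exists_ringHom_mvPowerSeries (maximalIdeal A) g a ham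
  have hFX (i) : F (MvPowerSeries.X i) = a i := by simpa using hF (MvPolynomial.X i)
  have hFC (x) : F (MvPowerSeries.C x) = g x := by simpa using hF (MvPolynomial.C x)
  let P := MvPowerSeries (Fin d) (ResidueField A)
  let _ : Algebra P A := F.toAlgebra
  let I : Ideal P := Ideal.span (Set.range MvPowerSeries.X)
  have hI : I.map F = Ideal.span (s : Set A) := by
    rw [Ideal.map_span, ← Set.range_comp, ← ha]
    congr 2
    ext i
    exact hFX i
  have : IsHausdorff I A := by
    rw [← IsHausdorff.map_algebraMap_iff (S := A)]
    refine IsHausdorff.of_isLocalRing _ _ ?_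
    change I.map F ≠ ⊤
    rw [hI]
    exact ne_top_of_le_ne_top (Ideal.IsPrime.ne_top') hle
  have hrad : (Ideal.span (s : Set A)).radical = maximalIdeal A := by
    refine le_antisymm (hs.1.1.radical_le_iff.2 hle) ?_
    rw [Ideal.radical_eq_sInf]
    refine le_sInf fun J hJ => hs.2 ⟨hJ.2, hJ.1⟩ (le_maximalIdeal hJ.2.ne_top)
  obtain ⟨N, hN⟩ := Ideal.exists_pow_le_of_le_radical_of_fg hrad.ge
    (IsNoetherian.noetherian (maximalIdeal A))
  have hfin : Module.Finite P A := by
    let _ : Algebra (ResidueField A) A := g.toAlgebra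
    have : IsScalarTower (ResidueField A) P A := IsScalarTower.of_algebraMap_eq fun x => by
      exact (hFC x).symm
    obtain ⟨V, hV, hVa⟩ := exists_fg_sup_maximalIdeal_pow (k := ResidueField A) (A := A) (by
      intro y
      exact ⟨y, RingHom.congr_fun hg y⟩) N
    obtain ⟨t, rfl⟩ := hV
    refine Module.Finite.of_isPrecomplete I (Submodule.span P (t : Set A)) ⟨t, rfl⟩ ?_
    rw [eq_top_iff]
    rintro x -
    obtain ⟨v, hv, hxv⟩ := hVa x
    rw [← sub_add_cancel x v, add_comm]
    refine Submodule.add_mem_sup (Submodule.span_le_restrictScalars (ResidueField A) P _ hv) ?_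
    rw [Ideal.smul_top_eq_map]
    change x - v ∈ I.map F
    rw [hI]
    exact hN hxv
  refine ⟨d, F, ?_, hfin⟩
  rw [injective_iff_map_eq_zero]
  intro f hf
  by_contra hf0
  -- Injectivity is a dimension count. A nonzero $f$ in the kernel would make $A$, of dimension $d$,
  -- integral over $P/f$, of dimension at most $d-1$.
  have h1 : ringKrullDim P ≤ d := MvPowerSeries.ringKrullDim_le d
  have h2 := ringKrullDim_quotient_succ_le_of_nonZeroDivisor (mem_nonZeroDivisors_of_ne_zero hf0)
  have h3 : ringKrullDim A ≤ ringKrullDim (P ⧸ Ideal.span {f}) := by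
    let G : P ⧸ Ideal.span {f} →+* A := Ideal.Quotient.lift _ F (by
      intro x hx
      obtain ⟨y, rfl⟩ := Ideal.mem_span_singleton'.1 hx
      rw [map_mul, hf, mul_zero])
    have hG : G.IsIntegral := by
      intro x
      obtain ⟨Q, hQ, hQx⟩ := Algebra.IsIntegral.isIntegral (R := P) x
      refine ⟨Q.map (Ideal.Quotient.mk _), hQ.map _, ?_⟩
      rw [Polynomial.eval₂_map]
      exact hQx
    refine Order.krullDim_le_of_strictMono (PrimeSpectrum.comap G) ?_
    intro x y hxy
    obtain ⟨z, hzy, hzx⟩ := SetLike.exists_of_lt ((PrimeSpectrum.asIdeal_lt_asIdeal _ _).2 hxy)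
    let _ := G.toAlgebra
    exact Ideal.comap_lt_comap_of_integral_mem_sdiff hxy.le ⟨hzy, hzx⟩ (hG z)
  have h4 : ringKrullDim A = d := by
    rw [← IsLocalRing.maximalIdeal_height_eq_ringKrullDim, ← hcard]
    rfl
  rw [h4] at h3
  have h5 := (add_le_add_left h3 1).trans (h2.trans h1)
  have h6 : ((d + 1 : ℕ) : WithBot ℕ∞) ≤ (d : ℕ) := by exact_mod_cast h5
  have h7 : d + 1 ≤ d := by exact_mod_cast h6
  omega

end PowerSeriesNormalization

/-! ### Integral closures over complete local domains of characteristic $p$. -/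

section JapaneseProperty

/-- A finite normal extension is purely inseparable below the fixed field of its
automorphism group. -/
theorem isPurelyInseparable_fixedField_top (F M : Type*) [Field F] [Field M] [Algebra F M]
    [Normal F M] :
    IsPurelyInseparable F (IntermediateField.fixedField (⊤ : Subgroup Gal(M/F))) := by
  classical
  let q := ringExpChar F
  refine (le_perfectClosure_iff F M _).1 fun x hx => ?_
  rw [mem_perfectClosure_iff_natSepDegree_eq_one,
    Polynomial.natSepDegree_eq_of_splits (E := M) _ (Normal.splits inferInstance x)]
  have hint : IsIntegral F x := Normal.isIntegral inferInstance x
  rw [Finset.card_eq_one]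
  refine ⟨x, Finset.eq_singleton_iff_unique_mem.2 ⟨?_, fun y hy => ?_⟩⟩
  · rw [Multiset.mem_toFinset, Polynomial.mem_aroots]
    exact ⟨minpoly.ne_zero hint, minpoly.aeval F x⟩
  · rw [Multiset.mem_toFinset, Polynomial.mem_aroots] at hy
    obtain ⟨σ, rfl⟩ := minpoly.exists_algEquiv_of_root' hint.isAlgebraic hy.2
    exact (IntermediateField.mem_fixedField_iff _ _).1 hx σ trivial

theorem Module.Finite.integralClosure_of_separable_tower (B C H M L : Type*) [CommRing B]
    [IsNoetherianRing B] [CommRing C] [IsDomain C] [IsIntegrallyClosed C] [Algebra B C]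
    [Module.Finite B C] [Field H] [Algebra C H] [IsFractionRing C H] [Field M] [Algebra C M]
    [Algebra H M] [IsScalarTower C H M] [FiniteDimensional H M] [Algebra.IsSeparable H M]
    [Algebra B M] [IsScalarTower B C M] [Field L] [Algebra B L] [Algebra L M]
    [IsScalarTower B L M] : Module.Finite B (integralClosure B L) := by
  have : IsNoetherianRing C := isNoetherian_of_tower B (isNoetherian_of_isNoetherianRing_of_finite B C)
  let D := integralClosure C M
  have hDfin : Module.Finite C D := IsIntegralClosure.finite C H M D
  have : Module.Finite B D := Module.Finite.trans C D
  let f : integralClosure B L →ₐ[B] D :=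
    ((IsScalarTower.toAlgHom B L M).comp (integralClosure B L).val).codRestrict
      (D.restrictScalars B) fun x => by
        have h1 : IsIntegral B (algebraMap L M x) := x.2.algebraMap
        exact h1.tower_top
  have hf : Function.Injective f := fun x y h => Subtype.ext
    ((algebraMap L M).injective (congrArg Subtype.val h))
  exact Module.Finite.of_injective f.toLinearMap hf

/-- The normal closure $M$ of $L$ is Galois over the fixed field $H$ of its automorphisms, and $H$
is purely inseparable over $F$. The root functionals handle $H/F$ and the trace form handles $M/H$.
-/
theorem Module.Finite.integralClosure_of_separatingRootFunctionals (B : Type*) [CommRing B]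
    [IsDomain B] [IsNoetherianRing B] [IsIntegrallyClosed B] (p : ℕ) [Fact p.Prime] [CharP B p]
    (hB : ∀ e, HasSeparatingRootFunctionals B (p ^ e)) (F : Type*) [Field F] [Algebra B F]
    [IsFractionRing B F] (L : Type*) [Field L] [Algebra B L] [Algebra F L] [IsScalarTower B F L]
    [FiniteDimensional F L] : Module.Finite B (integralClosure B L) := by
  have : CharP F p := charP_of_injective_algebraMap (IsFractionRing.injective B F) p
  let M := IntermediateField.normalClosure F L (AlgebraicClosure L)
  have : Normal F M := inferInstance
  let H := IntermediateField.fixedField (⊤ : Subgroup Gal(M/F))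
  have hpi : IsPurelyInseparable F H := isPurelyInseparable_fixedField_top F M
  have : IsGalois H M :=
    inferInstanceAs (IsGalois (FixedPoints.subfield (⊤ : Subgroup Gal(M/F)) M) M)
  let _ : Algebra B M := ((algebraMap F M).comp (algebraMap B F)).toAlgebra
  have : IsScalarTower B F M := IsScalarTower.of_algebraMap_eq fun _ => rfl
  have : IsScalarTower B L M := IsScalarTower.of_algebraMap_eq fun x => by
    rw [IsScalarTower.algebraMap_apply B F M, IsScalarTower.algebraMap_apply B F L,
      ← IsScalarTower.algebraMap_apply F L M]
  have : IsScalarTower B F H := inferInstance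
  let C := integralClosure B H
  have hCfin : Module.Finite B C := IsIntegralClosure.finite_of_pow_mem_range F H C p _
    (IsPurelyInseparable.exponent_def' F p) (hB _)
  have : IsFractionRing C H := integralClosure.isFractionRing_of_finite_extension F H
  have : IsIntegrallyClosed C := integralClosure.isIntegrallyClosedOfFiniteExtension F
  have : IsScalarTower B C M := IsScalarTower.of_algebraMap_eq fun _ => rfl
  exact Module.Finite.integralClosure_of_separable_tower B C H M L

/-- Both properties pass from $B$ to $B[[X]]$, so variables are adjoined one at a time. -/
theorem MvPowerSeries.isIntegrallyClosed_and_hasSeparatingRootFunctionals (k : Type u) [Field k]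
    (p : ℕ) [Fact p.Prime] [CharP k p] (d : ℕ) :
    IsIntegrallyClosed (MvPowerSeries (Fin d) k) ∧
      ∀ e, HasSeparatingRootFunctionals (MvPowerSeries (Fin d) k) (p ^ e) := by
  induction d with
  | zero =>
    let e := (MvPowerSeries.isEmptyEquiv (R := k) (Fin 0)).toRingEquiv.symm
    exact ⟨IsIntegrallyClosed.of_equiv e, fun n =>
      (HasSeparatingRootFunctionals.field k p n).of_ringEquiv e⟩
  | succ d ih =>
    let e := (MvPowerSeries.finSuccEquiv k d).toRingEquiv.symm
    have := ih.1
    have : IsDomain (MvPowerSeries (Fin d) k) := NoZeroDivisors.to_isDomain _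
    have : CharP (MvPowerSeries (Fin d) k) p :=
      charP_of_injective_algebraMap (algebraMap k (MvPowerSeries (Fin d) k)).injective p
    exact ⟨IsIntegrallyClosed.of_equiv e, fun n =>
      (HasSeparatingRootFunctionals.powerSeries _ p n (ih.2 n)).of_ringEquiv e⟩

/-- The integral closure of a complete Noetherian local domain of characteristic `p` in a finite
extension of its quotient field is finite. -/
theorem Module.Finite.integralClosure_of_isAdicComplete (A : Type u) [CommRing A] [IsDomain A]
    [IsLocalRing A] [IsNoetherianRing A] [IsAdicComplete (maximalIdeal A) A] (p : ℕ)
    [Fact p.Prime] [CharP A p] (E : Type v) [Field E] [Algebra A E] [IsFractionRing A E]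
    (L : Type w) [Field L] [Algebra A L] [Algebra E L] [IsScalarTower A E L]
    [FiniteDimensional E L] : Module.Finite A (integralClosure A L) := by
  obtain ⟨d, F, hF, hfin⟩ := exists_finite_injective_mvPowerSeries A p
  let P := MvPowerSeries (Fin d) (ResidueField A)
  have : IsDomain P := NoZeroDivisors.to_isDomain _
  let _ : Algebra P A := F.toAlgebra
  have : Module.Finite P A := hfin
  have : CharP P p := (RingHom.charP F hF p)
  have : CharP (ResidueField A) p := by
    refine (RingHom.charP (MvPowerSeries.C (σ := Fin d) (R := ResidueField A)) ?_ p)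
    exact RingHom.injective (MvPowerSeries.C (σ := Fin d) (R := ResidueField A))
  obtain ⟨h1, h2⟩ :=
    MvPowerSeries.isIntegrallyClosed_and_hasSeparatingRootFunctionals (ResidueField A) p d
  let _ : Algebra P E := ((algebraMap A E).comp F).toAlgebra
  let _ : Algebra P L := ((algebraMap A L).comp F).toAlgebra
  have : IsScalarTower P A E := IsScalarTower.of_algebraMap_eq fun _ => rfl
  have : IsScalarTower P A L := IsScalarTower.of_algebraMap_eq fun _ => rfl
  have : IsScalarTower P E L := IsScalarTower.of_algebraMap_eq fun x => by
    exact IsScalarTower.algebraMap_apply A E L (F x)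
  let Q := FractionRing P
  have : FaithfulSMul P A := (faithfulSMul_iff_algebraMap_injective P A).2 hF
  have : FaithfulSMul P E := (faithfulSMul_iff_algebraMap_injective P E).2
    ((IsFractionRing.injective A E).comp hF)
  let _ : Algebra Q E := FractionRing.liftAlgebra P E
  have : IsScalarTower P Q E := FractionRing.isScalarTower_liftAlgebra P E
  let _ : Algebra Q L := ((algebraMap E L).comp (algebraMap Q E)).toAlgebra
  have : IsScalarTower Q E L := IsScalarTower.of_algebraMap_eq fun _ => rfl
  have : IsScalarTower P Q L := IsScalarTower.of_algebraMap_eq fun x => by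
    rw [IsScalarTower.algebraMap_apply Q E L, ← IsScalarTower.algebraMap_apply P Q E,
      ← IsScalarTower.algebraMap_apply P E L]
  have : FiniteDimensional Q E := by
    have : IsLocalization (Algebra.algebraMapSubmonoid A (nonZeroDivisors P)) E := by
      refine (IsLocalization.iff_of_le_of_exists_dvd _ (nonZeroDivisors A) ?_ ?_).2 inferInstance
      · rintro _ ⟨x, hx, rfl⟩
        exact mem_nonZeroDivisors_of_ne_zero ((map_ne_zero_iff _ hF).2 (nonZeroDivisors.ne_zero hx))
      · intro a ha
        obtain ⟨r, hr, h⟩ := (Algebra.IsAlgebraic.isAlgebraic (R := P) a).exists_nonzero_dvd ha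
        exact ⟨_, ⟨r, mem_nonZeroDivisors_of_ne_zero hr, rfl⟩, h⟩
    exact .of_isLocalization P A (nonZeroDivisors P)
  have : FiniteDimensional Q L := Module.Finite.trans E L
  have h3 : Module.Finite P (integralClosure P L) :=
    Module.Finite.integralClosure_of_separatingRootFunctionals P p h2 Q L
  let f : integralClosure A L →ₐ[P] integralClosure P L :=
    ((integralClosure A L).val.restrictScalars P).codRestrict _ fun x => by
      exact isIntegral_trans (R := P) (A := A) _ x.2
  have hf : Function.Injective f := fun x y h =>
    Subtype.ext (congrArg (algebraMap (integralClosure P L) L) h)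
  have : Module.Finite P (integralClosure A L) :=
    Module.Finite.of_injective f.toLinearMap hf
  exact Module.Finite.of_restrictScalars_finite P A _

end JapaneseProperty

/-! ### Finiteness of the integral closure of $R$ in $K'$. -/

section FiniteIntegralClosure

/-- An integral algebra over a complete Noetherian local domain of characteristic `p` is finite
if it embeds into a finite reduced algebra over the quotient field. -/
theorem Module.Finite.of_injective_isReduced (A : Type*) [CommRing A] [IsDomain A]
    [IsLocalRing A] [IsNoetherianRing A] [IsAdicComplete (maximalIdeal A) A] (p : ℕ)
    [Fact p.Prime] [CharP A p] (E : Type*) [Field E] [Algebra A E] [IsFractionRing A E]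
    {V : Type*} [CommRing V] [Algebra A V] [Algebra E V] [IsScalarTower A E V] [Module.Finite E V]
    [IsReduced V] {T : Type*} [CommRing T] [Algebra A T] [Algebra.IsIntegral A T] (φ : T →ₐ[A] V)
    (hφ : Function.Injective φ) : Module.Finite A T := by
  have : IsArtinianRing V := isArtinian_of_tower E inferInstance
  let _ (m : MaximalSpectrum V) : Field (V ⧸ m.asIdeal) := Ideal.Quotient.field _
  have hfin (m : MaximalSpectrum V) : Module.Finite A (integralClosure A (V ⧸ m.asIdeal)) :=
    Module.Finite.integralClosure_of_isAdicComplete A p E (V ⧸ m.asIdeal)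
  let f (m : MaximalSpectrum V) : T →ₐ[A] integralClosure A (V ⧸ m.asIdeal) :=
    ((Ideal.Quotient.mkₐ A m.asIdeal).comp φ).codRestrict _ fun x =>
      (Algebra.IsIntegral.isIntegral (R := A) x).map ((Ideal.Quotient.mkₐ A m.asIdeal).comp φ)
  -- Being Artinian and reduced, $V$ embeds into the product of its residue fields, each finite over
  -- $E$.
  have hf : Function.Injective (LinearMap.pi fun m => (f m).toLinearMap) := by
    rw [← LinearMap.ker_eq_bot, LinearMap.ker_eq_bot']
    intro x hx
    have h1 (m : MaximalSpectrum V) : φ x ∈ m.asIdeal :=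
      Ideal.Quotient.eq_zero_iff_mem.1 (congrArg Subtype.val (congrFun hx m))
    have h2 : φ x ∈ nilradical V := by
      rw [nilradical_eq_sInf]
      refine Submodule.mem_sInf.2 fun (P : Ideal V) hP => ?_
      have : P.IsPrime := hP
      exact h1 ⟨P, inferInstance⟩
    rw [nilradical_eq_zero, Submodule.zero_eq_bot, Ideal.mem_bot] at h2
    exact hφ (by rw [h2, map_zero])
  exact Module.Finite.of_injective _ hf

/-- The base change of a finite extension of the quotient field is finite. -/
theorem Module.Finite.tensorProduct_fractionField (R K K' E : Type*) [CommRing R] [IsDomain R]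
    [Field K] [Algebra R K] [IsFractionRing R K] [Field K'] [Algebra K K'] [FiniteDimensional K K']
    [Algebra R K'] [IsScalarTower R K K'] [Field E] [Algebra R E] [FaithfulSMul R E] :
    Module.Finite E (E ⊗[R] K') := by
  let _ : Algebra K E := (IsFractionRing.lift (FaithfulSMul.algebraMap_injective R E)).toAlgebra
  have : IsScalarTower R K E := IsScalarTower.of_algebraMap_eq fun x =>
    (IsFractionRing.lift_algebraMap (FaithfulSMul.algebraMap_injective R E) x).symm
  have hc : CompatibleSMul R K E K' :=
    IsLocalization.tensorProduct_compatibleSMul (nonZeroDivisors R) K E K'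
  let b := Module.finBasis K K'
  refine ⟨Submodule.fg_iff_exists_fin_generating_family.2 ⟨_, fun i => 1 ⊗ₜ[R] b i, ?_⟩⟩
  rw [eq_top_iff]
  rintro z -
  induction z using TensorProduct.induction_on with
  | zero => exact zero_mem _
  | add x y hx hy => exact add_mem hx hy
  | tmul e x =>
    rw [← b.sum_repr x, TensorProduct.tmul_sum]
    refine Submodule.sum_mem _ fun i _ => ?_
    rw [← hc.smul_tmul]
    have : ((b.repr x) i • e) ⊗ₜ[R] b i = ((b.repr x) i • e) • ((1 : E) ⊗ₜ[R] b i) := by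
      rw [TensorProduct.smul_tmul', smul_eq_mul, mul_one]
    rw [this]
    exact Submodule.smul_mem _ _ (Submodule.subset_span ⟨i, rfl⟩)

/-- Being reduced passes to the extension of one factor of a tensor product to its quotient
field. -/
theorem isReduced_fractionField_tensorProduct (R A E K' : Type*) [CommRing R] [CommRing A]
    [IsDomain A] [Algebra R A] [Field E] [Algebra A E] [IsFractionRing A E] [Algebra R E]
    [IsScalarTower R A E] [CommRing K'] [Algebra R K'] [Module.Flat R K'] [IsReduced (A ⊗[R] K')] :
    IsReduced (E ⊗[R] K') := by
  let ψ : A ⊗[R] K' →ₐ[A] E ⊗[R] K' :=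
    Algebra.TensorProduct.map (Algebra.ofId A E) (AlgHom.id R K')
  have hψ : Function.Injective ψ :=
    Module.Flat.rTensor_preserves_injective_linearMap (M := K')
      (IsScalarTower.toAlgHom R A E).toLinearMap (IsFractionRing.injective A E)
  have hden (z : E ⊗[R] K') : ∃ a : A, a ≠ 0 ∧ ∃ w, ψ w = a • z := by
    induction z using TensorProduct.induction_on with
    | zero => exact ⟨1, one_ne_zero, 0, by simp⟩
    | tmul e x =>
      obtain ⟨b, a, ha, rfl⟩ := IsFractionRing.div_surjective (A := A) e
      refine ⟨a, nonZeroDivisors.ne_zero ha, b ⊗ₜ x, ?_⟩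
      rw [TensorProduct.smul_tmul', Algebra.smul_def, mul_div_cancel₀]
      · rfl
      · exact (map_ne_zero_iff _ (IsFractionRing.injective A E)).2 (nonZeroDivisors.ne_zero ha)
    | add x y hx hy =>
      obtain ⟨a, ha, w, hw⟩ := hx
      obtain ⟨b, hb, v, hv⟩ := hy
      refine ⟨a * b, mul_ne_zero ha hb, b • w + a • v, ?_⟩
      rw [map_add, map_smul, map_smul, hw, hv, smul_add, smul_smul, smul_smul, mul_comm b a]
  refine ⟨fun z hz => ?_⟩
  obtain ⟨n, hn⟩ := hz
  obtain ⟨a, ha, w, hw⟩ := hden z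
  have hw0 : w = 0 := by
    refine IsReduced.eq_zero w ⟨n, hψ ?_⟩
    rw [map_pow, hw, smul_pow, hn, smul_zero, map_zero]
  rw [hw0, map_zero] at hw
  have h1 : (algebraMap A E a) • z = 0 := by rw [algebraMap_smul, ← hw]
  exact (smul_eq_zero.1 h1).resolve_left
    ((map_ne_zero_iff _ (IsFractionRing.injective A E)).2 ha)

instance LocalCompletion.faithfullyFlat (R : Type u) [CommRing R] [IsLocalRing R]
    [IsNoetherianRing R] : Module.FaithfullyFlat R (LocalCompletion R) :=
  Module.FaithfullyFlat.of_flat_of_isLocalHom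

/-- In characteristic zero the extension is separable. In characteristic $p$, geometric regularity
makes $E\otimes_R K'$ reduced, so $\hat R\otimes_R S$ is finite over $\hat R$, and finiteness
descends. -/
theorem HasGeometricallyRegularFormalFibers.finite_integralClosure (R : Type u) [CommRing R]
    [IsDomain R] [IsLocalRing R] [IsNoetherianRing R] [IsIntegrallyClosed R]
    (h : HasGeometricallyRegularFormalFibers R)
    (K : Type v) [Field K] [Algebra R K] [IsFractionRing R K]
    (K' : Type w) [Field K'] [Algebra K K'] [FiniteDimensional K K']
    [Algebra R K'] [IsScalarTower R K K'] : Module.Finite R (integralClosure R K') := by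
  rcases CharP.exists' K with h0 | ⟨p, hp, hpK⟩
  · exact IsIntegralClosure.finite R K K' (integralClosure R K')
  · have : IsDomain (LocalCompletion R) := h.isDomain_localCompletion
    have hinj : Function.Injective (algebraMap R (LocalCompletion R)) :=
      FaithfulSMul.algebraMap_injective R _
    have : CharP R p := (RingHom.charP (algebraMap R K) (IsFractionRing.injective R K) p)
    have : CharP (LocalCompletion R) p := charP_of_injective_algebraMap hinj p
    let E := FractionRing (LocalCompletion R)
    have : FaithfulSMul R E := FaithfulSMul.trans R (LocalCompletion R) E
    have hreg := h.isRegularRing_fractionField_tensorProduct K K'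
    have hred : IsReduced (K' ⊗[R] LocalCompletion R) := IsRegularRing.isReduced
    have : IsReduced (LocalCompletion R ⊗[R] K') :=
      isReduced_of_injective (Algebra.TensorProduct.comm R (LocalCompletion R) K')
        (Algebra.TensorProduct.comm R (LocalCompletion R) K').injective
    have : Module.Flat R K := IsLocalization.flat K (nonZeroDivisors R)
    have : Module.Flat R K' := Module.Flat.trans R K K'
    have : IsReduced (E ⊗[R] K') := isReduced_fractionField_tensorProduct R (LocalCompletion R) E K'
    have : Module.Finite E (E ⊗[R] K') := Module.Finite.tensorProduct_fractionField R K K' E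
    let φ : LocalCompletion R ⊗[R] integralClosure R K' →ₐ[LocalCompletion R] E ⊗[R] K' :=
      (Algebra.TensorProduct.map (Algebra.ofId (LocalCompletion R) E) (AlgHom.id R K')).comp
        (Algebra.TensorProduct.map (AlgHom.id (LocalCompletion R) (LocalCompletion R))
          (integralClosure R K').val)
    have hφ : Function.Injective φ :=
      (Module.Flat.rTensor_preserves_injective_linearMap (M := K')
        (IsScalarTower.toAlgHom R (LocalCompletion R) E).toLinearMap
        (IsFractionRing.injective (LocalCompletion R) E)).comp
      (Module.Flat.lTensor_preserves_injective_linearMap (M := LocalCompletion R)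
        (integralClosure R K').val.toLinearMap Subtype.val_injective)
    have : Module.Finite (LocalCompletion R) (LocalCompletion R ⊗[R] integralClosure R K') :=
      Module.Finite.of_injective_isReduced (LocalCompletion R) p E φ hφ
    exact Module.Finite.of_finite_tensorProduct_of_faithfullyFlat (LocalCompletion R)

end FiniteIntegralClosure

/-! ### Localization of a finite algebra at a maximal ideal. -/

section LocalizationOfIntegralClosure

theorem LocalCompletion.exists_sub_algebraMap_mem (R : Type u) [CommRing R] [IsLocalRing R]
    [IsNoetherianRing R] (c : ℕ) (x : LocalCompletion R) :
    ∃ r : R, x - algebraMap R (LocalCompletion R) r ∈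
      (maximalIdeal R ^ c).map (algebraMap R (LocalCompletion R)) := by
  obtain ⟨r, hr⟩ := Ideal.Quotient.mk_surjective (AdicCompletion.eval (maximalIdeal R) R c x)
  refine ⟨r, ?_⟩
  have h1 : x - algebraMap R (LocalCompletion R) r ∈
      LinearMap.ker (AdicCompletion.eval (maximalIdeal R) R c) := by
    rw [LinearMap.mem_ker, map_sub, ← hr, sub_eq_zero]
    rfl
  rw [← AdicCompletion.pow_smul_top_eq_ker_eval (maximalIdeal R).fg_of_isNoetherianRing] at h1
  have h2 := Ideal.smul_top_eq_map (S := LocalCompletion R) (maximalIdeal R ^ c)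
  have h3 := h2.le h1
  exact h3

theorem LiesOver.exists_isLocalization {R : Type u} {K' : Type v} {R' : Type w} [CommRing R]
    [Field K'] [CommRing R'] [Algebra R K'] [Algebra R' K'] [IsDomain R'] [IsFractionRing R' K']
    [Algebra R R'] [IsScalarTower R R' K'] (h : LiesOver R K' R') :
    ∃ (n : Ideal (integralClosure R K')) (_ : n.IsMaximal) (f : integralClosure R K' →ₐ[R] R'),
      letI := f.toAlgebra
      IsScalarTower (integralClosure R K') R' K' ∧ IsLocalization.AtPrime R' n := by
  obtain ⟨n, hn, H⟩ := h
  have hinj : Function.Injective (algebraMap R' K') := IsFractionRing.injective R' K'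
  have h1 : (1 : integralClosure R K') ∉ n := (Ideal.ne_top_iff_one n).1 hn.ne_top
  have hex (a : integralClosure R K') : ∃ y : R', algebraMap R' K' y = a :=
    (H a).2 ⟨a, 1, h1, by simp⟩
  choose g hg using hex
  let f : integralClosure R K' →ₐ[R] R' :=
    { toFun := g
      map_one' := hinj (by rw [hg, map_one]; rfl)
      map_zero' := hinj (by rw [hg, map_zero]; rfl)
      map_mul' a b := hinj (by rw [map_mul, hg, hg, hg]; rfl)
      map_add' a b := hinj (by rw [map_add, hg, hg, hg]; rfl)
      commutes' r := hinj (by rw [hg, ← IsScalarTower.algebraMap_apply R R' K']; rfl) }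
  refine ⟨n, hn, f, ?_⟩
  let := f.toAlgebra
  have hf (a : integralClosure R K') : algebraMap R' K' (algebraMap _ R' a) = a := hg a
  refine ⟨IsScalarTower.of_algebraMap_eq fun a => (hg a).symm, ⟨?_, ?_, ?_⟩⟩
  · rintro ⟨b, hb⟩
    have hb0 : (b : K') ≠ 0 := fun h0 => hb (by
      rw [show b = 0 from Subtype.ext h0]; exact n.zero_mem)
    obtain ⟨y, hy⟩ := (H (1 / (b : K'))).2 ⟨1, b, hb, by simp⟩
    refine IsUnit.of_mul_eq_one y (hinj ?_)
    rw [map_mul, hf, hy, map_one, mul_one_div_cancel hb0]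
  · intro z
    obtain ⟨a, b, hb, hab⟩ := (H (algebraMap R' K' z)).1 ⟨z, rfl⟩
    have hb0 : (b : K') ≠ 0 := fun h0 => hb (by
      rw [show b = 0 from Subtype.ext h0]; exact n.zero_mem)
    refine ⟨⟨a, ⟨b, hb⟩⟩, hinj ?_⟩
    rw [map_mul, hf, hf, hab, div_mul_cancel₀ _ hb0]
  · intro a b hab
    exact ⟨1, by
      have := congrArg (algebraMap R' K') hab
      rw [hf, hf] at this
      rw [Subtype.ext this]⟩

variable {R : Type u} {S : Type v} {R' : Type w} [CommRing R] [IsLocalRing R]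
  [CommRing S] [Algebra R S] [CommRing R'] [IsLocalRing R'] [Algebra R R']
  [Algebra S R'] [IsScalarTower R S R'] (n : Ideal S) [n.IsMaximal] [IsLocalization.AtPrime R' n]

include n

theorem map_eq_maximalIdeal_of_isLocalization_atPrime :
    n.map (algebraMap S R') = maximalIdeal R' :=
  IsLocalization.AtPrime.map_eq_maximalIdeal n R'

theorem mem_pow_of_algebraMap_mem {c : ℕ} {s : S}
    (hs : algebraMap S R' s ∈ maximalIdeal R' ^ c) : s ∈ n ^ c := by
  rw [← Ideal.Quotient.eq_zero_iff_mem] at hs ⊢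
  rw [← IsLocalization.AtPrime.equivQuotMaximalIdealPow_apply_mk n R' c s] at hs
  exact (map_eq_zero_iff _ (AlgEquiv.injective _)).1 hs

theorem exists_sub_algebraMap_mem_pow (c : ℕ) (x : R') :
    ∃ s : S, x - algebraMap S R' s ∈ maximalIdeal R' ^ c := by
  obtain ⟨y, hy⟩ := (IsLocalization.AtPrime.equivQuotMaximalIdealPow n R' c).surjective
    (Ideal.Quotient.mk _ x)
  obtain ⟨s, rfl⟩ := Ideal.Quotient.mk_surjective y
  refine ⟨s, ?_⟩
  rw [IsLocalization.AtPrime.equivQuotMaximalIdealPow_apply_mk] at hy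
  exact (Ideal.Quotient.eq).1 hy.symm

/-- A prime of $R'$ containing $m_R$ contracts to a maximal ideal of $S$ by integrality. This ideal
lies in $n$, so it equals $n$. -/
theorem exists_maximalIdeal_pow_le_map [IsNoetherianRing S] [Module.Finite R S] :
    ∃ c, maximalIdeal R' ^ c ≤ (maximalIdeal R).map (algebraMap R R') := by
  have : IsNoetherianRing R' := IsLocalization.isNoetherianRing n.primeCompl R' inferInstance
  refine Ideal.exists_pow_le_of_le_radical_of_fg ?_ (IsNoetherian.noetherian (maximalIdeal R'))
  rw [Ideal.radical_eq_sInf]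
  refine le_sInf fun J ⟨hJ, hJp⟩ => ?_
  have h1 : (J.comap (algebraMap S R')).comap (algebraMap R S) = maximalIdeal R := by
    refine ((maximalIdeal.isMaximal R).eq_of_le (Ideal.IsPrime.ne_top inferInstance) ?_).symm
    rw [Ideal.comap_comap, ← IsScalarTower.algebraMap_eq, ← Ideal.map_le_iff_le_comap]
    exact hJ
  have h2 : (J.comap (algebraMap S R')).IsMaximal :=
    Ideal.isMaximal_of_isIntegral_of_isMaximal_comap (R := R) _ (h1 ▸ maximalIdeal.isMaximal R)
  have h3 : J.comap (algebraMap S R') ≤ n := by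
    rw [← IsLocalization.AtPrime.under_maximalIdeal R' n]
    exact Ideal.comap_mono (le_maximalIdeal hJp.ne_top)
  rw [← map_eq_maximalIdeal_of_isLocalization_atPrime (R' := R') n, Ideal.map_le_iff_le_comap,
    h2.eq_of_le (Ideal.IsPrime.ne_top inferInstance) h3]

end LocalizationOfIntegralClosure

/-! ### Comparison of $\hat R\otimes_R S$ with $\hat R'$. -/

section CompletionOfLocalization

variable {R : Type u} {S : Type v} {R' : Type w} [CommRing R] [IsLocalRing R] [IsNoetherianRing R]
  [CommRing S] [Algebra R S] [Module.Finite R S] [CommRing R'] [IsLocalRing R']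
  [IsNoetherianRing R'] [Algebra R R']
  [Algebra S R'] [IsScalarTower R S R'] (n : Ideal S) [n.IsMaximal] [IsLocalization.AtPrime R' n]
  [Algebra (LocalCompletion R) (LocalCompletion R')]
  [IsScalarTower R (LocalCompletion R) (LocalCompletion R')]

omit [IsNoetherianRing R'] in
theorem map_maximalIdeal_localCompletion :
    (maximalIdeal (LocalCompletion R)).map
        (algebraMap (LocalCompletion R) (LocalCompletion R')) =
      (((maximalIdeal R).map (algebraMap R R')).map (algebraMap R' (LocalCompletion R'))) := by
  rw [AdicCompletion.maximalIdeal_eq_map, Ideal.map_map, Ideal.map_map,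
    ← IsScalarTower.algebraMap_eq, ← IsScalarTower.algebraMap_eq]

theorem map_maximalIdeal_localCompletion_ne_top (h : IsLocalHom (algebraMap R R')) :
    (maximalIdeal (LocalCompletion R)).map
        (algebraMap (LocalCompletion R) (LocalCompletion R')) ≠ ⊤ := by
  rw [map_maximalIdeal_localCompletion]
  refine ne_top_of_le_ne_top (Ideal.IsPrime.ne_top (inferInstance :
    (maximalIdeal (LocalCompletion R')).IsPrime)) ?_
  rw [AdicCompletion.maximalIdeal_eq_map (R := R')]
  exact Ideal.map_mono (((local_hom_TFAE (algebraMap R R')).out 0 2 rfl rfl).mp h)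

include n

theorem exists_sub_algebraMap_mem_map (x : LocalCompletion R') :
    ∃ s : S, x - algebraMap S (LocalCompletion R') s ∈
      (maximalIdeal (LocalCompletion R)).map
        (algebraMap (LocalCompletion R) (LocalCompletion R')) := by
  have : IsNoetherianRing S := isNoetherian_of_tower R inferInstance
  obtain ⟨c, hc⟩ := exists_maximalIdeal_pow_le_map (R := R) (R' := R') n
  obtain ⟨y, hy⟩ := LocalCompletion.exists_sub_algebraMap_mem R' c x
  obtain ⟨s, hs⟩ := exists_sub_algebraMap_mem_pow (R' := R') n c y
  refine ⟨s, ?_⟩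
  rw [map_maximalIdeal_localCompletion]
  have h1 := Ideal.map_mono (f := algebraMap R' (LocalCompletion R')) hc hy
  have h2 := Ideal.mem_map_of_mem (algebraMap R' (LocalCompletion R')) (hc hs)
  have h3 := Ideal.add_mem _ h1 h2
  rw [map_sub, ← IsScalarTower.algebraMap_apply, sub_add_sub_cancel] at h3
  exact h3

theorem Module.Finite.localCompletion (h : IsLocalHom (algebraMap R R')) :
    Module.Finite (LocalCompletion R) (LocalCompletion R') := by
  obtain ⟨t, ht⟩ := Module.Finite.fg_top (R := R) (M := S)
  let I := maximalIdeal (LocalCompletion R)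
  have : IsHausdorff I (LocalCompletion R') := by
    rw [← IsHausdorff.map_algebraMap_iff (S := LocalCompletion R')]
    exact IsHausdorff.of_isLocalRing _ _ (map_maximalIdeal_localCompletion_ne_top h)
  let f : S →ₐ[R] LocalCompletion R' := IsScalarTower.toAlgHom R S (LocalCompletion R')
  refine Module.Finite.of_isPrecomplete I
    (Submodule.span (LocalCompletion R) (f '' t)) (Submodule.fg_span (t.finite_toSet.image f)) ?_
  rw [eq_top_iff]
  rintro x -
  obtain ⟨s, hs⟩ := exists_sub_algebraMap_mem_map (R := R) n x
  rw [← add_sub_cancel (f s) x]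
  refine Submodule.add_mem_sup ?_ ?_
  · have h1 : s ∈ Submodule.span R (t : Set S) := ht ▸ Submodule.mem_top
    have h2 := Submodule.mem_map_of_mem (f := f.toLinearMap) h1
    rw [Submodule.map_span] at h2
    exact Submodule.span_le_restrictScalars R (LocalCompletion R) _ h2
  · rw [Ideal.smul_top_eq_map]
    exact hs

/-- The comparison map from the base change of `S` to the completion of its localization. -/
noncomputable def completionComparison (R : Type u) (S : Type v) (R' : Type w)
    [CommRing R] [IsLocalRing R] [CommRing S] [Algebra R S] [CommRing R'] [IsLocalRing R']
    [Algebra R R'] [Algebra S R'] [IsScalarTower R S R']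
    [Algebra (LocalCompletion R) (LocalCompletion R')]
    [IsScalarTower R (LocalCompletion R) (LocalCompletion R')] :
    LocalCompletion R ⊗[R] S →ₐ[LocalCompletion R] LocalCompletion R' :=
  Algebra.TensorProduct.lift (Algebra.ofId (LocalCompletion R) (LocalCompletion R'))
    (IsScalarTower.toAlgHom R S (LocalCompletion R')) fun _ _ => Commute.all _ _

omit n in
omit [IsNoetherianRing R] [Module.Finite R S] [IsNoetherianRing R'] in
theorem completionComparison_tmul (a : LocalCompletion R) (s : S) :
    completionComparison R S R' (a ⊗ₜ s) = algebraMap _ _ a * algebraMap S _ s :=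
  Algebra.TensorProduct.lift_tmul ..

theorem completionComparison_surjective (h : IsLocalHom (algebraMap R R')) :
    Function.Surjective (completionComparison R S R') := by
  have := Module.Finite.localCompletion (R := R) (R' := R') n h
  have h1 : LinearMap.range (completionComparison R S R').toLinearMap = ⊤ := by
    rw [eq_top_iff]
    refine Submodule.le_of_le_smul_of_le_jacobson_bot (I := maximalIdeal (LocalCompletion R))
      Module.Finite.fg_top (maximalIdeal_le_jacobson _) ?_
    rintro x -
    obtain ⟨s, hs⟩ := exists_sub_algebraMap_mem_map (R := R) n x
    rw [← add_sub_cancel (algebraMap S _ s) x]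
    refine Submodule.add_mem_sup ⟨1 ⊗ₜ s, ?_⟩ ?_
    · rw [AlgHom.toLinearMap_apply, completionComparison_tmul, map_one, one_mul]
    · rw [Ideal.smul_top_eq_map]
      exact hs
  exact LinearMap.range_eq_top.1 h1

/-- The kernel of the comparison map consists of the elements killed by localization. -/
theorem exists_mul_eq_zero_of_completionComparison_eq_zero (h : IsLocalHom (algebraMap R R'))
    {z : LocalCompletion R ⊗[R] S} (hz : completionComparison R S R' z = 0) :
    ∃ t, IsUnit (completionComparison R S R' t) ∧ t * z = 0 := by
  let Φ := completionComparison R S R'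
  let M : Ideal (LocalCompletion R ⊗[R] S) := (maximalIdeal (LocalCompletion R')).comap Φ
  have : IsNoetherianRing (LocalCompletion R ⊗[R] S) :=
    isNoetherian_of_tower (LocalCompletion R) inferInstance
  have hmM : (maximalIdeal (LocalCompletion R)).map (algebraMap _ _) ≤ M := by
    rw [Ideal.map_le_iff_le_comap]
    intro a ha
    change Φ (algebraMap _ _ a) ∈ maximalIdeal _
    rw [AlgHom.commutes]
    exact le_maximalIdeal (map_maximalIdeal_localCompletion_ne_top h) (Ideal.mem_map_of_mem _ ha)
  have hΦs (s : S) : Φ (1 ⊗ₜ s) = algebraMap R' (LocalCompletion R') (algebraMap S R' s) := by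
    rw [completionComparison_tmul, map_one, one_mul, IsScalarTower.algebraMap_apply S R']
  have hnM : n.map (Algebra.TensorProduct.includeRight : S →ₐ[R] LocalCompletion R ⊗[R] S) ≤ M := by
    rw [Ideal.map_le_iff_le_comap]
    intro s hs
    change Φ (1 ⊗ₜ s) ∈ maximalIdeal _
    have h1 := Ideal.mem_map_of_mem (algebraMap S R') hs
    rw [map_eq_maximalIdeal_of_isLocalization_atPrime] at h1
    rw [hΦs, AdicCompletion.maximalIdeal_eq_map]
    exact Ideal.mem_map_of_mem _ h1
  -- Modulo $M^c$ every element comes from $S$, since $\hat R$ is approximated by $R$.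
  have hdec (c : ℕ) (y : LocalCompletion R ⊗[R] S) : ∃ s : S, y - 1 ⊗ₜ s ∈ M ^ c := by
    induction y using TensorProduct.induction_on with
    | zero => exact ⟨0, by simp⟩
    | add x y hx hy =>
      obtain ⟨s, hs⟩ := hx
      obtain ⟨t, ht⟩ := hy
      exact ⟨s + t, by rw [TensorProduct.tmul_add, add_sub_add_comm]; exact add_mem hs ht⟩
    | tmul a s =>
      obtain ⟨r, hr⟩ := LocalCompletion.exists_sub_algebraMap_mem R c a
      refine ⟨r • s, ?_⟩
      have h1 : a ⊗ₜ[R] s - 1 ⊗ₜ[R] (r • s) =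
          algebraMap _ (LocalCompletion R ⊗[R] S) (a - algebraMap R _ r) * 1 ⊗ₜ s := by
        rw [← TensorProduct.smul_tmul, ← TensorProduct.sub_tmul, Algebra.smul_def, mul_one,
          Algebra.TensorProduct.algebraMap_apply, Algebra.TensorProduct.tmul_mul_tmul, mul_one,
          one_mul]
        rfl
      rw [h1]
      refine Ideal.mul_mem_right _ _ ?_
      rw [Ideal.map_pow, ← AdicCompletion.maximalIdeal_eq_map] at hr
      have h2 := Ideal.mem_map_of_mem (algebraMap _ (LocalCompletion R ⊗[R] S)) hr
      rw [Ideal.map_pow] at h2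
      exact Ideal.pow_right_mono hmM c h2
  -- If $z$ is approximated by $s$ modulo $M^c$ and $\Phi(z)=0$, then $s$ maps into the $c$-th power
  -- of the maximal ideal of $\hat R'$. Faithful flatness and $S/n^c\cong R'/m_{R'}^c$ give $s\in
  -- n^c$, so $z\in M^c$.
  have hzM (c : ℕ) : z ∈ M ^ c := by
    obtain ⟨s, hs⟩ := hdec c z
    rw [← sub_add_cancel z (1 ⊗ₜ s)]
    refine add_mem hs ?_
    have h1 : Φ (z - 1 ⊗ₜ s) ∈ maximalIdeal (LocalCompletion R') ^ c := by
      have h2 : (M ^ c).map Φ ≤ maximalIdeal (LocalCompletion R') ^ c := by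
        rw [Ideal.map_pow]
        exact Ideal.pow_right_mono Ideal.map_comap_le c
      exact h2 (Ideal.mem_map_of_mem _ hs)
    have h0 : Φ z = 0 := hz
    rw [map_sub, h0, zero_sub, neg_mem_iff, hΦs, AdicCompletion.maximalIdeal_eq_map,
      ← Ideal.map_pow, ← Ideal.mem_comap, Ideal.comap_map_eq_self_of_faithfullyFlat] at h1
    have h3 := mem_pow_of_algebraMap_mem n h1
    have h4 := Ideal.mem_map_of_mem
      (Algebra.TensorProduct.includeRight : S →ₐ[R] LocalCompletion R ⊗[R] S) h3
    rw [Ideal.map_pow] at h4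
    exact Ideal.pow_right_mono hnM c h4
  -- Krull's intersection theorem gives $z=rz$ with $r\in M$, and $1-r$ becomes a unit in the local
  -- ring $\hat R'$.
  obtain ⟨r, hr⟩ := (Ideal.mem_iInf_smul_pow_eq_bot_iff M z).1 (by
    rw [Submodule.mem_iInf]
    intro c
    simpa using hzM c)
  refine ⟨1 - r, ?_, by rw [sub_mul, one_mul]; exact sub_eq_zero.2 hr.symm⟩
  rw [map_sub, map_one]
  have h6 : Φ r ∈ maximalIdeal (LocalCompletion R') := r.2
  exact (IsLocalRing.isUnit_or_isUnit_one_sub_self (Φ r)).resolve_left h6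

end CompletionOfLocalization

/-! ### The completion of $R'$ is a domain containing $\hat R$. -/

section CompletionDomain

variable {R : Type u} {S : Type*} {R' : Type*} [CommRing R] [IsDomain R] [IsLocalRing R]
  [IsNoetherianRing R] [CommRing S] [IsDomain S] [IsIntegrallyClosed S] [Algebra R S]
  [Module.Finite R S] [CommRing R'] [IsLocalRing R'] [IsNoetherianRing R'] [Algebra R R']
  [Algebra S R'] [IsScalarTower R S R'] (n : Ideal S) [n.IsMaximal] [IsLocalization.AtPrime R' n]
  [Algebra (LocalCompletion R) (LocalCompletion R')]
  [IsScalarTower R (LocalCompletion R) (LocalCompletion R')]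
  (hloc : IsLocalHom (algebraMap R R'))
  (K : Type v) [Field K] [Algebra R K] [IsFractionRing R K]
  (K' : Type w) [Field K'] [Algebra K K'] [FiniteDimensional K K']
  [Algebra R K'] [IsScalarTower R K K'] [Algebra S K'] [IsFractionRing S K'] [IsScalarTower R S K']

include hloc K K' n

/-- A vanishing product in $\hat R'$ lifts to $\hat R\otimes_R S$ and vanishes there after
multiplication by some $t$ that maps to a unit. The separating idempotent becomes trivial in the
local ring $\hat R'$, which kills one factor. -/
theorem HasGeometricallyRegularFormalFibers.isDomain_localCompletion_localization
    (h : HasGeometricallyRegularFormalFibers R) : IsDomain (LocalCompletion R') := by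
  have : NoZeroDivisors (LocalCompletion R') := ⟨by
    intro a b hab
    obtain ⟨x, rfl⟩ := completionComparison_surjective (R := R) n hloc a
    obtain ⟨y, rfl⟩ := completionComparison_surjective (R := R) n hloc b
    rw [← map_mul] at hab
    obtain ⟨t, ht, htxy⟩ := exists_mul_eq_zero_of_completionComparison_eq_zero n hloc hab
    rw [← mul_assoc] at htxy
    let e := Algebra.TensorProduct.comm R (LocalCompletion R) S
    obtain ⟨i, hi, hix, hiy⟩ := h.exists_idempotent_of_mul_eq_zero_tensorProduct K K' S
      (x := e (t * x)) (y := e y) (by rw [← map_mul, htxy, map_zero])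
    let Ψ := (completionComparison R S R').toRingHom.comp e.symm.toRingEquiv.toRingHom
    have hΨ (z) : Ψ (e z) = completionComparison R S R' z := by simp [Ψ]
    have h1 := congrArg Ψ hix
    have h2 := congrArg Ψ hiy
    rw [map_mul, hΨ, map_zero, map_mul] at h1
    rw [map_mul, hΨ] at h2
    rcases IsLocalRing.isUnit_or_isUnit_one_sub_self (Ψ i) with hu | hu
    · exact Or.inl (ht.mul_right_eq_zero.1 (hu.mul_right_eq_zero.1 h1))
    · refine Or.inr (hu.mul_right_eq_zero.1 ?_)
      rw [sub_mul, one_mul, h2, sub_self]⟩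
  exact NoZeroDivisors.to_isDomain _

-- By flatness $\hat R\otimes_R S$ embeds into $\hat R\otimes_R K'$, which is torsion-free over
-- $\hat R$. A nonzero $a$ in the kernel would be killed by some $t\ne0$.
omit [IsDomain R] [IsDomain S] [IsIntegrallyClosed S] in
theorem LocalCompletion.algebraMap_injective_of_isLocalization
    [IsDomain (LocalCompletion R)] :
    Function.Injective (algebraMap (LocalCompletion R) (LocalCompletion R')) := by
  rw [injective_iff_map_eq_zero]
  intro a ha
  have h1 : completionComparison R S R' (algebraMap _ _ a) = 0 := by
    rw [AlgHom.commutes, ha]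
  obtain ⟨t, ht, hta⟩ := exists_mul_eq_zero_of_completionComparison_eq_zero n hloc h1
  by_contra ha0
  have : Module.Flat R K := IsLocalization.flat K (nonZeroDivisors R)
  have : Module.Flat R K' := Module.Flat.trans R K K'
  have hinj := Module.Flat.lTensor_preserves_injective_linearMap (M := LocalCompletion R)
    (IsScalarTower.toAlgHom R S K').toLinearMap (IsFractionRing.injective S K')
  let ψ : LocalCompletion R ⊗[R] S →ₐ[LocalCompletion R] LocalCompletion R ⊗[R] K' :=
    Algebra.TensorProduct.map (AlgHom.id _ _) (IsScalarTower.toAlgHom R S K')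
  have h2 : a • ψ t = 0 := by
    have := congrArg ψ hta
    rw [map_mul, AlgHom.commutes, map_zero, mul_comm] at this
    rw [← this]
    exact Algebra.smul_def a (ψ t)
  have h3 : IsSMulRegular (LocalCompletion R ⊗[R] K') a :=
    Module.Flat.isSMulRegular_of_nonZeroDivisors (mem_nonZeroDivisors_of_ne_zero ha0)
  have h4 : ψ t = 0 := h3 (h2.trans (smul_zero a).symm)
  have h5 : t = 0 := hinj (by rw [map_zero]; exact h4)
  rw [h5, map_zero] at ht
  exact not_isUnit_zero ht

end CompletionDomain

/-! ### Degree and different of a finite extension of domains. -/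

section FractionFieldOfFinite

/-- Every nonzero element of $C$ is algebraic over $A$, so it divides a nonzero element of $A$. -/
theorem isLocalization_algebraMapSubmonoid_of_finite (A : Type*) {C : Type*} (E' : Type*)
    [CommRing A] [IsDomain A] [CommRing C] [IsDomain C] [Algebra A C] [Module.Finite A C]
    [FaithfulSMul A C] [Field E'] [Algebra C E'] [IsFractionRing C E'] :
    IsLocalization (Algebra.algebraMapSubmonoid C (nonZeroDivisors A)) E' := by
  refine (IsLocalization.iff_of_le_of_exists_dvd _ (nonZeroDivisors C) ?_ ?_).2 inferInstance
  · rintro _ ⟨x, hx, rfl⟩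
    exact mem_nonZeroDivisors_of_ne_zero
      ((map_ne_zero_iff _ (FaithfulSMul.algebraMap_injective A C)).2 (nonZeroDivisors.ne_zero hx))
  · intro a ha
    obtain ⟨r, hr, h⟩ := (Algebra.IsAlgebraic.isAlgebraic (R := A) a).exists_nonzero_dvd ha
    exact ⟨_, ⟨r, mem_nonZeroDivisors_of_ne_zero hr, rfl⟩, h⟩

variable (A C E E' : Type*) [CommRing A] [IsDomain A] [CommRing C] [IsDomain C]
  [Algebra A C] [Module.Finite A C] [FaithfulSMul A C] [Field E] [Algebra A E] [IsFractionRing A E]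
  [Field E'] [Algebra C E'] [IsFractionRing C E'] [Algebra E E'] [Algebra A E']
  [IsScalarTower A E E'] [IsScalarTower A C E']

include A C in
theorem Module.Finite.of_isFractionRing_of_finite : Module.Finite E E' := by
  have := isLocalization_algebraMapSubmonoid_of_finite A (C := C) E'
  exact .of_isLocalization A C (nonZeroDivisors A)

variable {C} in
theorem finrank_le_card_of_span_eq_top {ι : Type*} [Fintype ι] (b : ι → C)
    (hb : Submodule.span A (Set.range b) = ⊤) : Module.finrank E E' ≤ Fintype.card ι := by
  have := isLocalization_algebraMapSubmonoid_of_finite A (C := C) E'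
  have h := span_eq_top_localization_localization E (nonZeroDivisors A) E' hb
  rw [← Set.range_comp] at h
  exact finrank_le_of_span_eq_top h

variable {C} in
theorem natDegree_minpoly_le_finrank [IsIntegrallyClosed A] (θ : C) :
    (minpoly A θ).natDegree ≤ Module.finrank E E' := by
  have hfin : Module.Finite E E' := .of_isFractionRing_of_finite A C E E'
  have hint : IsIntegral A θ := Algebra.IsIntegral.isIntegral θ
  rw [← (minpoly.monic hint).natDegree_map (algebraMap A E),
    ← minpoly.isIntegrallyClosed_eq_field_fractions E E' hint]
  exact minpoly.natDegree_le _

variable {C} in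
/-- The derivative of the minimal polynomial of a generator multiplies any integral extension into
the subring generated by this element. -/
theorem aeval_derivative_minpoly_mul_mem_adjoin [IsIntegrallyClosed A] (θ c : C)
    (hθ : (minpoly A θ).natDegree = Module.finrank E E')
    (h0 : Polynomial.aeval θ (minpoly A θ).derivative ≠ 0) :
    Polynomial.aeval θ (minpoly A θ).derivative * c ∈ Algebra.adjoin A {θ} := by
  have hfin : Module.Finite E E' := .of_isFractionRing_of_finite A C E E'
  have hint : IsIntegral A θ := Algebra.IsIntegral.isIntegral θ
  have hinj := IsFractionRing.injective C E'
  have hintE : IsIntegral A (algebraMap C E' θ) := hint.algebraMap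
  have hmin : minpoly E (algebraMap C E' θ) = (minpoly A θ).map (algebraMap A E) :=
    minpoly.isIntegrallyClosed_eq_field_fractions E E' hint
  have hd : (minpoly E (algebraMap C E' θ)).natDegree = Module.finrank E E' := by
    rw [hmin, (minpoly.monic hint).natDegree_map, hθ]
  have hder : Polynomial.aeval (algebraMap C E' θ) (minpoly E (algebraMap C E' θ)).derivative =
      algebraMap C E' (Polynomial.aeval θ (minpoly A θ).derivative) := by
    rw [hmin, Polynomial.derivative_map, Polynomial.aeval_map_algebraMap,
      Polynomial.aeval_algebraMap_apply]
  have hsep : IsSeparable E (algebraMap C E' θ) := by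
    rw [IsSeparable, Polynomial.separable_iff_derivative_ne_zero
      (minpoly.irreducible (Algebra.IsIntegral.isIntegral _))]
    intro h
    rw [h, map_zero] at hder
    exact h0 (hinj (by rw [← hder, map_zero]))
  have htop : IntermediateField.adjoin E {algebraMap C E' θ} = ⊤ :=
    (Field.primitive_element_iff_minpoly_natDegree_eq E _).2 hd
  have htop' : Algebra.adjoin E {algebraMap C E' θ} = ⊤ := by
    rw [← IntermediateField.adjoin_simple_toSubalgebra_of_isAlgebraic
      (Algebra.IsAlgebraic.isAlgebraic _), htop, IntermediateField.top_toSubalgebra]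
  have : Algebra.IsSeparable E E' := by
    have h1 := IntermediateField.isSeparable_adjoin_simple_iff_isSeparable E E' |>.2 hsep
    rw [htop] at h1
    exact Algebra.IsSeparable.of_algHom E _ IntermediateField.topEquiv.symm.toAlgHom
  -- By Euler's formula the trace dual of $A[\theta]$ is $f'(\theta)^{-1}A[\theta]$. It contains
  -- $C$, because traces of integral elements lie in the normal ring $A$.
  have hdual := traceForm_dualSubmodule_adjoin A E htop' hintE
  have hc : algebraMap C E' c ∈ (Algebra.traceForm E E').dualSubmodule
      (Subalgebra.toSubmodule (Algebra.adjoin A {algebraMap C E' θ})) := by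
    intro y hy
    have hy' : IsIntegral A y := by
      exact (adjoin_le_integralClosure hintE) hy
    rw [Algebra.traceForm_apply, Submodule.mem_one]
    have hc' : IsIntegral A (algebraMap C E' c) :=
      (Algebra.IsIntegral.isIntegral (R := A) c).algebraMap
    exact IsIntegrallyClosed.isIntegral_iff.1 (Algebra.isIntegral_trace (hc'.mul hy'))
  rw [hdual, hder] at hc
  obtain ⟨y, hy, hyc⟩ := hc
  have hne : algebraMap C E' (Polynomial.aeval θ (minpoly A θ).derivative) ≠ 0 :=
    (map_ne_zero_iff _ hinj).2 h0
  have hy2 : y = algebraMap C E' (Polynomial.aeval θ (minpoly A θ).derivative * c) := by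
    rw [map_mul, ← hyc]
    simp [hne]
  rw [hy2] at hy
  change _ ∈ Algebra.adjoin A {algebraMap C E' θ} at hy
  rw [← IsScalarTower.coe_toAlgHom' A C E', ← AlgHom.map_adjoin_singleton] at hy
  obtain ⟨z, hz, hzc⟩ := hy
  rwa [← hinj hzc]

end FractionFieldOfFinite

/-! ### Degree against residue degree for finite local extensions. -/

section LocalExtensionDegree

theorem algebraMap_eq_zero_iff_mem_maximalIdeal {A k : Type*} [CommRing A] [IsLocalRing A]
    [Field k] [Algebra A k] (hk : Function.Surjective (algebraMap A k)) (a : A) :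
    algebraMap A k a = 0 ↔ a ∈ maximalIdeal A := by
  rw [← eq_maximalIdeal (RingHom.ker_isMaximal_of_surjective _ hk), RingHom.mem_ker]

theorem exists_isSeparable_natDegree_minpoly_eq_finSepDegree (k k' : Type*) [Field k] [Field k']
    [Algebra k k'] [FiniteDimensional k k'] :
    ∃ x : k', IsSeparable k x ∧ (minpoly k x).natDegree = Field.finSepDegree k k' := by
  obtain ⟨x, hx⟩ := Field.exists_primitive_element k (separableClosure k k')
  refine ⟨x, mem_separableClosure_iff.1 x.2, ?_⟩
  have h : minpoly k (x : k') = minpoly k x :=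
    minpoly.algebraMap_eq (algebraMap (separableClosure k k') k').injective x
  rw [Field.finSepDegree_eq, Field.sepDegree, ← Module.finrank, h,
    ← IntermediateField.adjoin.finrank (Algebra.IsIntegral.isIntegral x), hx,
    IntermediateField.finrank_top']

variable (A C k k' : Type*) [CommRing A] [IsLocalRing A] [CommRing C] [IsLocalRing C]
  [Algebra A C] [Module.Finite A C] [Field k] [Field k'] [Algebra A k] [Algebra C k']
  [Algebra k k'] [Algebra A k'] [IsScalarTower A k k'] [IsScalarTower A C k']
  (hk : Function.Surjective (algebraMap A k)) (hk' : Function.Surjective (algebraMap C k'))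

include A in
omit [IsLocalRing A] [IsLocalRing C] in
theorem Module.Finite.of_surjective_algebraMap (hk' : Function.Surjective (algebraMap C k')) :
    Module.Finite k k' := by
  have : Module.Finite A k' :=
    .of_surjective (IsScalarTower.toAlgHom A C k').toLinearMap hk'
  exact .of_restrictScalars_finite A k k'

variable {A C}

-- Nakayama applies because $C/m_AC$ is the residue field $k'$.
include hk hk' in
theorem span_range_eq_top_of_map_maximalIdeal_eq
    (hm : (maximalIdeal A).map (algebraMap A C) = maximalIdeal C) {ι : Type*} (b : ι → C)
    (hb : Submodule.span k (Set.range (algebraMap C k' ∘ b)) = ⊤) :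
    Submodule.span A (Set.range b) = ⊤ := by
  rw [eq_top_iff]
  refine Submodule.le_of_le_smul_of_le_jacobson_bot (I := maximalIdeal A) Module.Finite.fg_top
    (maximalIdeal_le_jacobson _) ?_
  intro c _
  let f := (IsScalarTower.toAlgHom A C k').toLinearMap
  have h1 : algebraMap C k' c ∈ Submodule.span A (Set.range (algebraMap C k' ∘ b)) := by
    have h2 : algebraMap C k' c ∈ Submodule.span k (Set.range (algebraMap C k' ∘ b)) :=
      hb ▸ Submodule.mem_top
    rwa [← SetLike.mem_coe, Submodule.coe_span_eq_span_of_surjective A k hk] at h2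
  have h3 : Submodule.span A (Set.range (algebraMap C k' ∘ b)) =
      (Submodule.span A (Set.range b)).map f := by
    rw [Submodule.map_span, ← Set.range_comp]; rfl
  rw [h3] at h1
  obtain ⟨y, hy, hyc⟩ := h1
  have h4 : c - y ∈ maximalIdeal C := by
    rw [← algebraMap_eq_zero_iff_mem_maximalIdeal hk', map_sub, sub_eq_zero]
    exact hyc.symm
  rw [← hm] at h4
  have h5 : c - y ∈ maximalIdeal A • (⊤ : Submodule A C) := by
    rw [Ideal.smul_top_eq_map]; exact h4
  rw [← sub_add_cancel c y, add_comm]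
  exact Submodule.add_mem_sup hy h5

omit [IsLocalRing A] [IsLocalRing C] [Module.Finite A C] in
theorem minpoly_dvd_map_minpoly (θ : C) :
    minpoly k (algebraMap C k' θ) ∣ (minpoly A θ).map (algebraMap A k) :=
  minpoly.dvd _ _ (by
    rw [Polynomial.aeval_map_algebraMap, Polynomial.aeval_algebraMap_apply, minpoly.aeval,
      map_zero])

variable [IsDomain A] [IsDomain C] [IsIntegrallyClosed A] [FaithfulSMul A C]
  (E E' : Type*) [Field E] [Algebra A E] [IsFractionRing A E]
  [Field E'] [Algebra C E'] [IsFractionRing C E'] [Algebra E E'] [Algebra A E']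
  [IsScalarTower A E E'] [IsScalarTower A C E']

include hk'

-- The minimal polynomial over $A$ of a lift of a generator of the separable closure has degree at
-- least $g$ by reduction, and at most $d$ by normality.
variable (A) in
include A in
omit [IsLocalRing A] [IsLocalRing C] in
theorem finSepDegree_le_finrank_of_isFractionRing :
    Field.finSepDegree k k' ≤ Module.finrank E E' := by
  have : Module.Finite k k' := .of_surjective_algebraMap A C k k' hk'
  obtain ⟨x, -, hx⟩ := exists_isSeparable_natDegree_minpoly_eq_finSepDegree k k'
  obtain ⟨θ, rfl⟩ := hk' x
  have hmon := minpoly.monic (Algebra.IsIntegral.isIntegral (R := A) θ)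
  rw [← hx]
  refine (Polynomial.natDegree_le_of_dvd (minpoly_dvd_map_minpoly k k' (A := A) θ)
    (hmon.map _).ne_zero).trans ?_
  rw [hmon.natDegree_map]
  exact natDegree_minpoly_le_finrank A E E' θ

include hk

theorem finrank_eq_finSepDegree_of_map_maximalIdeal_eq
    (hm : (maximalIdeal A).map (algebraMap A C) = maximalIdeal C) [Algebra.IsSeparable k k'] :
    Module.finrank E E' = Field.finSepDegree k k' := by
  have : Module.Finite k k' := .of_surjective_algebraMap A C k k' hk'
  refine le_antisymm ?_ (finSepDegree_le_finrank_of_isFractionRing A k k' hk' E E')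
  let b := Module.finBasis k k'
  choose c hc using fun i => hk' (b i)
  have h := finrank_le_card_of_span_eq_top A E E' c
    (span_range_eq_top_of_map_maximalIdeal_eq k k' hk hk' hm c (by
      rw [← b.span_eq]; congr 2; exact funext hc))
  rwa [Fintype.card_fin, ← Field.finSepDegree_eq_finrank_of_isSeparable k k'] at h

/-- Equality leaves no room between the minimal polynomial of $\theta$ and that of its separable
residue. Hence the derivative at $\theta$ is a unit and $C=A[\theta]$. -/
theorem map_maximalIdeal_eq_of_finrank_eq_finSepDegree
    (h : Module.finrank E E' = Field.finSepDegree k k') :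
    (maximalIdeal A).map (algebraMap A C) = maximalIdeal C ∧ Algebra.IsSeparable k k' := by
  have : Module.Finite k k' := .of_surjective_algebraMap A C k k' hk'
  obtain ⟨x, hsep, hx⟩ := exists_isSeparable_natDegree_minpoly_eq_finSepDegree k k'
  obtain ⟨θ, rfl⟩ := hk' x
  have hmon := minpoly.monic (Algebra.IsIntegral.isIntegral (R := A) θ)
  have hdvd := minpoly_dvd_map_minpoly k k' (A := A) θ
  have hle := natDegree_minpoly_le_finrank A E E' θ
  have hge := Polynomial.natDegree_le_of_dvd hdvd (hmon.map _).ne_zero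
  rw [hmon.natDegree_map, hx, ← h] at hge
  have hmin : (minpoly A θ).map (algebraMap A k) = minpoly k (algebraMap C k' θ) :=
    Polynomial.eq_of_monic_of_dvd_of_natDegree_le
      (minpoly.monic (Algebra.IsIntegral.isIntegral _)) (hmon.map _) hdvd
      (by rw [hmon.natDegree_map, hx, ← h]; exact hle)
  have hunit : IsUnit (Polynomial.aeval θ (minpoly A θ).derivative) := by
    rw [← notMem_maximalIdeal, ← algebraMap_eq_zero_iff_mem_maximalIdeal hk',
      ← Polynomial.aeval_algebraMap_apply, ← Polynomial.aeval_map_algebraMap k,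
      ← Polynomial.derivative_map, hmin]
    exact hsep.aeval_derivative_ne_zero (minpoly.aeval _ _)
  have hmem (c : C) : c ∈ Algebra.adjoin A {θ} := by
    obtain ⟨u, hu⟩ := hunit
    have h1 := aeval_derivative_minpoly_mul_mem_adjoin A E E' θ (↑u⁻¹ * c) (le_antisymm hle hge)
      (hu ▸ u.ne_zero)
    rwa [← hu, Units.mul_inv_cancel_left] at h1
  have hpoly (c : C) : ∃ p : Polynomial A, Polynomial.aeval θ p = c := by
    have := hmem c
    rwa [Algebra.adjoin_singleton_eq_range_aeval] at this
  constructor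
  · refine le_antisymm ?_ ?_
    · exact (((local_hom_TFAE (algebraMap A C)).out 0 2 rfl rfl).mp inferInstance)
    · intro c hc
      obtain ⟨p, rfl⟩ := hpoly c
      rw [← algebraMap_eq_zero_iff_mem_maximalIdeal hk', ← Polynomial.aeval_algebraMap_apply,
        ← Polynomial.aeval_map_algebraMap k] at hc
      -- If $p(\theta)\in m_C$, then $\bar f$ divides $\bar p$. Subtracting a multiple of $f$ leaves
      -- the value at $\theta$ unchanged and moves all coefficients into $m_A$.
      obtain ⟨q, hq⟩ := minpoly.dvd _ _ hc
      obtain ⟨q, rfl⟩ := Polynomial.map_surjective _ hk q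
      have h1 : (p - minpoly A θ * q).map (algebraMap A k) = 0 := by
        rw [Polynomial.map_sub, Polynomial.map_mul, hmin, hq, sub_self]
      have h2 : Polynomial.aeval θ p = Polynomial.aeval θ (p - minpoly A θ * q) := by
        rw [map_sub, map_mul, minpoly.aeval, zero_mul, sub_zero]
      rw [h2, Polynomial.aeval_eq_sum_range]
      refine Ideal.sum_mem _ fun i _ => ?_
      rw [Algebra.smul_def]
      refine Ideal.mul_mem_right _ _ (Ideal.mem_map_of_mem _ ?_)
      rw [← algebraMap_eq_zero_iff_mem_maximalIdeal hk, ← Polynomial.coeff_map, h1,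
        Polynomial.coeff_zero]
  · refine (separableClosure.eq_top_iff k k').1 (eq_top_iff.2 fun y _ => ?_)
    obtain ⟨c, rfl⟩ := hk' y
    obtain ⟨p, rfl⟩ := hpoly c
    rw [← Polynomial.aeval_algebraMap_apply, ← Polynomial.aeval_map_algebraMap k]
    have hx' : algebraMap C k' θ ∈ separableClosure k k' := mem_separableClosure_iff.2 hsep
    exact Algebra.adjoin_le (S := (separableClosure k k').toSubalgebra)
      (Set.singleton_subset_iff.2 hx') (Polynomial.aeval_mem_adjoin_singleton k _)

end LocalExtensionDegree

/-! ### Residue fields of completions and the main theorem. -/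

namespace LocalCompletion

variable (R : Type u) [CommRing R] [IsLocalRing R] [IsNoetherianRing R]

/-- The residue map of the completion of a local ring, with values in the residue field of the
ring itself. -/
noncomputable def toResidueField : LocalCompletion R →+* ResidueField R :=
  (RingEquiv.ofBijective _ (AdicCompletion.residueField_map_bijective R)).symm.toRingHom.comp
    (residue _)

theorem toResidueField_algebraMap (r : R) :
    toResidueField R (algebraMap R (LocalCompletion R) r) = residue R r := by
  rw [toResidueField, RingHom.comp_apply, ← ResidueField.map_residue]
  exact (RingEquiv.ofBijective _ (AdicCompletion.residueField_map_bijective R)).symm_apply_apply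
    (residue R r)

theorem toResidueField_surjective : Function.Surjective (toResidueField R) :=
  (RingEquiv.ofBijective _
    (AdicCompletion.residueField_map_bijective R)).symm.surjective.comp residue_surjective

end LocalCompletion

theorem toResidueField_completionMap (R : Type u) (R' : Type v) [CommRing R] [CommRing R']
    [IsLocalRing R] [IsLocalRing R'] [IsNoetherianRing R] [IsNoetherianRing R'] [Algebra R R']
    [IsLocalHom (algebraMap R R')] (x : LocalCompletion R) :
    LocalCompletion.toResidueField R' (completionMap R R' x) =
      algebraMap (ResidueField R) (ResidueField R') (LocalCompletion.toResidueField R x) := by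
  obtain ⟨r, hr⟩ := residue_surjective (LocalCompletion.toResidueField R x)
  have h : x - algebraMap R (LocalCompletion R) r ∈ maximalIdeal (LocalCompletion R) := by
    let := (LocalCompletion.toResidueField R).toAlgebra
    rw [← algebraMap_eq_zero_iff_mem_maximalIdeal (LocalCompletion.toResidueField_surjective R),
      map_sub, sub_eq_zero]
    exact hr.symm.trans (LocalCompletion.toResidueField_algebraMap R r).symm
  have h2 : completionMap R R' (x - algebraMap R (LocalCompletion R) r) ∈
      maximalIdeal (LocalCompletion R') := by
    rw [AdicCompletion.maximalIdeal_eq_map] at h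
    have h3 := Ideal.mem_map_of_mem (completionMap R R') h
    rw [Ideal.map_map, AdicCompletion.maximalIdeal_eq_map] at *
    have h4 : (completionMap R R').comp (algebraMap R (LocalCompletion R)) =
        (algebraMap R' (LocalCompletion R')).comp (algebraMap R R') :=
      RingHom.ext (completionMap_algebraMap R R')
    rw [h4, ← Ideal.map_map] at h3
    exact Ideal.map_mono (((local_hom_TFAE (algebraMap R R')).out 0 2 rfl rfl).mp inferInstance) h3
  let := (LocalCompletion.toResidueField R').toAlgebra
  rw [← algebraMap_eq_zero_iff_mem_maximalIdeal (LocalCompletion.toResidueField_surjective R'),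
    map_sub, map_sub, sub_eq_zero, completionMap_algebraMap] at h2
  refine h2.trans ?_
  rw [← hr]
  exact LocalCompletion.toResidueField_algebraMap R' _

theorem completionFractionMap_algebraMap {R : Type u} {R' : Type v} [CommRing R] [CommRing R']
    [IsLocalRing R] [IsLocalRing R'] [Algebra R R'] [IsLocalHom (algebraMap R R')]
    [IsDomain (LocalCompletion R)] [IsDomain (LocalCompletion R')]
    (h : Function.Injective (completionMap R R')) (x : LocalCompletion R) :
    completionFractionMap h (algebraMap _ _ x) = algebraMap _ _ (completionMap R R' x) :=
  IsLocalization.map_eq (M := nonZeroDivisors (LocalCompletion R))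
    (T := nonZeroDivisors (LocalCompletion R')) (g := completionMap R R')
    (nonZeroDivisors_le_comap_nonZeroDivisors_of_injective _ h) x

theorem proposition4p4
    {R : Type u} [CommRing R] [IsDomain R] [IsLocalRing R] [IsIntegrallyClosed R]
    [IsExcellentRing R]
    {K : Type v} [Field K] [Algebra R K] [IsFractionRing R K]
    {K' : Type w} [Field K'] [Algebra K K'] [FiniteDimensional K K']
    [Algebra R K'] [IsScalarTower R K K']
    {R' : Type*} [CommRing R'] [IsDomain R'] [IsLocalRing R'] [IsIntegrallyClosed R']
    [Algebra R' K'] [IsFractionRing R' K']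
    [Algebra R R'] [IsScalarTower R R' K']
    (hR' : LiesOver R K' R') :
    haveI : IsLocalHom (algebraMap R R') := hR'.isLocalHom
    ∃ (_ : IsDomain (LocalCompletion R)) (_ : IsDomain (LocalCompletion R'))
      (h : Function.Injective (completionMap R R')),
      (completionFractionMap h).Finite ∧
      Module.Finite (ResidueField R) (ResidueField R') ∧
      (IsUnramifiedLocalExtension R R' ↔ ramificationRatio h = 1) := by
  have hloc : IsLocalHom (algebraMap R R') := hR'.isLocalHom
  have : IsLocalization.AtPrime R (maximalIdeal R) := IsLocalization.self fun x hx => by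
    simpa [IsUnit.mem_submonoid_iff, Ideal.mem_primeCompl_iff] using hx
  have hff : HasGeometricallyRegularFormalFibers R :=
    IsExcellentRing.formalFibers (maximalIdeal R) R
  let S := integralClosure R K'
  have : Module.Finite R S := hff.finite_integralClosure R K K'
  have : IsNoetherianRing S := isNoetherian_of_tower R inferInstance
  have : IsFractionRing S K' := integralClosure.isFractionRing_of_finite_extension K K'
  have : IsIntegrallyClosed S := integralClosure.isIntegrallyClosedOfFiniteExtension K
  obtain ⟨n, hn, f, htower, hloc'⟩ := hR'.exists_isLocalization
  let : Algebra S R' := f.toAlgebra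
  have : IsScalarTower R S R' := .of_algebraMap_eq fun r => (f.commutes r).symm
  have : IsNoetherianRing R' := IsLocalization.isNoetherianRing n.primeCompl R' inferInstance
  let : Algebra (LocalCompletion R) (LocalCompletion R') := (completionMap R R').toAlgebra
  have : IsScalarTower R (LocalCompletion R) (LocalCompletion R') := .of_algebraMap_eq fun r => by
    rw [IsScalarTower.algebraMap_apply R R' (LocalCompletion R')]
    exact (completionMap_algebraMap R R' r).symm
  have hA : IsDomain (LocalCompletion R) := hff.isDomain_localCompletion
  have : IsIntegrallyClosed (LocalCompletion R) := hff.isIntegrallyClosed_localCompletion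
  have hC : IsDomain (LocalCompletion R') := hff.isDomain_localCompletion_localization n hloc K K'
  have hinj : Function.Injective (completionMap R R') :=
    LocalCompletion.algebraMap_injective_of_isLocalization n hloc K K'
  have : FaithfulSMul (LocalCompletion R) (LocalCompletion R') :=
    (faithfulSMul_iff_algebraMap_injective _ _).2 hinj
  have : Module.Finite (LocalCompletion R) (LocalCompletion R') := .localCompletion n hloc
  let := (completionFractionMap hinj).toAlgebra
  have : IsScalarTower (LocalCompletion R) (FractionRing (LocalCompletion R))
      (FractionRing (LocalCompletion R')) := .of_algebraMap_eq fun r => by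
    rw [IsScalarTower.algebraMap_apply _ (LocalCompletion R') (FractionRing (LocalCompletion R'))]
    exact (completionFractionMap_algebraMap hinj r).symm
  let := (LocalCompletion.toResidueField R).toAlgebra
  let := (LocalCompletion.toResidueField R').toAlgebra
  let : Algebra (LocalCompletion R) (ResidueField R') :=
    ((LocalCompletion.toResidueField R').comp (completionMap R R')).toAlgebra
  have : IsScalarTower (LocalCompletion R) (LocalCompletion R') (ResidueField R') :=
    .of_algebraMap_eq fun r => rfl
  have : IsScalarTower (LocalCompletion R) (ResidueField R) (ResidueField R') :=
    .of_algebraMap_eq (toResidueField_completionMap R R')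
  have hfin : Module.Finite (ResidueField R) (ResidueField R') :=
    .of_surjective_algebraMap (LocalCompletion R) (LocalCompletion R') _ _
      (LocalCompletion.toResidueField_surjective R')
  -- Ideals of $R'$ are recovered from their extensions to $\hat R'$ by faithful flatness, so this
  -- condition can be tested on completions.
  have hm : (maximalIdeal R).map (algebraMap R R') = maximalIdeal R' ↔
      (maximalIdeal (LocalCompletion R)).map
        (algebraMap (LocalCompletion R) (LocalCompletion R')) =
          maximalIdeal (LocalCompletion R') := by
    rw [map_maximalIdeal_localCompletion, AdicCompletion.maximalIdeal_eq_map (R := R')]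
    refine ⟨fun h => by rw [h], fun h => ?_⟩
    rw [← Ideal.comap_map_eq_self_of_faithfullyFlat (B := LocalCompletion R')
      ((maximalIdeal R).map (algebraMap R R')), h,
      Ideal.comap_map_eq_self_of_faithfullyFlat]
  refine ⟨hA, hC, hinj, ?_, hfin, ?_⟩
  · exact Module.Finite.of_isFractionRing_of_finite (LocalCompletion R) (LocalCompletion R')
      (FractionRing (LocalCompletion R)) (FractionRing (LocalCompletion R'))
  · have hk := LocalCompletion.toResidueField_surjective R
    have hk' := LocalCompletion.toResidueField_surjective R'
    have hg : (residueSeparableDegree R R' : ℚ) ≠ 0 :=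
      Nat.cast_ne_zero.2 (NeZero.ne (Field.finSepDegree (ResidueField R) (ResidueField R')))
    rw [ramificationRatio, div_eq_one_iff_eq hg, Nat.cast_inj, IsUnramifiedLocalExtension, hm]
    constructor
    · rintro ⟨h1, -, h2⟩
      exact finrank_eq_finSepDegree_of_map_maximalIdeal_eq _ _ hk hk'
        (FractionRing (LocalCompletion R)) (FractionRing (LocalCompletion R')) h1
    · intro h
      obtain ⟨h1, h2⟩ := map_maximalIdeal_eq_of_finrank_eq_finSepDegree _ _ hk hk'
        (FractionRing (LocalCompletion R)) (FractionRing (LocalCompletion R')) h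
      exact ⟨h1, hfin, h2⟩
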